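/- Let $p$ be a prime, $k$ a perfect field of characteristic $p$, $\mathfrak S=W(k)[[u]]$ with its Frobenius $\varphi$ (the Witt vector Frobenius on $W(k)$, and $u\mapsto u^p$), and let $E\in W(k)[u]$ be a monic Eisenstein polynomial of degree $e\ge 1$ (equivalently, the minimal polynomial of a uniformizer of a finite totally ramified extension of $\operatorname{Frac}W(k)$). A Kisin module is a finite free $\mathfrak S$-module $M$ with an isomorphism $\varphi_M:(\varphi^*M)[\tfrac1E]\simeq M[\tfrac1E]$. Its rank is $r=\operatorname{rank}_{\mathfrak S}M$ and its degree is $d=\nu\bigl(M_{(E)},\varphi_M(\varphi^*M)_{(E)}\bigr)\in\mathbb Z$, where for two lattices $L_1=\bigoplus_j O e_j$, $L_2=\bigoplus_j O\pi^{-a_j}e_j$ over a discrete valuation ring $O$ with uniformizer $\pi$ one puts $\nu(L_1,L_2)=\sum_j a_j$. A $p^\infty$-torsion Kisin module is a finitely generated $\mathfrak S$-module $T$ killed by a power of $p$ and without $u$-torsion, with an isomorphism $\varphi_T:(\varphi^*T)[\tfrac1E]\simeq T[\tfrac1E]$. Its rank is $\operatorname{length}_{W(k)}(T/uT)$ and its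 degree is $\tfrac1e\bigl(-\operatorname{length}_{\mathfrak S}(T/u^i\varphi_T(\varphi^*T))+i\operatorname{rank}T\bigr)$ for any $i\ge 0$ with $u^i\varphi_T(\varphi^*T)\subseteq T$; its slope, if $T\ne0$, is degree over rank. A subobject $T'\subseteq T$ is strict if $T/T'$ has no $u$-torsion, and $T\neq 0$ is semistable if no nonzero strict subobject has larger slope. A Harder–Narasimhan filtration of $T$ is a flag $0=T_0\subset T_1\subset\dots\subset T_s=T$ of strict subobjects whose graded pieces $T_i/T_{i-1}$ are semistable of strictly decreasing slopes; its polygon is the concave function on $[0,\operatorname{rank}T]$ that vanishes at $0$ and is affine on $[\operatorname{rank}T_{i-1},\operatorname{rank}T_i]$ with slope that of $T_i/T_{i-1}$. Let $M$ be a Kisin module of rank $r$ and degree $d$. For every $n\ge1$ the $p^\infty$-torsion Kisin module $M/p^nM$ has a unique Harder–Narasimhan filtration; let $t_{F,t}(M/p^nM)$ be its polygon and put $$t_{F,n}(M)(x)=\tfrac1n\,t_{F,t}(M/p^nM)(nx),\qquad x\in[0,r].$$ Then the functions $t_{F,n}(M)$ converge uniformly on $[0,r]$, for $n$ in the positive integers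 ordered by divisibility, to a continuous concave function $t_{F,\infty}(M):[0,r]\to\mathbb R$ (that is, for every $\varepsilon>0$ there is $N\ge1$ such that $|t_{F,n}(M)(x)-t_{F,\infty}(M)(x)|<\varepsilon$ for all $x\in[0,r]$ and all $n\geq 1$ divisible by $N$). Moreover $t_{F,\infty}(M)(x)=\inf_{n\ge1}t_{F,n}(M)(x)$ for all $x\in[0,r]$, $t_{F,\infty}(M)(0)=0$ and $t_{F,\infty}(M)(r)=d$. Finally, $t_{F,\infty}(M)$ depends only on the isogeny class of $M$: if $M'$ is a Kisin module (for the same $E$) with $M\otimes\mathbb Q_p\simeq M'\otimes\mathbb Q_p$ in the category of Kisin modules up to isogeny (morphisms tensored with $\mathbb Q_p$), then $M$ and $M'$ have the same rank and $t_{F,\infty}(M)=t_{F,\infty}(M')$. -/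

import Mathlib

open TensorProduct
open scoped Polynomial

universe u v w

namespace KisinModules

section PhiModules

variable {R : Type u} [CommRing R]

/-- The ring `R`, regarded as an `R`-algebra through the ring endomorphism `φ`. -/
def Twist (_φ : R →+* R) : Type u := R

noncomputable instance (φ : R →+* R) : CommRing (Twist φ) := inferInstanceAs (CommRing R)

noncomputable instance (φ : R →+* R) : Algebra R (Twist φ) := RingHom.toAlgebra (S := R) φ

/-- The pullback `φ^* M = R ⊗_{φ, R} M`. -/
def Pullback (φ : R →+* R) (M : Type v) [AddCommGroup M] [Module R M] : Type (max u v) :=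
  Twist φ ⊗[R] M

noncomputable instance (φ : R →+* R) (M : Type v) [AddCommGroup M] [Module R M] :
    AddCommGroup (Pullback φ M) := inferInstanceAs (AddCommGroup (Twist φ ⊗[R] M))

/-- `R` acts on `φ^* M = R ⊗_{φ, R} M` through the left factor. -/
noncomputable instance (φ : R →+* R) (M : Type v) [AddCommGroup M] [Module R M] :
    Module R (Pullback φ M) := inferInstanceAs (Module (Twist φ) (Twist φ ⊗[R] M))

/-- The map `φ^* f : φ^* M → φ^* N`. -/
noncomputable def Pullback.map (φ : R →+* R) {M N : Type*} [AddCommGroup M] [Module R M]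
    [AddCommGroup N] [Module R N] (f : M →ₗ[R] N) : Pullback φ M →ₗ[R] Pullback φ N :=
  (f.baseChange (Twist φ) : Twist φ ⊗[R] M →ₗ[Twist φ] Twist φ ⊗[R] N)

/-- The localized module `M[1/E]`. -/
abbrev Away (E : R) (M : Type v) [AddCommGroup M] [Module R M] : Type (max u v) :=
  LocalizedModule (Submonoid.powers E) M

/-- The map `f[1/E] : M[1/E] → N[1/E]`. -/
noncomputable abbrev Away.map (E : R) {M N : Type*} [AddCommGroup M] [Module R M]
    [AddCommGroup N] [Module R N] (f : M →ₗ[R] N) :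
    Away E M →ₗ[Localization.Away E] Away E N :=
  LocalizedModule.map (Submonoid.powers E) f

section functoriality

variable (φ : R →+* R) (E : R) {L M N : Type*} [AddCommGroup L] [Module R L]
  [AddCommGroup M] [Module R M] [AddCommGroup N] [Module R N]

lemma Pullback.map_comp (g : M →ₗ[R] N) (f : L →ₗ[R] M) :
    Pullback.map φ (g ∘ₗ f) = Pullback.map φ g ∘ₗ Pullback.map φ f :=
  LinearMap.baseChange_comp (A := Twist φ) f g

lemma Pullback.map_surjective {f : M →ₗ[R] N} (hf : Function.Surjective f) :
    Function.Surjective (Pullback.map φ f) :=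
  LinearMap.lTensor_surjective (Twist φ) hf

lemma Pullback.map_injective [Module.Flat R (Twist φ)] {f : M →ₗ[R] N}
    (hf : Function.Injective f) : Function.Injective (Pullback.map φ f) :=
  Module.Flat.lTensor_preserves_injective_linearMap (M := Twist φ) f hf

lemma Away.map_comp (g : M →ₗ[R] N) (f : L →ₗ[R] M) :
    Away.map E (g ∘ₗ f) = Away.map E g ∘ₗ Away.map E f := by
  ext x
  induction x using LocalizedModule.induction_on with
  | h m s => simp [Away.map, LocalizedModule.map_mk]

lemma Away.map_surjective {f : M →ₗ[R] N} (hf : Function.Surjective f) :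
    Function.Surjective (Away.map E f) :=
  LocalizedModule.map_surjective _ f hf

lemma Away.map_injective {f : M →ₗ[R] N} (hf : Function.Injective f) :
    Function.Injective (Away.map E f) :=
  LocalizedModule.map_injective _ f hf

lemma Away.map_exact {f : L →ₗ[R] M} {g : M →ₗ[R] N} (h : Function.Exact f g) :
    LinearMap.ker (Away.map E g) = LinearMap.range (Away.map E f) :=
  LinearMap.exact_iff.mp (LocalizedModule.map_exact (Submonoid.powers E) f g h)

lemma Away.range_comp (f : M →ₗ[R] N) {g : L →ₗ[R] M} (hg : Function.Surjective g) :
    LinearMap.range (Away.map E (f ∘ₗ g)) = LinearMap.range (Away.map E f) := by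
  rw [Away.map_comp, LinearMap.range_comp_of_range_eq_top]
  exact LinearMap.range_eq_top.mpr (Away.map_surjective E hg)

lemma Away.range_pullback_comp (f : M →ₗ[R] N) {g : L →ₗ[R] M} (hg : Function.Surjective g) :
    LinearMap.range (Away.map E (Pullback.map φ (f ∘ₗ g)))
      = LinearMap.range (Away.map E (Pullback.map φ f)) := by
  rw [Pullback.map_comp, Away.range_comp E _ (Pullback.map_surjective φ hg)]

lemma Away.map_lsmul (c : R) :
    Away.map E (LinearMap.lsmul R M c)
      = LinearMap.lsmul (Localization.Away E) (Away E M) (algebraMap R _ c) := by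
  ext z
  induction z using LocalizedModule.induction_on with
  | h m s => simp [Away.map, LocalizedModule.map_mk, LocalizedModule.smul'_mk]

lemma Pullback.map_lsmul (c : R) :
    Pullback.map φ (LinearMap.lsmul R M c) = LinearMap.lsmul R (Pullback φ M) (φ c) := by
  have h : ∀ z : Twist φ ⊗[R] M, (LinearMap.lsmul R M c).baseChange (Twist φ) z
      = (algebraMap R (Twist φ) c) • z := by
    intro z
    induction z using TensorProduct.induction_on with
    | zero => simp
    | add x y hx hy => rw [map_add, hx, hy, smul_add]
    | tmul a m =>
      rw [LinearMap.baseChange_tmul, LinearMap.lsmul_apply, TensorProduct.tmul_smul,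
        TensorProduct.smul_tmul', TensorProduct.smul_tmul', Algebra.smul_def, smul_eq_mul]
  exact LinearMap.ext fun z => h z

end functoriality

/-- A Frobenius on `M`: an `R[1/E]`-linear isomorphism `φ_M : (φ^* M)[1/E] ≃ M[1/E]`. -/
abbrev FrobStr (φ : R →+* R) (E : R) (M : Type v) [AddCommGroup M] [Module R M] :
    Type (max u v) :=
  Away E (Pullback φ M) ≃ₗ[Localization.Away E] Away E M

section structures

variable {φ : R →+* R} {E : R} {M : Type v} [AddCommGroup M] [Module R M]

/-- The linear map `f : M → N` is a morphism `(M, F) → (N, G)`, i.e. compatible with Frobenius. -/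
def IsPhiHom {N : Type*} [AddCommGroup N] [Module R N] (F : FrobStr φ E M) (G : FrobStr φ E N)
    (f : M →ₗ[R] N) : Prop :=
  ∀ z : Away E (Pullback φ M), Away.map E f (F z) = G (Away.map E (Pullback.map φ f) z)

/-- `N ⊆ M` is a subobject of `(M, F)`: `F` maps `(φ^* N)[1/E]` onto `N[1/E]`. -/
def IsStable (F : FrobStr φ E M) (N : Submodule R M) : Prop :=
  (LinearMap.range (Away.map E (Pullback.map φ N.subtype))).map F.toLinearMap
    = LinearMap.range (Away.map E N.subtype)

/-- The Frobenius induced on a subobject; see `isPhiHom_subtype`. For `φ` flat the maps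
`(φ^* N)[1/E] → (φ^* M)[1/E]` and `N[1/E] → M[1/E]` are injective. -/
noncomputable def FrobStr.sub [Module.Flat R (Twist φ)] (F : FrobStr φ E M)
    (N : Submodule R M) (h : IsStable F N) : FrobStr φ E N :=
  (LinearEquiv.ofInjective (Away.map E (Pullback.map φ N.subtype))
      (Away.map_injective E (Pullback.map_injective φ N.injective_subtype))) ≪≫ₗ
    (LinearEquiv.submoduleMap F _) ≪≫ₗ (LinearEquiv.ofEq _ _ h) ≪≫ₗ
    (LinearEquiv.ofInjective (Away.map E N.subtype)
      (Away.map_injective E N.injective_subtype)).symm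

lemma isPhiHom_subtype [Module.Flat R (Twist φ)] (F : FrobStr φ E M)
    (N : Submodule R M) (h : IsStable F N) : IsPhiHom (F.sub N h) F N.subtype := by
  intro z
  set b := LinearEquiv.ofInjective (Away.map E N.subtype)
      (Away.map_injective E N.injective_subtype) with hb
  have key : ∀ y, Away.map E N.subtype (b.symm y) = (y : Away E M) := by
    intro y
    conv_rhs => rw [← b.apply_symm_apply y]
    rfl
  exact key _

lemma IsStable.map_ker {F : FrobStr φ E M} {N : Submodule R M} (h : IsStable F N) :
    (LinearMap.ker (Away.map E (Pullback.map φ N.mkQ))).map F.toLinearMap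
      = LinearMap.ker (Away.map E N.mkQ) := by
  have ex : Function.Exact N.subtype N.mkQ := by
    rw [LinearMap.exact_iff, Submodule.ker_mkQ, Submodule.range_subtype]
  have ex' : Function.Exact (Pullback.map φ N.subtype) (Pullback.map φ N.mkQ) :=
    lTensor_exact (Twist φ) ex N.mkQ_surjective
  rw [Away.map_exact E ex, Away.map_exact E ex']
  exact h

/-- The Frobenius induced on the quotient by a subobject; see `isPhiHom_mkQ`. -/
noncomputable def FrobStr.quot (F : FrobStr φ E M)
    (N : Submodule R M) (h : IsStable F N) : FrobStr φ E (M ⧸ N) :=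
  ((Away.map E (Pullback.map φ N.mkQ)).quotKerEquivOfSurjective
      (Away.map_surjective E (Pullback.map_surjective φ N.mkQ_surjective))).symm ≪≫ₗ
    (Submodule.Quotient.equiv _ _ F h.map_ker) ≪≫ₗ
    ((Away.map E N.mkQ).quotKerEquivOfSurjective (Away.map_surjective E N.mkQ_surjective))

lemma isPhiHom_mkQ (F : FrobStr φ E M) (N : Submodule R M) (h : IsStable F N) :
    IsPhiHom F (F.quot N h) N.mkQ := by
  intro z
  set a := (Away.map E (Pullback.map φ N.mkQ)).quotKerEquivOfSurjective
      (Away.map_surjective E (Pullback.map_surjective φ N.mkQ_surjective)) with ha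
  have key : a.symm (Away.map E (Pullback.map φ N.mkQ) z) = Submodule.Quotient.mk z := by
    rw [LinearEquiv.symm_apply_eq]; rfl
  change _ = ((Away.map E N.mkQ).quotKerEquivOfSurjective
      (Away.map_surjective E N.mkQ_surjective))
    (Submodule.Quotient.equiv _ _ F h.map_ker
      (a.symm (Away.map E (Pullback.map φ N.mkQ) z)))
  rw [key]; rfl

lemma IsStable.submoduleOf [Module.Flat R (Twist φ)] {F : FrobStr φ E M}
    {N N' : Submodule R M} (h : IsStable F N) (h' : IsStable F N') (hle : N ≤ N') :
    IsStable (F.sub N' h') (N.submoduleOf N') := by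
  let e := (Submodule.submoduleOfEquivOfLe hle)
  have hcomp : N'.subtype ∘ₗ (N.submoduleOf N').subtype = N.subtype ∘ₗ e.toLinearMap := by
    ext x; rfl
  have hinj := Away.map_injective E N'.injective_subtype
  apply Submodule.map_injective_of_injective hinj
  have comm : Away.map E N'.subtype ∘ₗ (F.sub N' h').toLinearMap
      = F.toLinearMap ∘ₗ Away.map E (Pullback.map φ N'.subtype) :=
    LinearMap.ext (isPhiHom_subtype F N' h')
  have h1 : Away.map E N'.subtype ∘ₗ Away.map E (N.submoduleOf N').subtype
      = Away.map E (N.subtype ∘ₗ e.toLinearMap) := by rw [← Away.map_comp, hcomp]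
  have h2 : Away.map E (Pullback.map φ N'.subtype) ∘ₗ
      Away.map E (Pullback.map φ (N.submoduleOf N').subtype)
      = Away.map E (Pullback.map φ (N.subtype ∘ₗ e.toLinearMap)) := by
    rw [← Away.map_comp, ← Pullback.map_comp, hcomp]
  rw [← Submodule.map_comp, comm, Submodule.map_comp, ← LinearMap.range_comp, h2,
    Away.range_pullback_comp φ E _ e.surjective, h, ← LinearMap.range_comp, h1,
    Away.range_comp E N.subtype e.surjective]

lemma isStable_smul_top (F : FrobStr φ E M) {c : R} (hc : φ c = c) :
    IsStable F (Ideal.span {c} • (⊤ : Submodule R M)) := by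
  set N : Submodule R M := Ideal.span {c} • ⊤ with hN
  have hmem : ∀ x : M, c • x ∈ N := fun x =>
    Submodule.smul_mem_smul (Ideal.mem_span_singleton_self c) trivial
  let g : M →ₗ[R] N := LinearMap.codRestrict N (LinearMap.lsmul R M c) hmem
  have hg : Function.Surjective g := by
    rintro ⟨y, hy⟩
    have hy' := hy
    rw [hN, Submodule.ideal_span_singleton_smul, Submodule.mem_smul_pointwise_iff_exists] at hy'
    obtain ⟨x, -, hx⟩ := hy'
    exact ⟨x, Subtype.ext hx⟩
  have hcomp : N.subtype ∘ₗ g = LinearMap.lsmul R M c := by ext x; rfl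
  rw [IsStable, ← Away.range_comp E N.subtype hg, ← Away.range_pullback_comp φ E N.subtype hg,
    hcomp, Pullback.map_lsmul, hc, Away.map_lsmul, Away.map_lsmul, ← LinearMap.range_comp]
  have hF : F.toLinearMap ∘ₗ LinearMap.lsmul (Localization.Away E) (Away E (Pullback φ M))
      (algebraMap R _ c) = LinearMap.lsmul (Localization.Away E) (Away E M)
      (algebraMap R _ c) ∘ₗ F.toLinearMap := by
    exact LinearMap.ext fun z => F.map_smul (algebraMap R (Localization.Away E) c) z
  rw [hF, LinearMap.range_comp_of_range_eq_top _ (LinearEquiv.range F)]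

end structures

end PhiModules

section Ring

variable (p : ℕ) [hp : Fact p.Prime] (k : Type u) [Field k]

/-- The ring `𝔖 = W(k)⟦u⟧`. -/
abbrev BK : Type u := PowerSeries (WittVector p k)

/-- The Frobenius of `𝔖`: the Witt vector Frobenius on `W(k)` and `u ↦ u ^ p`. -/
noncomputable def phi : BK p k →+* BK p k :=
  (PowerSeries.expand (R := WittVector p k) p hp.out.ne_zero).toRingHom.comp
    (PowerSeries.map WittVector.frobenius)

lemma phi_natCast_pow (n : ℕ) : phi p k ((p : BK p k) ^ n) = (p : BK p k) ^ n := by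
  rw [map_pow, map_natCast]

lemma coeff_sum_phi (f : Fin p → BK p k) (m : ℕ) (j : Fin p) :
    PowerSeries.coeff (p * m + j) (∑ i : Fin p, phi p k (f i) * PowerSeries.X ^ (i : ℕ))
      = WittVector.frobenius (PowerSeries.coeff m (f j)) := by
  have hp0 := hp.out.pos
  rw [map_sum, Finset.sum_eq_single j]
  · rw [PowerSeries.coeff_mul_X_pow]
    change PowerSeries.coeff (p * m) (PowerSeries.expand p hp.out.ne_zero _) = _
    rw [PowerSeries.coeff_expand_mul, PowerSeries.coeff_map]
  · intro i _ hij
    rw [PowerSeries.coeff_mul_X_pow']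
    split_ifs with hle
    · change PowerSeries.coeff _ (PowerSeries.expand p hp.out.ne_zero _) = _
      apply PowerSeries.coeff_expand_of_not_dvd
      rintro ⟨c, hc⟩
      apply hij
      have h1 : p * m + (j : ℕ) = p * c + i := by omega
      have h2 := congrArg (· % p) h1
      simp only [Nat.mul_add_mod, Nat.mod_eq_of_lt i.2, Nat.mod_eq_of_lt j.2] at h2
      exact Fin.ext h2.symm
    · rfl
  · simp

variable [CharP k p] [PerfectRing k p]

/-- The Frobenius of `W(k)⟦u⟧` is free of rank `p` (with basis `1, u, …, u ^ (p - 1)`). -/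
instance : Module.Free (BK p k) (Twist (phi p k)) := by
  let T : (Fin p → BK p k) →ₗ[BK p k] Twist (phi p k) :=
    Fintype.linearCombination (BK p k)
      (fun i : Fin p => ((PowerSeries.X : BK p k) ^ (i : ℕ) : Twist (phi p k)))
  have hT : ∀ f, T f = (∑ i : Fin p, phi p k (f i) * PowerSeries.X ^ (i : ℕ) : BK p k) := by
    intro f
    exact Fintype.linearCombination_apply (BK p k) _ f
  have hbij : Function.Bijective T := by
    constructor
    · intro f g hfg
      rw [hT, hT] at hfg
      funext j
      ext m : 1
      apply (WittVector.frobenius_bijective p k).1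
      rw [← coeff_sum_phi p k f m j, ← coeff_sum_phi p k g m j]
      exact congrArg (PowerSeries.coeff (p * m + j)) hfg
    · intro (y : BK p k)
      choose G hG using (WittVector.frobenius_bijective p k).2
      refine ⟨fun j => PowerSeries.mk fun m => G (PowerSeries.coeff (p * m + j) y), ?_⟩
      rw [hT]
      refine PowerSeries.ext fun n => ?_
      have hn := coeff_sum_phi p k
        (fun j => PowerSeries.mk fun m => G (PowerSeries.coeff (p * m + j) y)) (n / p)
        ⟨n % p, Nat.mod_lt _ hp.out.pos⟩
      rw [PowerSeries.coeff_mk, hG] at hn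
      simpa only [Nat.div_add_mod] using hn
  exact Module.Free.of_equiv (LinearEquiv.ofBijective T hbij)

/-- `E` is a monic Eisenstein polynomial over `W(k)`, of positive degree. These are exactly the minimal
polynomials over `Frac W(k)` of the uniformizers of its finite totally ramified extensions `K`;
the degree of `E` is then the degree of `K`. -/
class IsUniformizerPoly (E : (WittVector p k)[X]) : Prop where
  monic : E.Monic
  isEisensteinAt : E.IsEisensteinAt (Ideal.span {(p : WittVector p k)})
  natDegree_pos : 0 < E.natDegree

/-- `E` is a prime element of `𝔖`. -/
instance (E : (WittVector p k)[X]) [h : IsUniformizerPoly p k E] :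
    (Ideal.span {(E : BK p k)}).IsPrime := by
  have hprime : (Ideal.span {(p : WittVector p k)}).IsPrime :=
    (Ideal.span_singleton_prime (WittVector.irreducible p).ne_zero).mpr
      (WittVector.irreducible p).prime
  have hirr : Irreducible E :=
    h.isEisensteinAt.irreducible hprime h.monic.isPrimitive h.natDegree_pos
  have hE : (Ideal.span {E}).IsPrime :=
    (Ideal.span_singleton_prime h.monic.ne_zero).mpr hirr.prime
  have hd : E.IsDistinguishedAt (Ideal.span {(p : WittVector p k)}) :=
    ⟨h.isEisensteinAt.isWeaklyEisensteinAt, h.monic⟩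
  rw [← Ideal.Quotient.isDomain_iff_prime] at hE ⊢
  exact hd.algEquivQuotient.symm.toMulEquiv.isDomain _

end Ring

section Lattices

variable {O : Type*} [CommRing O] (π : O) {V : Type*} [AddCommGroup V] [Module O V]

/-- The lattice `π ^ i L` for `i : ℤ`, when `π` acts bijectively on `V`. -/
noncomputable def zpowSMul (i : ℤ) (L : Submodule O V) : Submodule O V :=
  (L.map (LinearMap.lsmul O V (π ^ i.toNat))).comap (LinearMap.lsmul O V (π ^ (-i).toNat))

/-- The preimage in `L₁` of the `i`-th step `(π ^ i L₂ ∩ L₁ + π L₁) / π L₁` of the filtration that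
`L₂` induces on `L₁ / π L₁`. -/
noncomputable def relFil (L₁ L₂ : Submodule O V) (i : ℤ) : Submodule O V :=
  (zpowSMul π i L₂ ⊓ L₁) ⊔ L₁.map (LinearMap.lsmul O V π)

/-- `ν(L₁, L₂)`, for two lattices over a discrete valuation ring `O` with uniformizer `π` in the same
`Frac O`-vector space `V`: the degree `∑ i * dim gr^i` of the filtration that `L₂` induces on
`L₁ / π L₁`. If `L₁ = ⨁ O e_j` and `L₂ = ⨁ O π ^ (-a_j) e_j`, this is `∑ a_j`. -/
noncomputable def nu (L₁ L₂ : Submodule O V) : ℤ :=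
  ∑ᶠ i : ℤ, i * ((Module.length O
    (relFil π L₁ L₂ i ⧸ (relFil π L₁ L₂ (i + 1)).submoduleOf (relFil π L₁ L₂ i))).toNat : ℤ)

end Lattices

section Kisin

variable {p : ℕ} [hp : Fact p.Prime] {k : Type u} [Field k]
  {E : (WittVector p k)[X]} {M : Type v} [AddCommGroup M] [Module (BK p k) M]

variable (p k E M) in
/-- A Frobenius `(φ^* M)[1/E] ≃ M[1/E]` on the `𝔖`-module `M`. A Kisin module is a finite free
`𝔖`-module with such a structure; a `p^∞`-torsion Kisin module is a finitely generated `𝔖`-module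
killed by a power of `p` and without `u`-torsion, with such a structure. -/
abbrev KisinStr : Type (max u v) := FrobStr (phi p k) (E : BK p k) M

variable (E M) in
/-- The image of `M` in `M[1/E]`. -/
noncomputable def stdLattice : Submodule (BK p k) (Away (E : BK p k) M) :=
  LinearMap.range (LocalizedModule.mkLinearMap (Submonoid.powers (E : BK p k)) M)

/-- The submodule `φ_M(φ^* M)` of `M[1/E]`. -/
noncomputable def frobLattice (F : KisinStr p k E M) :
    Submodule (BK p k) (Away (E : BK p k) M) :=
  (stdLattice E (Pullback (phi p k) M)).map (F.toLinearMap.restrictScalars (BK p k))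

section Torsion

variable (p k M) in
/-- The rank of a `p^∞`-torsion Kisin module: the length of the `W(k)`-module `M / uM`, where `W(k)`
acts through `W(k) → 𝔖`. -/
noncomputable def torsionRank : ℕ :=
  letI : Module (WittVector p k)
      (M ⧸ (Ideal.span {(PowerSeries.X : BK p k)} • ⊤ : Submodule (BK p k) M)) :=
    Module.compHom _ (PowerSeries.C : WittVector p k →+* BK p k)
  (Module.length (WittVector p k)
    (M ⧸ (Ideal.span {(PowerSeries.X : BK p k)} • ⊤ : Submodule (BK p k) M))).toNat

/-- The submodule `u ^ i φ_M(φ^* M)` of `M[1/E]`: the image of `φ^* M` under the Frobenius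
`u ^ i φ_M` of the twist `M(i)` of the `p^∞`-torsion Kisin module `M`. -/
noncomputable def twistLattice (F : KisinStr p k E M) (i : ℕ) :
    Submodule (BK p k) (Away (E : BK p k) M) :=
  (frobLattice F).map (LinearMap.lsmul (BK p k) _ (PowerSeries.X ^ i))

/-- The least `i : ℕ` such that `M(i)` is effective. -/
noncomputable def twistIndex (F : KisinStr p k E M) : ℕ :=
  sInf {i : ℕ | twistLattice F i ≤ stdLattice E M}

/-- The degree `-length_𝔖 (M(i) / φ_{M(i)}(φ^* M(i))) + i * rank M` of a `p^∞`-torsion Kisin module,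
where `M(i)` is effective, before normalization. -/
noncomputable def rawDegree (F : KisinStr p k E M) : ℤ :=
  -((Module.length (BK p k) (stdLattice E M ⧸
      (twistLattice F (twistIndex F)).submoduleOf (stdLattice E M))).toNat : ℤ)
    + (twistIndex F : ℤ) * (torsionRank p k M : ℤ)

/-- The degree of a `p^∞`-torsion Kisin module, normalized by `1 / e` where `e = deg E`. -/
noncomputable def torsionDegree (F : KisinStr p k E M) : ℚ :=
  (rawDegree F : ℚ) / (E.natDegree : ℚ)

/-- The slope `deg / rank`. -/
noncomputable def slope (F : KisinStr p k E M) : ℚ :=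
  torsionDegree F / (torsionRank p k M : ℚ)

variable (p k M) in
/-- `M` has no `u`-torsion. -/
def NoUTorsion : Prop := ∀ x : M, (PowerSeries.X : BK p k) • x = 0 → x = 0

variable [CharP k p] [PerfectRing k p]

/-- Semistability of a `p^∞`-torsion Kisin module `M`: it is nonzero, and the slope of each nonzero
strict subobject is at most that of `M`. A subobject `N` is strict when `M / N` is again a
`p^∞`-torsion Kisin module, i.e. has no `u`-torsion. -/
def IsSemistable (F : KisinStr p k E M) : Prop :=
  Nontrivial M ∧ ∀ (N : Submodule (BK p k) M) (h : IsStable F N),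
    NoUTorsion p k (M ⧸ N) → N ≠ ⊥ → slope (F.sub N h) ≤ slope F

/-- The Frobenius of the subquotient `N' / N`. -/
noncomputable def FrobStr.gr (F : KisinStr p k E M) {N N' : Submodule (BK p k) M}
    (h : IsStable F N) (h' : IsStable F N') (hle : N ≤ N') :
    KisinStr p k E (N' ⧸ N.submoduleOf N') :=
  FrobStr.quot (F.sub N' h') (N.submoduleOf N') (h.submoduleOf h' hle)

/-- A Harder-Narasimhan filtration of a `p^∞`-torsion Kisin module: a flag
`0 = M_0 ⊆ M_1 ⊆ ⋯ ⊆ M_s = M` of strict subobjects whose graded pieces `M_i / M_{i-1}` are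
semistable, of strictly decreasing slopes. -/
structure HNFlag (F : KisinStr p k E M) where
  len : ℕ
  obj : Fin (len + 1) → Submodule (BK p k) M
  obj_zero : obj 0 = ⊥
  obj_last : obj (Fin.last len) = ⊤
  mono : Monotone obj
  stable : ∀ i, IsStable F (obj i)
  strict : ∀ i, NoUTorsion p k (M ⧸ obj i)
  semistable : ∀ i : Fin len,
    IsSemistable (F.gr (stable i.castSucc) (stable i.succ) (mono i.castSucc_le_succ))
  slope_anti : StrictAnti fun i : Fin len =>
    slope (F.gr (stable i.castSucc) (stable i.succ) (mono i.castSucc_le_succ))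

/-- The polygon of a Harder-Narasimhan filtration: the function on `[0, rank M]` that vanishes at
`0` and is affine on `[rank M_{i-1}, rank M_i]` with slope that of `M_i / M_{i-1}`. -/
noncomputable def HNFlag.polygon {F : KisinStr p k E M} (Φ : HNFlag F) (x : ℝ) : ℝ :=
  ∑ i : Fin Φ.len,
    (slope (F.gr (Φ.stable i.castSucc) (Φ.stable i.succ) (Φ.mono i.castSucc_le_succ)) : ℝ) *
      (min x (torsionRank p k (Φ.obj i.succ)) - min x (torsionRank p k (Φ.obj i.castSucc)))

open Classical in
/-- The polygon `t_{F,t}(M)` of the Harder-Narasimhan filtration of a `p^∞`-torsion Kisin module. -/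
noncomputable def hnPolygon (F : KisinStr p k E M) (x : ℝ) : ℝ :=
  if h : Nonempty (HNFlag F) then h.some.polygon x else 0

end Torsion

section Free

variable [CharP k p] [PerfectRing k p]

/-- The Frobenius of `M / p ^ n M`. -/
noncomputable def FrobStr.reduce (F : KisinStr p k E M) (n : ℕ) :
    KisinStr p k E (M ⧸ (Ideal.span {(p : BK p k) ^ n} • (⊤ : Submodule (BK p k) M))) :=
  FrobStr.quot F _ (isStable_smul_top F (phi_natCast_pow p k n))

/-- `t_{F,n}(M)(x) = (1 / n) t_{F,t}(M / p ^ n M)(n x)`. -/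
noncomputable def renormPolygon (F : KisinStr p k E M) (n : ℕ) (x : ℝ) : ℝ :=
  1 / (n : ℝ) * hnPolygon (F.reduce n) (n * x)

/-- The function `t_{F,∞}(M) = inf_{n ≥ 1} t_{F,n}(M)`. -/
noncomputable def farguesPolygon (F : KisinStr p k E M) (x : ℝ) : ℝ :=
  ⨅ n : ℕ+, renormPolygon F n x

/-- The localization `𝔖_(E)`, a discrete valuation ring. -/
abbrev LocE (E : (WittVector p k)[X]) [IsUniformizerPoly p k E] : Type u :=
  Localization.AtPrime (Ideal.span {(E : BK p k)})

/-- For a submodule `L` of `M[1/E]`, the lattice `L_(E)` in the vector space `M[1/E]_(E)` over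
`𝔖_(E)[1/E] = Frac 𝔖`. -/
noncomputable def localLattice [IsUniformizerPoly p k E]
    (L : Submodule (BK p k) (Away (E : BK p k) M)) :
    Submodule (LocE E)
      (LocalizedModule (Ideal.span {(E : BK p k)}).primeCompl (Away (E : BK p k) M)) :=
  Submodule.span (LocE E) (LocalizedModule.mkLinearMap
    (Ideal.span {(E : BK p k)}).primeCompl (Away (E : BK p k) M) '' (L : Set _))

/-- The degree `ν(M_(E), φ_M(φ^* M)_(E))` of a Kisin module. -/
noncomputable def kisinDegree [IsUniformizerPoly p k E] (F : KisinStr p k E M) : ℤ :=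
  nu (algebraMap (BK p k) (LocE E) (E : BK p k))
    (localLattice (stdLattice E M)) (localLattice (frobLattice F))

/-- `M ⊗ ℚ_p` and `N ⊗ ℚ_p` are isomorphic in the isogeny category, where `Hom` is replaced by
`Hom[1/p]`: there are morphisms `f : M → N` and `g : N → M` whose composites are multiplication
by `p ^ n`, for some `n`. -/
def IsIsogenous {N : Type*} [AddCommGroup N] [Module (BK p k) N]
    (F : KisinStr p k E M) (G : KisinStr p k E N) : Prop :=
  ∃ (f : M →ₗ[BK p k] N) (g : N →ₗ[BK p k] M) (n : ℕ), IsPhiHom F G f ∧ IsPhiHom G F g ∧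
    (∀ x, g (f x) = ((p : BK p k) ^ n) • x) ∧ (∀ y, f (g y) = ((p : BK p k) ^ n) • y)

end Free

end Kisin

end KisinModules

set_option linter.unusedSectionVars false

/-! Torsion modules. Modulo `p` the polynomial `E` is `u ^ e`, so on modules killed by a power of
`p` inverting `E` and inverting `u` agree. For large `i` the map `u ^ i φ_T` therefore comes from a
`φ`-semilinear `ψ : T → T` with injective linearization (`exists_isEff`, `IsEff.frobInj`). Strict
subobjects become the `u`-saturated `ψ`-stable submodules `N`, the rank is the length of `N / uN`,
and `e` times the degree is `i * rank` minus the length of `N / ⟨ψ(N)⟩` (`IsEff.rawDegree_eq`). Rank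
and degree are additive in short exact sequences, and `u`-saturation preserves rank and cannot lower
degree. Rank is thus strictly increasing and modular on the lattice of strict subobjects, and degree
is supermodular (`IsPTorsion.isSlopeData`). Lattice-theoretic Harder-Narasimhan theory then yields
existence and uniqueness of the filtration, and shows that the polygon is the least concave majorant
of the points `(rank N, degree N)` (`IsHNPolygon`).

The limit. A submodule of `M / p ^ (a + b)` splits into a submodule of `M / p ^ a` and a submodule
of `M / p ^ b`. The majorant property and concavity turn this into `t_{nm} ≤ t_n`
(`hnPolygon_reduce_mul_le`). All `t_n` are concave, lie below `t_1` and share their end values, so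
they satisfy one common Lipschitz bound (`IsDivDecreasing.lipschitz`). Compactness upgrades the
monotone pointwise limit to a uniform one. The infimum inherits concavity, the Lipschitz bound and
the end values.

The end value. It is the degree of `M / p`. In a basis, `E ^ m φ_M` has determinant `E ^ a` up to a
unit. Smith form over `𝔖_(E)` gives `m r - a` for the degree of `M`. Reduction to `k⟦u⟧` turns the
determinant into `u ^ (e a)` and gives the same number for `M / p`.

Isogenies. If `g ∘ f = p ^ c`, the kernel of `M / p ^ n → M' / p ^ n` is killed by `p ^ c`, so its
rank is at most `c r`, independently of `n`. The polygons before rescaling satisfy an inequality up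
to a bounded error, which division by `n` removes in the limit (`farguesPolygon_le_of_isogeny`). -/

namespace KisinModules

/-! ### Lengths of subquotients -/

section RelativeLength

variable {A : Type*} [CommRing A] {T T' : Type*} [AddCommGroup T] [Module A T]
  [AddCommGroup T'] [Module A T']

/-- The length of `N' / N`, for submodules `N ≤ N'` of `T`. -/
noncomputable def relLength (N N' : Submodule A T) : ℕ∞ :=
  Module.length A (N' ⧸ N.submoduleOf N')

lemma relLength_add {a b c : Submodule A T} (hab : a ≤ b) (hbc : b ≤ c) :
    relLength a c = relLength a b + relLength b c := by
  have h1 : a.submoduleOf b ≤ (a.submoduleOf c).comap (Submodule.inclusion hbc) := fun x hx => hx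
  have h2 : a.submoduleOf c ≤ (b.submoduleOf c).comap LinearMap.id := fun x hx => hab hx
  refine Module.length_eq_add_of_exact
    (Submodule.mapQ _ _ (Submodule.inclusion hbc) h1) (Submodule.mapQ _ _ LinearMap.id h2) ?_ ?_ ?_
  · rw [← LinearMap.ker_eq_bot, Submodule.ker_mapQ]
    have : Submodule.comap (Submodule.inclusion hbc) (a.submoduleOf c) = a.submoduleOf b := rfl
    rw [this, Submodule.mkQ_map_self]
  · rintro ⟨x⟩
    exact ⟨Submodule.Quotient.mk x, rfl⟩
  · rintro ⟨x⟩
    constructor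
    · intro hx
      have hx' : (x : T) ∈ b := (Submodule.Quotient.mk_eq_zero (b.submoduleOf c)).mp hx
      exact ⟨Submodule.Quotient.mk ⟨x, hx'⟩, rfl⟩
    · rintro ⟨⟨y⟩, hy⟩
      rw [← hy]
      exact (Submodule.Quotient.mk_eq_zero (b.submoduleOf c)).mpr y.2

lemma relLength_inf_left (a b : Submodule A T) : relLength (a ⊓ b) b = relLength a b := by
  have : (a ⊓ b).submoduleOf b = a.submoduleOf b := by
    ext x; simp [Submodule.submoduleOf]
  rw [relLength, this]; rfl

lemma relLength_sup_right (a b : Submodule A T) : relLength a (b ⊔ a) = relLength a b :=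
  ((LinearMap.quotientInfEquivSupQuotient b a).symm.length_eq).trans (by
    have : (b ⊓ a).submoduleOf b = a.submoduleOf b := by
      ext x; simp [Submodule.submoduleOf]
    show Module.length A (b ⧸ (Submodule.comap b.subtype b ⊓ Submodule.comap b.subtype a)) = _
    have h : Submodule.comap b.subtype b ⊓ Submodule.comap b.subtype a = a.submoduleOf b := this
    rw [h]; rfl)

lemma relLength_eq_zero {a b : Submodule A T} : relLength a b = 0 ↔ b ≤ a := by
  rw [relLength, Module.length_eq_zero_iff, Submodule.Quotient.subsingleton_iff]
  exact Submodule.submoduleOf_eq_top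

/-- The map `b → f(b) / f(a)` has kernel exactly `a` as soon as `a` absorbs the part of `ker f`
inside `b`. Injectivity of `f` is not needed, which allows its use for quotient maps. -/
lemma relLength_map (f : T →ₗ[A] T') {a b : Submodule A T} (hab : a ≤ b)
    (h : LinearMap.ker f ⊓ b ≤ a) :
    relLength (a.map f) (b.map f) = relLength a b := by
  let g : b →ₗ[A] (b.map f) ⧸ (a.map f).submoduleOf (b.map f) :=
    ((a.map f).submoduleOf (b.map f)).mkQ ∘ₗ f.submoduleMap b
  have hg : Function.Surjective g :=
    (Submodule.mkQ_surjective _).comp (LinearMap.submoduleMap_surjective f b)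
  have hker : LinearMap.ker g = a.submoduleOf b := by
    ext x
    rw [LinearMap.mem_ker]
    change Submodule.Quotient.mk _ = _ ↔ _
    rw [Submodule.Quotient.mk_eq_zero]
    change f x ∈ a.map f ↔ (x : T) ∈ a
    constructor
    · rintro ⟨y, hy, hyx⟩
      have hk : (x : T) - y ∈ LinearMap.ker f := by
        rw [LinearMap.mem_ker, map_sub, hyx, sub_self]
      have := a.add_mem (h ⟨hk, b.sub_mem x.2 (hab hy)⟩) hy
      simpa using this
    · intro hx
      exact ⟨x, hx, rfl⟩
  rw [relLength, relLength, ← hker]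
  exact ((g.quotKerEquivOfSurjective hg).length_eq).symm

/-- Length is the Krull dimension of the lattice of submodules, so a strictly increasing map between
intervals is enough. It need not come from a linear map, nor over the same ring; this is how lengths
are compared across the semilinear `ψ`. -/
lemma relLength_le_of_strictMono {B : Type*} [CommRing B] {S : Type*} [AddCommGroup S] [Module B S]
    {a b : Submodule A T} {c d : Submodule B S} (hab : a ≤ b)
    (g : Submodule A T → Submodule B S)
    (hg : ∀ x, a ≤ x → x ≤ b → c ≤ g x ∧ g x ≤ d)
    (hmono : ∀ x y, a ≤ x → x < y → y ≤ b → g x < g y) : relLength a b ≤ relLength c d := by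
  let j : Submodule A (b ⧸ a.submoduleOf b) → Submodule A T := fun X =>
    (X.comap (a.submoduleOf b).mkQ).map b.subtype
  have hj : ∀ X, a ≤ j X ∧ j X ≤ b := fun X =>
    ⟨fun x hx => ⟨⟨x, hab hx⟩, by
      have : (a.submoduleOf b).mkQ ⟨x, hab hx⟩ = 0 :=
        (Submodule.Quotient.mk_eq_zero _).mpr hx
      simp only [SetLike.mem_coe, Submodule.mem_comap, this, zero_mem], rfl⟩,
     Submodule.map_subtype_le _ _⟩
  have hjm : StrictMono j := by
    intro X Y hXY
    refine Submodule.map_strictMono_of_injective b.injective_subtype ?_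
    exact (Submodule.comap_strictMono_of_surjective (Submodule.mkQ_surjective _)) hXY
  let q : Submodule B S → Submodule B (d ⧸ c.submoduleOf d) := fun Y =>
    (Y.submoduleOf d).map (c.submoduleOf d).mkQ
  have hq : ∀ x y, c ≤ x → x < y → y ≤ d → q x < q y := by
    intro x y hx hxy hy
    refine lt_of_le_of_ne (Submodule.map_mono (Submodule.comap_mono hxy.le)) fun h => ?_
    apply hxy.not_ge
    intro z hz
    have hz' : (c.submoduleOf d).mkQ ⟨z, hy hz⟩ ∈ q x := by
      rw [h]; exact ⟨⟨z, hy hz⟩, hz, rfl⟩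
    obtain ⟨w, hw, hwz⟩ := hz'
    have h3 : w - ⟨z, hy hz⟩ ∈ c.submoduleOf d := (Submodule.Quotient.eq _).mp hwz
    have h4 : (w : S) - z ∈ x := hx h3
    have h5 : (w : S) ∈ x := hw
    simpa using x.sub_mem h5 h4
  have key : StrictMono fun X => q (g (j X)) := fun X Y hXY =>
    hq _ _ (hg _ (hj X).1 (hj X).2).1 (hmono _ _ (hj X).1 (hjm hXY) (hj Y).2)
      (hg _ (hj Y).1 (hj Y).2).2
  have := Order.krullDim_le_of_strictMono _ key
  rw [← Module.coe_length, ← Module.coe_length] at this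
  exact_mod_cast this

lemma relLength_bot_top : relLength (⊥ : Submodule A T) ⊤ = Module.length A T := by
  have h : (⊥ : Submodule A T).submoduleOf ⊤ = ⊥ := by
    ext x; simp [Submodule.submoduleOf]
  rw [relLength, h]
  exact ((Submodule.quotEquivOfEqBot _ rfl).trans Submodule.topEquiv).length_eq

lemma relLength_top (N : Submodule A T) : relLength N ⊤ = Module.length A (T ⧸ N) := by
  have h := relLength_map N.mkQ (a := N) (b := ⊤) le_top (by rw [Submodule.ker_mkQ]; exact inf_le_left)
  rw [Submodule.mkQ_map_self, Submodule.map_top, Submodule.range_mkQ, relLength_bot_top] at h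
  exact h.symm

end RelativeLength

/-! ### The ring `W(k)⟦u⟧`: finiteness of lengths and its basis over Frobenius -/

section BKRing

variable (p : ℕ) [hp : Fact p.Prime] (k : Type u) [Field k] [CharP k p]

/-- The residue map `W(k)⟦u⟧ → k`. -/
noncomputable def residueMap : BK p k →+* k :=
  (WittVector.constantCoeff (p := p)).comp PowerSeries.constantCoeff

lemma residueMap_surjective : Function.Surjective (residueMap p k) := by
  intro a
  refine ⟨PowerSeries.C (WittVector.teichmuller p a), ?_⟩
  simp [residueMap, WittVector.constantCoeff_apply]

variable [PerfectRing k p]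

lemma mem_ker_residueMap {a : BK p k} (ha : residueMap p k a = 0) :
    ∃ b c : BK p k, a = (p : BK p k) * b + PowerSeries.X * c := by
  have h1 : PowerSeries.constantCoeff a ∈ RingHom.ker (WittVector.constantCoeff (p := p) (R := k)) :=
    ha
  rw [WittVector.ker_constantCoeff, Ideal.mem_span_singleton] at h1
  obtain ⟨b, hb⟩ := h1
  have h2 := PowerSeries.sub_const_eq_X_mul_shift a
  exact ⟨PowerSeries.C b, _, by rw [← h2, hb, map_mul, map_natCast]; ring⟩

/-- A prime containing `I` contains `p` and `u`, hence the kernel of the residue map, which is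
maximal. The quotient is Noetherian of dimension zero. -/
lemma isArtinianRing_quotient {I : Ideal (BK p k)} {n j : ℕ} (hn : (p : BK p k) ^ n ∈ I)
    (hj : (PowerSeries.X : BK p k) ^ j ∈ I) : IsArtinianRing (BK p k ⧸ I) := by
  have : Ring.KrullDimLE 0 (BK p k ⧸ I) := by
    rw [Ring.krullDimLE_zero_iff]
    intro P hP
    have hQ : (P.comap (Ideal.Quotient.mk I)).IsPrime := inferInstance
    have hI : ∀ x ∈ I, x ∈ P.comap (Ideal.Quotient.mk I) := fun x hx => by
      rw [Ideal.mem_comap, Ideal.Quotient.eq_zero_iff_mem.mpr hx]; exact zero_mem _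
    have hpQ := hQ.mem_of_pow_mem _ (hI _ hn)
    have hXQ := hQ.mem_of_pow_mem _ (hI _ hj)
    have hm : (RingHom.ker (residueMap p k)).IsMaximal :=
      RingHom.ker_isMaximal_of_surjective _ (residueMap_surjective p k)
    have hle : RingHom.ker (residueMap p k) ≤ P.comap (Ideal.Quotient.mk I) := by
      intro a ha
      obtain ⟨b, c, rfl⟩ := mem_ker_residueMap p k ha
      exact add_mem (Ideal.mul_mem_right _ _ hpQ) (Ideal.mul_mem_right _ _ hXQ)
    have heq := hm.eq_of_le hQ.ne_top hle
    have hmax : (P.comap (Ideal.Quotient.mk I)).IsMaximal := heq ▸ hm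
    have hmap := Ideal.map_comap_of_surjective _ (Ideal.Quotient.mk_surjective (I := I)) P
    rcases Ideal.map_eq_top_or_isMaximal_of_surjective _ (Ideal.Quotient.mk_surjective (I := I))
      hmax with h | h
    · exact absurd (hmap.symm.trans h) hP.ne_top
    · rwa [hmap] at h
  exact isArtinianRing_iff_isNoetherianRing_krullDimLE_zero.mpr ⟨inferInstance, this⟩

/-- `Q` is finite over the quotient of `𝔖` by its annihilator, which is Artinian. The finiteness
that permits cancellation in `ℕ∞` below comes from here. -/
lemma length_ne_top {Q : Type*} [AddCommGroup Q] [Module (BK p k) Q] [Module.Finite (BK p k) Q]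
    {n j : ℕ} (hn : ∀ x : Q, (p : BK p k) ^ n • x = 0)
    (hj : ∀ x : Q, (PowerSeries.X : BK p k) ^ j • x = 0) : Module.length (BK p k) Q ≠ ⊤ := by
  set I := Module.annihilator (BK p k) Q
  have hI : Module.IsTorsionBySet (BK p k) Q I := fun x a => Module.mem_annihilator.mp a.2 x
  let := hI.module
  have : IsArtinianRing (BK p k ⧸ I) := isArtinianRing_quotient p k
    (Module.mem_annihilator.mpr hn) (Module.mem_annihilator.mpr hj)
  have : IsScalarTower (BK p k) (BK p k ⧸ I) Q := hI.isScalarTower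
  have : Module.Finite (BK p k ⧸ I) Q := Module.Finite.of_restrictScalars_finite (BK p k) _ _
  rw [Module.length_eq_of_surjective (R := BK p k ⧸ I) Ideal.Quotient.mk_surjective]
  exact Module.length_ne_top

lemma mem_jacobson_X : (PowerSeries.X : BK p k) ∈ (⊥ : Ideal (BK p k)).jacobson := by
  rw [Ideal.mem_jacobson_bot]
  intro y
  rw [PowerSeries.isUnit_iff_constantCoeff]
  simp

/-- Each element of `𝔖` is uniquely of the form `∑ φ(a_i) u^i` with `0 ≤ i < p`. -/
lemma exists_eq_sum_phi (y : BK p k) :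
    ∃ f : Fin p → BK p k, y = ∑ i : Fin p, phi p k (f i) * PowerSeries.X ^ (i : ℕ) := by
  choose G hG using (WittVector.frobenius_bijective p k).2
  refine ⟨fun j => PowerSeries.mk fun m => G (PowerSeries.coeff (p * m + j) y), ?_⟩
  refine PowerSeries.ext fun n => ?_
  have hn := coeff_sum_phi p k
    (fun j => PowerSeries.mk fun m => G (PowerSeries.coeff (p * m + j) y)) (n / p)
    ⟨n % p, Nat.mod_lt _ hp.out.pos⟩
  rw [PowerSeries.coeff_mk, hG] at hn
  simpa only [Nat.div_add_mod] using hn.symm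

lemma eq_zero_of_sum_phi_eq_zero {f : Fin p → BK p k}
    (h : ∑ i : Fin p, phi p k (f i) * PowerSeries.X ^ (i : ℕ) = 0) : f = 0 := by
  funext j
  refine PowerSeries.ext fun m => ?_
  apply (WittVector.frobenius_bijective p k).1
  rw [← coeff_sum_phi p k f m j, h]
  simp

lemma phi_X : phi p k PowerSeries.X = PowerSeries.X ^ p := by
  change PowerSeries.expand p hp.out.ne_zero (PowerSeries.map _ PowerSeries.X) = _
  rw [PowerSeries.map_X, PowerSeries.expand_X]

end BKRing

/-! ### Rank and degree of submodules under a semilinear Frobenius -/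

section SemilinearFrobenius

variable {p : ℕ} [hp : Fact p.Prime] {k : Type u} [Field k] [CharP k p] [PerfectRing k p]
  {T : Type*} [AddCommGroup T] [Module (BK p k) T]

variable (p k T) in
/-- `T` is finitely generated, killed by a power of `p`, and without `u`-torsion. -/
structure IsPTorsion : Prop where
  finite : Module.Finite (BK p k) T
  killed : ∃ n : ℕ, ∀ x : T, (p : BK p k) ^ n • x = 0
  noUTorsion : NoUTorsion p k T

lemma IsPTorsion.isNoetherian (hT : IsPTorsion p k T) : IsNoetherian (BK p k) T :=
  have := hT.finite
  inferInstance

lemma NoUTorsion.pow (hT : NoUTorsion p k T) (j : ℕ) {x : T}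
    (h : (PowerSeries.X : BK p k) ^ j • x = 0) : x = 0 := by
  induction j with
  | zero => simpa using h
  | succ j ih =>
    rw [pow_succ', mul_smul] at h
    exact ih (hT _ h)

lemma IsPTorsion.of_injective {S : Type*} [AddCommGroup S] [Module (BK p k) S]
    (hT : IsPTorsion p k T) (f : S →ₗ[BK p k] T) (hf : Function.Injective f) :
    IsPTorsion p k S := by
  have := hT.isNoetherian
  obtain ⟨n, hn⟩ := hT.killed
  refine ⟨Module.Finite.of_injective f hf, ⟨n, fun x => hf ?_⟩, fun x hx => hf ?_⟩
  · rw [map_smul, hn, map_zero]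
  · rw [map_zero]
    apply hT.noUTorsion
    rw [← map_smul, hx, map_zero]

lemma IsPTorsion.quotient (hT : IsPTorsion p k T) (N : Submodule (BK p k) T)
    (hN : NoUTorsion p k (T ⧸ N)) : IsPTorsion p k (T ⧸ N) := by
  have := hT.finite
  obtain ⟨n, hn⟩ := hT.killed
  refine ⟨inferInstance, ⟨n, ?_⟩, hN⟩
  rintro ⟨x⟩
  change Submodule.Quotient.mk ((p : BK p k) ^ n • x) = _
  rw [hn]; rfl

/-- The submodule `uN`. -/
noncomputable def uMul (N : Submodule (BK p k) T) : Submodule (BK p k) T :=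
  N.map (LinearMap.lsmul (BK p k) T PowerSeries.X)

/-- The length of `N / uN`. -/
noncomputable def rho (N : Submodule (BK p k) T) : ℕ := (relLength (uMul N) N).toNat

lemma uMul_le (N : Submodule (BK p k) T) : uMul N ≤ N := by
  rintro _ ⟨x, hx, rfl⟩
  exact N.smul_mem _ hx

lemma uMul_mono {N N' : Submodule (BK p k) T} (h : N ≤ N') : uMul N ≤ uMul N' :=
  Submodule.map_mono h

lemma IsPTorsion.relLength_ne_top (hT : IsPTorsion p k T) {N N' : Submodule (BK p k) T} {j : ℕ}
    (h : ∀ x ∈ N', (PowerSeries.X : BK p k) ^ j • x ∈ N) : relLength N N' ≠ ⊤ := by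
  have := hT.isNoetherian
  obtain ⟨n, hn⟩ := hT.killed
  refine length_ne_top p k (n := n) (j := j) ?_ ?_
  · rintro ⟨x⟩
    change Submodule.Quotient.mk ((p : BK p k) ^ n • x) = _
    have : (p : BK p k) ^ n • x = 0 := Subtype.ext (hn x)
    rw [this]; rfl
  · rintro ⟨x⟩
    exact (Submodule.Quotient.mk_eq_zero _).mpr (h x x.2)

lemma IsPTorsion.coe_rho (hT : IsPTorsion p k T) (N : Submodule (BK p k) T) :
    (rho N : ℕ∞) = relLength (uMul N) N :=
  ENat.natCast_toNat (hT.relLength_ne_top (j := 1) fun x hx => ⟨x, hx, by simp⟩)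

lemma IsPTorsion.lsmul_X_injective (hT : IsPTorsion p k T) :
    Function.Injective (LinearMap.lsmul (BK p k) T PowerSeries.X) := by
  rw [← LinearMap.ker_eq_bot, LinearMap.ker_eq_bot']
  exact fun x hx => hT.noUTorsion x hx

lemma relLength_map_of_injective {A : Type*} [CommRing A] {T T' : Type*} [AddCommGroup T]
    [Module A T] [AddCommGroup T'] [Module A T'] {f : T →ₗ[A] T'} (hf : Function.Injective f)
    {a b : Submodule A T} (hab : a ≤ b) : relLength (a.map f) (b.map f) = relLength a b :=
  relLength_map f hab (by rw [LinearMap.ker_eq_bot.mpr hf, bot_inf_eq]; exact bot_le)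

lemma IsPTorsion.relLength_uMul (hT : IsPTorsion p k T) {N N' : Submodule (BK p k) T}
    (h : N ≤ N') : relLength (uMul N) (uMul N') = relLength N N' :=
  relLength_map_of_injective hT.lsmul_X_injective h

/-- Compute the length of `N' / uN` through `N` and through `uN'`. Multiplication by `u` is
injective, so `uN' / uN` and `N' / N` have the same finite length, which cancels. -/
lemma IsPTorsion.rho_eq (hT : IsPTorsion p k T) {N N' : Submodule (BK p k) T} (hle : N ≤ N')
    {j : ℕ} (h : ∀ x ∈ N', (PowerSeries.X : BK p k) ^ j • x ∈ N) : rho N = rho N' := by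
  have h1 := relLength_add (uMul_le N) hle
  have h2 := relLength_add (uMul_mono hle) (uMul_le N')
  rw [h1, hT.relLength_uMul hle, add_comm] at h2
  rw [rho, rho, ENat.add_right_injective_of_ne_top (hT.relLength_ne_top h) h2]

/-- `N'/N` has no `u`-torsion. -/
def StrictIn (N N' : Submodule (BK p k) T) : Prop :=
  ∀ x ∈ N', (PowerSeries.X : BK p k) • x ∈ N → x ∈ N

lemma StrictIn.pow {N N' : Submodule (BK p k) T} (h : StrictIn N N') (j : ℕ) {x : T} (hx : x ∈ N')
    (hj : (PowerSeries.X : BK p k) ^ j • x ∈ N) : x ∈ N := by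
  induction j with
  | zero => simpa using hj
  | succ j ih =>
    rw [pow_succ', mul_smul] at hj
    exact ih (h _ (N'.smul_mem _ hx) hj)

lemma StrictIn.mono {N N' N'' : Submodule (BK p k) T} (h : StrictIn N N'') (hle : N' ≤ N'') :
    StrictIn N N' := fun x hx hX => h x (hle hx) hX

lemma strictIn_top_iff {N : Submodule (BK p k) T} :
    StrictIn N ⊤ ↔ NoUTorsion p k (T ⧸ N) := by
  constructor
  · rintro h ⟨x⟩ hx
    exact (Submodule.Quotient.mk_eq_zero _).mpr
      (h x trivial ((Submodule.Quotient.mk_eq_zero _).mp hx))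
  · intro h x _ hx
    exact (Submodule.Quotient.mk_eq_zero _).mp
      (h (Submodule.Quotient.mk x) ((Submodule.Quotient.mk_eq_zero _).mpr hx))

/-- Strictness means `N ∩ uN' = uN`, so `N / uN` embeds in `N' / uN'`. -/
lemma IsPTorsion.rho_add (hT : IsPTorsion p k T) {N N' : Submodule (BK p k) T} (hle : N ≤ N')
    (h : StrictIn N N') : (rho N' : ℕ∞) = rho N + relLength (N ⊔ uMul N') N' := by
  rw [hT.coe_rho, relLength_add (b := N ⊔ uMul N') le_sup_right (sup_le hle (uMul_le N')),
    relLength_sup_right, ← relLength_inf_left, hT.coe_rho]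
  congr 2
  apply le_antisymm
  · rintro _ ⟨⟨x, hx, rfl⟩, hx'⟩
    exact ⟨x, h x hx hx', rfl⟩
  · exact le_inf (uMul_mono hle) (uMul_le N)

/-- Equal ranks force `N' = N + uN'`, and Nakayama applies since `u` lies in the Jacobson radical.
This makes the rank strictly increasing on strict subobjects. -/
lemma IsPTorsion.eq_of_rho_le (hT : IsPTorsion p k T) {N N' : Submodule (BK p k) T} (hle : N ≤ N')
    (h : StrictIn N N') (hr : rho N' ≤ rho N) : N = N' := by
  have := hT.isNoetherian
  have h1 := hT.rho_add hle h
  have h2 : relLength (N ⊔ uMul N') N' = 0 := by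
    have h3 : (rho N' : ℕ∞) ≤ rho N := by exact_mod_cast hr
    rw [h1] at h3
    have h4 : (rho N : ℕ∞) + relLength (N ⊔ uMul N') N' = rho N + 0 :=
      le_antisymm (by rw [add_zero]; exact h3) (by rw [add_zero]; exact le_self_add)
    exact ENat.add_right_injective_of_ne_top (ENat.natCast_ne_top _) h4
  rw [relLength_eq_zero] at h2
  refine le_antisymm hle ?_
  have hJ : Ideal.span {(PowerSeries.X : BK p k)} ≤ (⊥ : Ideal (BK p k)).jacobson := by
    rw [Ideal.span_singleton_le_iff_mem]; exact mem_jacobson_X p k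
  refine Submodule.le_of_le_smul_of_le_jacobson_bot (IsNoetherian.noetherian N') hJ ?_
  rw [Submodule.ideal_span_singleton_smul]
  exact h2

/-- The `u`-saturation of `N` in `T`. -/
def uSat (N : Submodule (BK p k) T) : Submodule (BK p k) T where
  carrier := {x | ∃ j : ℕ, (PowerSeries.X : BK p k) ^ j • x ∈ N}
  zero_mem' := ⟨0, by simp⟩
  add_mem' := by
    rintro x y ⟨i, hi⟩ ⟨j, hj⟩
    refine ⟨i + j, ?_⟩
    rw [smul_add]
    refine N.add_mem ?_ ?_
    · rw [add_comm, pow_add, mul_smul]; exact N.smul_mem _ hi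
    · rw [pow_add, mul_smul]; exact N.smul_mem _ hj
  smul_mem' := by
    rintro a x ⟨i, hi⟩
    exact ⟨i, by rw [smul_comm]; exact N.smul_mem _ hi⟩

lemma le_uSat (N : Submodule (BK p k) T) : N ≤ uSat N := fun x hx => ⟨0, by simpa using hx⟩

lemma strictIn_uSat (N : Submodule (BK p k) T) : StrictIn (uSat N) ⊤ := by
  rintro x - ⟨j, hj⟩
  exact ⟨j + 1, by rwa [pow_succ, mul_smul]⟩

lemma exists_pow_smul_mem [IsNoetherian (BK p k) T] {N N' : Submodule (BK p k) T}
    (h : ∀ x ∈ N', ∃ j : ℕ, (PowerSeries.X : BK p k) ^ j • x ∈ N) :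
    ∃ j : ℕ, ∀ x ∈ N', (PowerSeries.X : BK p k) ^ j • x ∈ N := by
  obtain ⟨s, hs⟩ := IsNoetherian.noetherian N'
  have h1 : ∀ t : Finset T, (∀ x ∈ t, x ∈ N') →
      ∃ j : ℕ, ∀ x ∈ t, (PowerSeries.X : BK p k) ^ j • x ∈ N := by
    classical
    intro t
    induction t using Finset.induction_on with
    | empty => exact fun _ => ⟨0, by simp⟩
    | insert a t _ ih =>
      intro ht
      obtain ⟨j, hj⟩ := ih fun x hx => ht x (Finset.mem_insert_of_mem hx)
      obtain ⟨i, hi⟩ := h a (ht a (Finset.mem_insert_self _ _))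
      refine ⟨i + j, fun x hx => ?_⟩
      rcases Finset.mem_insert.mp hx with rfl | hx
      · rw [add_comm, pow_add, mul_smul]; exact N.smul_mem _ hi
      · rw [pow_add, mul_smul]; exact N.smul_mem _ (hj x hx)
  obtain ⟨j, hj⟩ := h1 s fun x hx => hs ▸ Submodule.subset_span hx
  refine ⟨j, ?_⟩
  have : N' ≤ N.comap (LinearMap.lsmul (BK p k) T (PowerSeries.X ^ j)) := by
    rw [← hs, Submodule.span_le]
    exact fun x hx => hj x hx
  exact fun x hx => this hx

lemma IsPTorsion.exists_pow_uSat (hT : IsPTorsion p k T) (N : Submodule (BK p k) T) :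
    ∃ j : ℕ, ∀ x ∈ uSat N, (PowerSeries.X : BK p k) ^ j • x ∈ N :=
  have := hT.isNoetherian
  exists_pow_smul_mem fun _ hx => hx

lemma IsPTorsion.rho_uSat (hT : IsPTorsion p k T) (N : Submodule (BK p k) T) :
    rho (uSat N) = rho N := by
  obtain ⟨j, hj⟩ := hT.exists_pow_uSat N
  exact (hT.rho_eq (le_uSat N) hj).symm

lemma IsPTorsion.rho_mono (hT : IsPTorsion p k T) {N N' : Submodule (BK p k) T} (hle : N ≤ N') :
    rho N ≤ rho N' := by
  rw [← hT.rho_uSat N, ← hT.rho_uSat N']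
  have h1 : uSat N ≤ uSat N' := by
    rintro x ⟨j, hj⟩; exact ⟨j, hle hj⟩
  have := hT.rho_add h1 ((strictIn_uSat N).mono le_top)
  have h2 : (rho (uSat N) : ℕ∞) ≤ rho (uSat N') := by rw [this]; exact le_self_add
  exact_mod_cast h2

variable (ψ : T →ₛₗ[phi p k] T)

/-- The `𝔖`-submodule generated by `ψ(N)`. -/
noncomputable def frobSpan (N : Submodule (BK p k) T) : Submodule (BK p k) T := Submodule.span _ (ψ '' N)

/-- The linearization `φ^* T → T` of `ψ` is injective. -/
def FrobInj : Prop :=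
  ∀ x : Fin p → T, ∑ i : Fin p, (PowerSeries.X : BK p k) ^ (i : ℕ) • ψ (x i) = 0 → x = 0

/-- The negative of the length of the cokernel of the linearization of `ψ` on `N`. -/
noncomputable def delta (N : Submodule (BK p k) T) : ℤ :=
  -((relLength (frobSpan ψ N) N).toNat : ℤ)

/-- `N` is stable under `ψ`. -/
def Invariant (N : Submodule (BK p k) T) : Prop := ∀ x ∈ N, ψ x ∈ N

variable {ψ}

lemma frobSpan_mono {N N' : Submodule (BK p k) T} (h : N ≤ N') : frobSpan ψ N ≤ frobSpan ψ N' :=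
  Submodule.span_mono (Set.image_mono h)

lemma mem_frobSpan_of_mem {N : Submodule (BK p k) T} {x : T} (hx : x ∈ N) :
    ψ x ∈ frobSpan ψ N := Submodule.subset_span ⟨x, hx, rfl⟩

lemma Invariant.frobSpan_le {N : Submodule (BK p k) T} (h : Invariant ψ N) : frobSpan ψ N ≤ N := by
  rw [frobSpan, Submodule.span_le]
  rintro _ ⟨x, hx, rfl⟩
  exact h x hx

lemma smul_psi_eq (a : BK p k) (x : T) : ∃ b : Fin p → BK p k,
    a = ∑ i : Fin p, phi p k (b i) * PowerSeries.X ^ (i : ℕ) ∧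
    a • ψ x = ∑ i : Fin p, (PowerSeries.X : BK p k) ^ (i : ℕ) • ψ (b i • x) := by
  obtain ⟨b, hb⟩ := exists_eq_sum_phi p k a
  refine ⟨b, hb, ?_⟩
  conv_lhs => rw [hb]
  rw [Finset.sum_smul]
  refine Finset.sum_congr rfl fun i _ => ?_
  rw [map_smulₛₗ, smul_smul, mul_comm]

/-- Since `𝔖` is the direct sum of the `u ^ i φ(𝔖)` for `i < p`, every scalar can be absorbed into
the arguments of `ψ`, and `p` summands suffice. -/
lemma mem_frobSpan {N : Submodule (BK p k) T} {z : T} : z ∈ frobSpan ψ N ↔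
    ∃ x : Fin p → T, (∀ i, x i ∈ N) ∧
      z = ∑ i : Fin p, (PowerSeries.X : BK p k) ^ (i : ℕ) • ψ (x i) := by
  constructor
  · intro hz
    induction hz using Submodule.closure_induction with
    | zero => exact ⟨0, fun _ => N.zero_mem, by simp⟩
    | add y z _ _ hy hz =>
      obtain ⟨x, hx, rfl⟩ := hy
      obtain ⟨x', hx', rfl⟩ := hz
      exact ⟨x + x', fun i => N.add_mem (hx i) (hx' i), by
        simp [smul_add, Finset.sum_add_distrib]⟩
    | smul_mem a y hy =>
      obtain ⟨x, hx, rfl⟩ := hy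
      obtain ⟨b, -, hb⟩ := smul_psi_eq (ψ := ψ) a x
      exact ⟨fun i => b i • x, fun i => N.smul_mem _ hx, hb⟩
  · rintro ⟨x, hx, rfl⟩
    exact Submodule.sum_mem _ fun i _ => Submodule.smul_mem _ _ (mem_frobSpan_of_mem (hx i))

/-- The constant coefficient of the sum is the Witt vector Frobenius of that of `b 0`, and this
Frobenius is injective. -/
lemma dvd_of_X_dvd_sum {b : Fin p → BK p k}
    (h : (PowerSeries.X : BK p k) ∣ ∑ i : Fin p, phi p k (b i) * PowerSeries.X ^ (i : ℕ)) :
    PowerSeries.X ∣ b ⟨0, hp.out.pos⟩ := by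
  have h1 := coeff_sum_phi p k b 0 ⟨0, hp.out.pos⟩
  rw [PowerSeries.X_dvd_iff] at h ⊢
  simp only [mul_zero, add_zero, PowerSeries.coeff_zero_eq_constantCoeff_apply] at h1
  rw [h] at h1
  exact (WittVector.frobenius_bijective p k).1 (by rw [← h1, map_zero])

lemma mem_uMul_frobSpan {N : Submodule (BK p k) T} {z : T} (hz : z ∈ uMul (frobSpan ψ N)) :
    ∃ x : Fin p → T, (∀ i, x i ∈ N) ∧ x ⟨0, hp.out.pos⟩ ∈ uMul N ∧
      z = ∑ i : Fin p, (PowerSeries.X : BK p k) ^ (i : ℕ) • ψ (x i) := by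
  obtain ⟨z, hz, rfl⟩ := hz
  induction hz using Submodule.closure_induction with
  | zero => exact ⟨0, fun _ => N.zero_mem, zero_mem _, by simp⟩
  | add y z _ _ hy hz =>
    obtain ⟨x, hx, hx0, h1⟩ := hy
    obtain ⟨x', hx', hx0', h2⟩ := hz
    exact ⟨x + x', fun i => N.add_mem (hx i) (hx' i), add_mem hx0 hx0', by
      rw [map_add, h1, h2]
      simp [smul_add, Finset.sum_add_distrib]⟩
  | smul_mem a y hy =>
    obtain ⟨x, hx, rfl⟩ := hy
    obtain ⟨b, hb', hb⟩ := smul_psi_eq (ψ := ψ) (PowerSeries.X * a) x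
    refine ⟨fun i => b i • x, fun i => N.smul_mem _ hx, ?_, ?_⟩
    · obtain ⟨c, hc⟩ := dvd_of_X_dvd_sum (hb' ▸ Dvd.intro a rfl)
      exact ⟨c • x, N.smul_mem _ hx, by
        simp only [hc, LinearMap.lsmul_apply, smul_smul]⟩
    · rw [← hb, LinearMap.lsmul_apply, smul_smul]

lemma FrobInj.eq (hψ : FrobInj ψ) {x y : Fin p → T}
    (h : ∑ i : Fin p, (PowerSeries.X : BK p k) ^ (i : ℕ) • ψ (x i)
      = ∑ i : Fin p, (PowerSeries.X : BK p k) ^ (i : ℕ) • ψ (y i)) : x = y := by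
  rw [← sub_eq_zero]
  apply hψ
  simp only [Pi.sub_apply, map_sub, smul_sub, Finset.sum_sub_distrib, h, sub_self]

lemma sum_single (x : T) : ∑ i : Fin p, (PowerSeries.X : BK p k) ^ (i : ℕ) •
    ψ ((Pi.single ⟨0, hp.out.pos⟩ x : Fin p → T) i) = ψ x := by
  rw [Finset.sum_eq_single ⟨0, hp.out.pos⟩]
  · simp
  · intro i _ hi
    rw [Pi.single_eq_of_ne hi, map_zero, smul_zero]
  · simp

/-- An element of the span differs from its zeroth coordinate by a multiple of `u`. -/
lemma sum_sub_mem_uMul {N : Submodule (BK p k) T} {x : Fin p → T} (hx : ∀ i, x i ∈ N) :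
    (∑ i : Fin p, (PowerSeries.X : BK p k) ^ (i : ℕ) • ψ (x i)) - ψ (x ⟨0, hp.out.pos⟩)
      ∈ uMul (frobSpan ψ N) := by
  rw [← Finset.add_sum_erase _ _ (Finset.mem_univ (⟨0, hp.out.pos⟩ : Fin p)), pow_zero, one_smul,
    add_sub_cancel_left]
  refine Submodule.sum_mem _ fun i hi => ?_
  have hi0 : (i : ℕ) ≠ 0 := fun h => (Finset.mem_erase.mp hi).1 (Fin.ext h)
  obtain ⟨j, hj⟩ := Nat.exists_eq_succ_of_ne_zero hi0
  exact ⟨(PowerSeries.X : BK p k) ^ j • ψ (x i),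
    Submodule.smul_mem _ _ (mem_frobSpan_of_mem (hx i)), by
      rw [LinearMap.lsmul_apply, smul_smul, hj, pow_succ']⟩

/-- Modulo `u` only the zeroth coordinate of `∑ u ^ i ψ(x_i)` survives, so the span modulo `u` is
the Frobenius twist of `N / uN`. The two inequalities come from the strictly increasing maps `Y ↦
ψ⁻¹(Y) ∩ N` and `Y ↦ ⟨ψ(Y)⟩ + u⟨ψ(N)⟩`. -/
lemma FrobInj.relLength_uMul_frobSpan (hψ : FrobInj ψ) (N : Submodule (BK p k) T) :
    relLength (uMul (frobSpan ψ N)) (frobSpan ψ N) = relLength (uMul N) N := by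
  apply le_antisymm
  · refine relLength_le_of_strictMono (uMul_le _) (fun Y => Y.comap ψ ⊓ N) ?_ ?_
    · refine fun Y hY hY' => ⟨?_, inf_le_right⟩
      rintro _ ⟨x, hx, rfl⟩
      refine ⟨hY ?_, N.smul_mem _ hx⟩
      -- `φ(u) = u ^ p` is divisible by `u`, which places `ψ(uN)` inside `u⟨ψ(N)⟩`.
      obtain ⟨q, hq⟩ := Nat.exists_eq_succ_of_ne_zero hp.out.ne_zero
      have hX : (PowerSeries.X : BK p k) ^ p = PowerSeries.X * PowerSeries.X ^ q := by
        rw [← pow_succ']; exact congrArg _ hq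
      rw [LinearMap.lsmul_apply, map_smulₛₗ, phi_X, hX, mul_smul]
      exact ⟨_, Submodule.smul_mem _ _ (mem_frobSpan_of_mem hx), rfl⟩
    · intro Y Y' hY hlt hY'
      refine lt_of_le_of_ne (inf_le_inf_right _ (Submodule.comap_mono hlt.le)) fun h => ?_
      apply hlt.not_ge
      intro z hz
      obtain ⟨x, hx, rfl⟩ := mem_frobSpan.mp (hY' hz)
      have h1 := sum_sub_mem_uMul (ψ := ψ) hx
      have h2 : ψ (x ⟨0, hp.out.pos⟩) ∈ Y' := by
        have := Y'.sub_mem hz (hlt.le (hY h1))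
        rwa [sub_sub_cancel] at this
      have h3 : x ⟨0, hp.out.pos⟩ ∈ Y.comap ψ ⊓ N := by rw [h]; exact ⟨h2, hx _⟩
      have := Y.add_mem (hY h1) h3.1
      rwa [sub_add_cancel] at this
  · refine relLength_le_of_strictMono (uMul_le _)
      (fun Y => frobSpan ψ Y ⊔ uMul (frobSpan ψ N)) ?_ ?_
    · exact fun Y hY hY' => ⟨le_sup_right, sup_le (frobSpan_mono hY') (uMul_le _)⟩
    · intro Y Y' hY hlt hY'
      refine lt_of_le_of_ne (sup_le_sup_right (frobSpan_mono hlt.le) _) fun h => ?_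
      apply hlt.not_ge
      intro x hx
      have h1 : ψ x ∈ frobSpan ψ Y ⊔ uMul (frobSpan ψ N) := by
        rw [h]; exact Submodule.mem_sup_left (mem_frobSpan_of_mem hx)
      obtain ⟨y, hy, z, hz, hyz⟩ := Submodule.mem_sup.mp h1
      obtain ⟨a, ha, rfl⟩ := mem_frobSpan.mp hy
      obtain ⟨b, hb, hb0, rfl⟩ := mem_uMul_frobSpan hz
      have h2 : a + b = Pi.single ⟨0, hp.out.pos⟩ x := by
        apply hψ.eq
        rw [sum_single, ← hyz, ← Finset.sum_add_distrib]
        simp [smul_add]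
      have h3 := congrFun h2 ⟨0, hp.out.pos⟩
      rw [Pi.single_eq_same, Pi.add_apply] at h3
      rw [← h3]
      exact Y.add_mem (ha _) (hY hb0)

lemma FrobInj.rho_frobSpan (hψ : FrobInj ψ) (N : Submodule (BK p k) T) :
    rho (frobSpan ψ N) = rho N := by
  rw [rho, hψ.relLength_uMul_frobSpan, rho]

lemma FrobInj.mem_of_mem_frobSpan (hψ : FrobInj ψ) {N : Submodule (BK p k) T} {x : T}
    (h : ψ x ∈ frobSpan ψ N) : x ∈ N := by
  obtain ⟨a, ha, h1⟩ := mem_frobSpan.mp h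
  rw [← sum_single (ψ := ψ) x] at h1
  have h2 := congrFun (hψ.eq h1) ⟨0, hp.out.pos⟩
  rw [Pi.single_eq_same] at h2
  rw [h2]; exact ha _

/-- `N` is recovered from `⟨ψ(N)⟩` as the set of `x` with `ψ x` in it, so `frobSpan ψ` is strictly
increasing. Only this inequality enters the comparison of degrees. -/
lemma FrobInj.relLength_le_frobSpan (hψ : FrobInj ψ) {N N' : Submodule (BK p k) T} (h : N ≤ N') :
    relLength N N' ≤ relLength (frobSpan ψ N) (frobSpan ψ N') := by
  refine relLength_le_of_strictMono h (frobSpan ψ)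
    (fun x hx hx' => ⟨frobSpan_mono hx, frobSpan_mono hx'⟩) fun x y _ hxy _ => ?_
  refine lt_of_le_of_ne (frobSpan_mono hxy.le) fun he => hxy.not_ge fun z hz => ?_
  exact hψ.mem_of_mem_frobSpan (he ▸ mem_frobSpan_of_mem hz)

/-- The saturation of `⟨ψ(N)⟩` inside `N` is strict in `N` and has the rank of `⟨ψ(N)⟩`, which is
that of `N`; hence it is all of `N`. Injectivity of the linearization thus makes it bijective after
inverting `u`, on every stable submodule. -/
lemma IsPTorsion.exists_pow_frobSpan (hT : IsPTorsion p k T) (hψ : FrobInj ψ)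
    {N : Submodule (BK p k) T} (hN : Invariant ψ N) :
    ∃ j : ℕ, ∀ x ∈ N, (PowerSeries.X : BK p k) ^ j • x ∈ frobSpan ψ N := by
  obtain ⟨j, hj⟩ := hT.exists_pow_uSat (frobSpan ψ N)
  have h1 : rho (frobSpan ψ N) = rho (uSat (frobSpan ψ N) ⊓ N) :=
    hT.rho_eq (le_inf (le_uSat _) hN.frobSpan_le) fun x hx => hj x hx.1
  have h2 : uSat (frobSpan ψ N) ⊓ N = N := by
    refine hT.eq_of_rho_le inf_le_right ?_ ?_
    · exact fun x hx hX => ⟨strictIn_uSat _ x trivial hX.1, hx⟩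
    · rw [← h1, hψ.rho_frobSpan]
  exact ⟨j, fun x hx => hj x (inf_eq_right.mp h2 hx)⟩

lemma IsPTorsion.coe_delta (hT : IsPTorsion p k T) (hψ : FrobInj ψ)
    {N : Submodule (BK p k) T} (hN : Invariant ψ N) :
    relLength (frobSpan ψ N) N = ((-delta ψ N).toNat : ℕ∞) := by
  obtain ⟨j, hj⟩ := hT.exists_pow_frobSpan hψ hN
  rw [delta, neg_neg, Int.toNat_natCast, ENat.natCast_toNat (hT.relLength_ne_top hj)]

lemma delta_nonpos (N : Submodule (BK p k) T) : delta ψ N ≤ 0 := by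
  rw [delta]; simp

/-- If `∑ u ^ i ψ(x_i)` lies in `N`, a multiple by a power of `u` lies in `⟨ψ(N)⟩`. Uniqueness of
coordinates puts `u ^ j x_i` in `N`, and strictness removes `u ^ j`. This is the counterpart for `ψ`
of `N ∩ uN' = uN`. -/
lemma IsPTorsion.inf_frobSpan (hT : IsPTorsion p k T) (hψ : FrobInj ψ)
    {N N' : Submodule (BK p k) T} (hle : N ≤ N') (hN : Invariant ψ N) (h : StrictIn N N') :
    N ⊓ frobSpan ψ N' = frobSpan ψ N := by
  apply le_antisymm _ (le_inf hN.frobSpan_le (frobSpan_mono hle))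
  rintro z ⟨hz, hz'⟩
  obtain ⟨x, hx, rfl⟩ := mem_frobSpan.mp hz'
  obtain ⟨j, hj⟩ := hT.exists_pow_frobSpan hψ hN
  have h1 := hj _ hz
  -- The exponent is `p * j` because `u ^ (p * j) = φ(u ^ j)` can be moved inside `ψ`.
  have h2 : (PowerSeries.X : BK p k) ^ (p * j) •
      ∑ i : Fin p, (PowerSeries.X : BK p k) ^ (i : ℕ) • ψ (x i) ∈ frobSpan ψ N := by
    have hpj : p * j = (p * j - j) + j :=
      (Nat.sub_add_cancel (Nat.le_mul_of_pos_left j hp.out.pos)).symm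
    rw [hpj, pow_add, mul_smul]
    exact Submodule.smul_mem _ _ h1
  obtain ⟨y, hy, h3⟩ := mem_frobSpan.mp h2
  have h4 : (fun i => (PowerSeries.X : BK p k) ^ j • x i) = y := by
    apply hψ.eq
    rw [← h3, Finset.smul_sum]
    refine Finset.sum_congr rfl fun i _ => ?_
    rw [map_smulₛₗ, map_pow, phi_X, ← pow_mul, smul_comm]
  exact mem_frobSpan.mpr ⟨x, fun i => h.pow j (hx i) (by
    have : (PowerSeries.X : BK p k) ^ j • x i = y i := congrFun h4 i
    rw [this]; exact hy i), rfl⟩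

lemma IsPTorsion.delta_add (hT : IsPTorsion p k T) (hψ : FrobInj ψ)
    {N N' : Submodule (BK p k) T} (hle : N ≤ N') (hN : Invariant ψ N) (hN' : Invariant ψ N')
    (h : StrictIn N N') :
    relLength (frobSpan ψ N') N' = relLength (frobSpan ψ N) N
      + relLength (N ⊔ frobSpan ψ N') N' := by
  rw [relLength_add (b := N ⊔ frobSpan ψ N') le_sup_right (sup_le hle hN'.frobSpan_le),
    relLength_sup_right, ← relLength_inf_left, inf_comm, hT.inf_frobSpan hψ hle hN h]

/-- Both `N` and `⟨ψ(N')⟩` lie between `⟨ψ(N)⟩` and `N'`. Since `⟨ψ(N')⟩ / ⟨ψ(N)⟩` is at least as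
long as `N' / N`, the cokernel of `ψ` on `N'` is no longer than the one on `N`. -/
lemma IsPTorsion.delta_le (hT : IsPTorsion p k T) (hψ : FrobInj ψ)
    {N N' : Submodule (BK p k) T} (hle : N ≤ N') (hN : Invariant ψ N) (hN' : Invariant ψ N')
    {j : ℕ} (h : ∀ x ∈ N', (PowerSeries.X : BK p k) ^ j • x ∈ N) : delta ψ N ≤ delta ψ N' := by
  have h1 := relLength_add hN.frobSpan_le hle
  have h2 := relLength_add (frobSpan_mono (ψ := ψ) hle) hN'.frobSpan_le
  have h3 := hψ.relLength_le_frobSpan hle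
  rw [h1, add_comm] at h2
  have h4 : relLength N N' + relLength (frobSpan ψ N') N' ≤
      relLength N N' + relLength (frobSpan ψ N) N := by
    rw [h2]; gcongr
  have h5 := (ENat.add_le_add_iff_left (hT.relLength_ne_top h)).mp h4
  rw [hT.coe_delta hψ hN, hT.coe_delta hψ hN'] at h5
  have h6 : (-delta ψ N').toNat ≤ (-delta ψ N).toNat := by exact_mod_cast h5
  have := delta_nonpos (ψ := ψ) N
  have := delta_nonpos (ψ := ψ) N'
  omega

end SemilinearFrobenius

/-! ### Additivity of rank and degree along morphisms -/

section SemilinearMaps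

variable {p : ℕ} [hp : Fact p.Prime] {k : Type u} [Field k] [CharP k p] [PerfectRing k p]
  {T S : Type*} [AddCommGroup T] [Module (BK p k) T] [AddCommGroup S] [Module (BK p k) S]
  {ψ : T →ₛₗ[phi p k] T} {ψ' : S →ₛₗ[phi p k] S}

lemma strictIn_inf_ker (hS : NoUTorsion p k S) (f : T →ₗ[BK p k] S) (N : Submodule (BK p k) T) :
    StrictIn (N ⊓ LinearMap.ker f) N := fun x hx hX =>
  ⟨hx, hS _ (by rw [← map_smul]; exact hX.2)⟩

lemma uMul_map (f : T →ₗ[BK p k] S) (N : Submodule (BK p k) T) :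
    uMul (N.map f) = (uMul N).map f := by
  rw [uMul, uMul, ← Submodule.map_comp, ← Submodule.map_comp]
  congr 1
  ext x; simp

lemma frobSpan_map {f : T →ₗ[BK p k] S} (hf : ∀ x, f (ψ x) = ψ' (f x))
    (N : Submodule (BK p k) T) : frobSpan ψ' (N.map f) = (frobSpan ψ N).map f := by
  rw [frobSpan, frobSpan, Submodule.map_span]
  congr 1
  ext y
  constructor
  · rintro ⟨_, ⟨x, hx, rfl⟩, rfl⟩
    exact ⟨ψ x, ⟨x, hx, rfl⟩, hf x⟩
  · rintro ⟨_, ⟨x, hx, rfl⟩, rfl⟩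
    exact ⟨f x, ⟨x, hx, rfl⟩, (hf x).symm⟩

lemma map_inf_ker_sup {A : Type*} [CommRing A] {T S : Type*} [AddCommGroup T] [Module A T]
    [AddCommGroup S] [Module A S] (f : T →ₗ[A] S) (N N' : Submodule A T) :
    ((N ⊓ LinearMap.ker f) ⊔ N').map f = N'.map f := by
  rw [Submodule.map_sup, sup_eq_right]
  rintro _ ⟨x, hx, rfl⟩
  rw [LinearMap.mem_ker.mp hx.2]
  exact zero_mem _

/-- The kernel of a map to a module without `u`-torsion is strict, and `f` identifies the extra term
of `rho_add` with the length of `f(N) / u f(N)`. `delta_eq_add_map` follows the same pattern with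
`frobSpan` in place of `uMul`. -/
lemma IsPTorsion.rho_eq_add_map (hT : IsPTorsion p k T) (hS : IsPTorsion p k S)
    (f : T →ₗ[BK p k] S) (N : Submodule (BK p k) T) :
    rho N = rho (N ⊓ LinearMap.ker f) + rho (N.map f) := by
  have h := hT.rho_add inf_le_left (strictIn_inf_ker hS.noUTorsion f N)
  rw [← relLength_map f (sup_le inf_le_left (uMul_le N)) (by rw [inf_comm]; exact le_sup_left),
    map_inf_ker_sup, ← uMul_map, ← hS.coe_rho] at h
  exact_mod_cast h

lemma Invariant.map {f : T →ₗ[BK p k] S} (hf : ∀ x, f (ψ x) = ψ' (f x))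
    {N : Submodule (BK p k) T} (h : Invariant ψ N) : Invariant ψ' (N.map f) := by
  rintro _ ⟨x, hx, rfl⟩
  exact ⟨ψ x, h x hx, hf x⟩

lemma Invariant.comap {f : T →ₗ[BK p k] S} (hf : ∀ x, f (ψ x) = ψ' (f x))
    {N : Submodule (BK p k) S} (h : Invariant ψ' N) : Invariant ψ (N.comap f) := by
  intro x hx
  rw [Submodule.mem_comap, hf]
  exact h _ hx

lemma Invariant.inf {N N' : Submodule (BK p k) T} (h : Invariant ψ N) (h' : Invariant ψ N') :
    Invariant ψ (N ⊓ N') := fun x hx => ⟨h x hx.1, h' x hx.2⟩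

lemma Invariant.sup {N N' : Submodule (BK p k) T} (h : Invariant ψ N) (h' : Invariant ψ N') :
    Invariant ψ (N ⊔ N') := by
  intro x hx
  obtain ⟨y, hy, z, hz, rfl⟩ := Submodule.mem_sup.mp hx
  rw [map_add]
  exact Submodule.add_mem_sup (h y hy) (h' z hz)

lemma invariant_ker {f : T →ₗ[BK p k] S} (hf : ∀ x, f (ψ x) = ψ' (f x)) :
    Invariant ψ (LinearMap.ker f) := fun x hx => by
  rw [LinearMap.mem_ker, hf, LinearMap.mem_ker.mp hx, map_zero]

lemma Invariant.uSat {N : Submodule (BK p k) T} (h : Invariant ψ N) : Invariant ψ (uSat N) := by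
  rintro x ⟨j, hj⟩
  refine ⟨p * j, ?_⟩
  have := h _ hj
  rwa [map_smulₛₗ, map_pow, phi_X, ← pow_mul] at this

lemma invariant_top : Invariant ψ ⊤ := fun _ _ => trivial

lemma invariant_bot : Invariant ψ ⊥ := fun x hx => by
  rw [(Submodule.mem_bot _).mp hx, map_zero]; exact zero_mem _

lemma IsPTorsion.delta_eq_add_map (hT : IsPTorsion p k T) (hS : IsPTorsion p k S)
    (hψ : FrobInj ψ) (hψ' : FrobInj ψ') {f : T →ₗ[BK p k] S} (hf : ∀ x, f (ψ x) = ψ' (f x))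
    {N : Submodule (BK p k) T} (hN : Invariant ψ N) :
    delta ψ N = delta ψ (N ⊓ LinearMap.ker f) + delta ψ' (N.map f) := by
  have hK : Invariant ψ (N ⊓ LinearMap.ker f) := hN.inf (invariant_ker hf)
  have h := hT.delta_add hψ inf_le_left hK hN (strictIn_inf_ker hS.noUTorsion f N)
  rw [← relLength_map f (sup_le inf_le_left hN.frobSpan_le) (by rw [inf_comm]; exact le_sup_left),
    map_inf_ker_sup, ← frobSpan_map hf, hT.coe_delta hψ hN, hT.coe_delta hψ hK,
    hS.coe_delta hψ' (hN.map hf)] at h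
  have h' : (-delta ψ N).toNat = (-delta ψ (N ⊓ LinearMap.ker f)).toNat
      + (-delta ψ' (N.map f)).toNat := by exact_mod_cast h
  have := delta_nonpos (ψ := ψ) N
  have := delta_nonpos (ψ := ψ) (N ⊓ LinearMap.ker f)
  have := delta_nonpos (ψ := ψ') (N.map f)
  omega

@[simp] lemma rho_bot : rho (⊥ : Submodule (BK p k) T) = 0 := by
  rw [rho, relLength_eq_zero.mpr bot_le]; rfl

@[simp] lemma delta_bot : delta ψ ⊥ = 0 := by
  rw [delta, relLength_eq_zero.mpr bot_le]; rfl

lemma IsPTorsion.rho_map_of_injective (hT : IsPTorsion p k T) (hS : IsPTorsion p k S)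
    {f : T →ₗ[BK p k] S} (hf : Function.Injective f) (N : Submodule (BK p k) T) :
    rho (N.map f) = rho N := by
  rw [hT.rho_eq_add_map hS f N, LinearMap.ker_eq_bot.mpr hf, inf_bot_eq, rho_bot, zero_add]

lemma IsPTorsion.delta_map_of_injective (hT : IsPTorsion p k T) (hS : IsPTorsion p k S)
    (hψ : FrobInj ψ) (hψ' : FrobInj ψ') {f : T →ₗ[BK p k] S} (hf : ∀ x, f (ψ x) = ψ' (f x))
    (hinj : Function.Injective f) {N : Submodule (BK p k) T} (hN : Invariant ψ N) :
    delta ψ' (N.map f) = delta ψ N := by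
  rw [hT.delta_eq_add_map hS hψ hψ' hf hN, LinearMap.ker_eq_bot.mpr hinj, inf_bot_eq, delta_bot,
    zero_add]

/-- The map induced by `ψ` on the quotient by a stable submodule. -/
noncomputable def quotPsi (ψ : T →ₛₗ[phi p k] T) {N : Submodule (BK p k) T} (hN : Invariant ψ N) :
    (T ⧸ N) →ₛₗ[phi p k] (T ⧸ N) := Submodule.mapQ N N ψ hN

lemma quotPsi_mkQ {N : Submodule (BK p k) T} (hN : Invariant ψ N) (x : T) :
    N.mkQ (ψ x) = quotPsi ψ hN (N.mkQ x) := rfl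

/-- A relation in `T / N` lifts to an element of `N ∩ ⟨ψ(T)⟩ = ⟨ψ(N)⟩`, so its coordinates already
lie in `N`. -/
lemma FrobInj.quotPsi (hψ : FrobInj ψ) (hT : IsPTorsion p k T) {N : Submodule (BK p k) T}
    (hN : Invariant ψ N) (hs : StrictIn N ⊤) : FrobInj (quotPsi ψ hN) := by
  intro x hx
  choose y hy using fun i => N.mkQ_surjective (x i)
  simp only [← hy, ← quotPsi_mkQ, ← map_smul] at hx
  rw [← map_sum, ← LinearMap.mem_ker, Submodule.ker_mkQ] at hx
  have h1 : ∑ i : Fin p, (PowerSeries.X : BK p k) ^ (i : ℕ) • ψ (y i) ∈ N ⊓ frobSpan ψ ⊤ :=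
    ⟨hx, mem_frobSpan.mpr ⟨y, fun _ => trivial, rfl⟩⟩
  rw [hT.inf_frobSpan hψ le_top hN hs] at h1
  obtain ⟨z, hz, h2⟩ := mem_frobSpan.mp h1
  rw [hψ.eq h2] at hy
  funext i
  rw [← hy i, Pi.zero_apply, ← LinearMap.mem_ker, Submodule.ker_mkQ]
  exact hz i

lemma map_mkQ_sup {A : Type*} [CommRing A] {T : Type*} [AddCommGroup T] [Module A T]
    (N N' : Submodule A T) : (N ⊔ N').map N.mkQ = N'.map N.mkQ := by
  rw [Submodule.map_sup, Submodule.mkQ_map_self, bot_sup_eq]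

/-- `N + N'` and `N'` have the same image in `T / N`, with kernels `N` and `N ∩ N'`; additivity does
the rest, here and for `delta`. Strictness of `N` makes `T / N` an admissible target. -/
lemma IsPTorsion.rho_sup_add_inf (hT : IsPTorsion p k T) {N : Submodule (BK p k) T}
    (hs : StrictIn N ⊤) (N' : Submodule (BK p k) T) :
    rho (N ⊔ N') + rho (N ⊓ N') = rho N + rho N' := by
  have hS := hT.quotient N (strictIn_top_iff.mp hs)
  have h1 := hT.rho_eq_add_map hS N.mkQ (N ⊔ N')
  have h2 := hT.rho_eq_add_map hS N.mkQ N'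
  rw [map_mkQ_sup, Submodule.ker_mkQ, inf_eq_right.mpr le_sup_left] at h1
  rw [Submodule.ker_mkQ, inf_comm] at h2
  omega

lemma IsPTorsion.delta_sup_add_inf (hT : IsPTorsion p k T) (hψ : FrobInj ψ)
    {N N' : Submodule (BK p k) T} (hN : Invariant ψ N) (hN' : Invariant ψ N')
    (hs : StrictIn N ⊤) :
    delta ψ (N ⊔ N') + delta ψ (N ⊓ N') = delta ψ N + delta ψ N' := by
  have hS := hT.quotient N (strictIn_top_iff.mp hs)
  have hq := hψ.quotPsi hT hN hs
  have h1 := hT.delta_eq_add_map hS hψ hq (quotPsi_mkQ hN) (hN.sup hN')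
  have h2 := hT.delta_eq_add_map hS hψ hq (quotPsi_mkQ hN) hN'
  rw [map_mkQ_sup, Submodule.ker_mkQ, inf_eq_right.mpr le_sup_left] at h1
  rw [Submodule.ker_mkQ, inf_comm] at h2
  omega

/-- The equality for sums and intersections becomes an inequality for strict subobjects, whose join
is a saturated sum. This is the source of supermodularity. -/
lemma IsPTorsion.delta_le_uSat (hT : IsPTorsion p k T) (hψ : FrobInj ψ)
    {N : Submodule (BK p k) T} (hN : Invariant ψ N) : delta ψ N ≤ delta ψ (uSat N) := by
  obtain ⟨j, hj⟩ := hT.exists_pow_uSat N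
  exact hT.delta_le hψ (le_uSat N) hN hN.uSat hj

end SemilinearMaps

/-! ### Elements of `M[1/E]` and of the Frobenius pullback -/

section LocalizationAndPullback

variable {R : Type u} [CommRing R] (φ : R →+* R) (E : R) {M N : Type*} [AddCommGroup M]
  [Module R M] [AddCommGroup N] [Module R N]

/-- The `φ`-semilinear map `M → φ^* M`, `x ↦ 1 ⊗ x`. -/
noncomputable def Pullback.incl : M →ₛₗ[φ] Pullback φ M where
  toFun x := ((1 : Twist φ) ⊗ₜ[R] x : Twist φ ⊗[R] M)
  map_add' x y := TensorProduct.tmul_add _ _ _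
  map_smul' a x := by
    change ((1 : Twist φ) ⊗ₜ[R] (a • x) : Twist φ ⊗[R] M)
      = (algebraMap R (Twist φ) a) • ((1 : Twist φ) ⊗ₜ[R] x : Twist φ ⊗[R] M)
    rw [TensorProduct.tmul_smul, TensorProduct.smul_tmul', TensorProduct.smul_tmul', Algebra.smul_def,
      smul_eq_mul]

lemma Pullback.map_incl (f : M →ₗ[R] N) (x : M) :
    Pullback.map φ f (Pullback.incl φ x) = Pullback.incl φ (f x) := rfl

lemma Pullback.smul_incl (a : R) (x : M) :
    a • Pullback.incl φ x = ((show Twist φ from a) ⊗ₜ[R] x : Twist φ ⊗[R] M) := by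
  change (show Twist φ from a) • ((1 : Twist φ) ⊗ₜ[R] x : Twist φ ⊗[R] M) = _
  rw [TensorProduct.smul_tmul', smul_eq_mul, mul_one]

lemma Pullback.span_incl : Submodule.span R (Set.range (Pullback.incl φ (M := M))) = ⊤ := by
  rw [eq_top_iff]
  rintro (z : Twist φ ⊗[R] M) -
  induction z using TensorProduct.induction_on with
  | zero => exact zero_mem _
  | add x y hx hy => exact add_mem hx hy
  | tmul a m =>
    have := Pullback.smul_incl φ (M := M) a m
    rw [← this]
    exact Submodule.smul_mem _ _ (Submodule.subset_span ⟨m, rfl⟩)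

/-- The map `M → M[1/E]`. -/
noncomputable abbrev Away.mk : M →ₗ[R] Away E M :=
  LocalizedModule.mkLinearMap (Submonoid.powers E) M

variable {E}

lemma Away.map_mk (f : M →ₗ[R] N) (x : M) : Away.map E f (Away.mk E x) = Away.mk E (f x) := by
  simp [Away.map, LocalizedModule.mkLinearMap_apply, LocalizedModule.map_mk]

lemma Away.exists_pow_smul (y : Away E M) : ∃ (n : ℕ) (x : M), E ^ n • y = Away.mk E x := by
  obtain ⟨⟨x, ⟨_, n, rfl⟩⟩, h⟩ := IsLocalizedModule.surj (Submonoid.powers E) (Away.mk E) y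
  exact ⟨n, x, h⟩

lemma Away.pow_smul_injective (n : ℕ) {x y : Away E M} (h : E ^ n • x = E ^ n • y) : x = y :=
  IsLocalizedModule.smul_injective (Away.mk E (M := M)) (⟨E ^ n, n, rfl⟩ : Submonoid.powers E) h

lemma Away.mk_eq_zero {x : M} : Away.mk E x = 0 ↔ ∃ n : ℕ, E ^ n • x = 0 := by
  rw [IsLocalizedModule.eq_zero_iff (Submonoid.powers E)]
  constructor
  · rintro ⟨⟨_, n, rfl⟩, h⟩; exact ⟨n, h⟩
  · rintro ⟨n, h⟩; exact ⟨⟨E ^ n, n, rfl⟩, h⟩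

/-- The inverse of `E ^ n` in `R[1/E]`. -/
lemma Away.exists_inv (n : ℕ) : ∃ c : Localization.Away E, ∀ y : Away E M, c • E ^ n • y = y := by
  obtain ⟨c, hc⟩ := (IsLocalization.map_units (Localization.Away E)
    (⟨E ^ n, n, rfl⟩ : Submonoid.powers E)).exists_left_inv
  refine ⟨c, fun y => ?_⟩
  rw [← algebraMap_smul (Localization.Away E) (E ^ n) y, smul_smul, hc, one_smul]

lemma Away.mem_of_pow_smul_mem {W : Submodule (Localization.Away E) (Away E M)} {n : ℕ}
    {y : Away E M} (h : E ^ n • y ∈ W) : y ∈ W := by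
  obtain ⟨c, hc⟩ := Away.exists_inv (E := E) (M := M) n
  rw [← hc y]
  exact W.smul_mem c h

lemma Away.range_map (f : M →ₗ[R] N) : LinearMap.range (Away.map E f)
    = Submodule.span (Localization.Away E) (Set.range fun x => Away.mk E (f x)) := by
  apply le_antisymm
  · rintro _ ⟨y, rfl⟩
    obtain ⟨n, x, h⟩ := Away.exists_pow_smul y
    apply Away.mem_of_pow_smul_mem (n := n)
    have : E ^ n • Away.map E f y = Away.mk E (f x) := by
      rw [← Away.map_mk, ← h, ← algebraMap_smul (Localization.Away E) (E ^ n) y, map_smul,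
        algebraMap_smul]
    rw [this]
    exact Submodule.subset_span ⟨x, rfl⟩
  · rw [Submodule.span_le]
    rintro _ ⟨x, rfl⟩
    exact ⟨Away.mk E x, Away.map_mk f x⟩

lemma Away.range_map_pullback (f : M →ₗ[R] N) : LinearMap.range (Away.map E (Pullback.map φ f))
    = Submodule.span (Localization.Away E)
      (Set.range fun x => Away.mk E (Pullback.incl φ (f x))) := by
  rw [Away.range_map]
  apply le_antisymm
  · rw [Submodule.span_le]
    rintro _ ⟨z, rfl⟩
    have hz : z ∈ Submodule.span R (Set.range (Pullback.incl φ (M := M))) := by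
      rw [Pullback.span_incl]; trivial
    change Away.mk E (Pullback.map φ f z) ∈ _
    induction hz using Submodule.span_induction with
    | mem y hy =>
      obtain ⟨x, rfl⟩ := hy
      exact Submodule.subset_span ⟨x, rfl⟩
    | zero => rw [map_zero, map_zero]; exact zero_mem _
    | add x y _ _ hx hy => rw [map_add, map_add]; exact add_mem hx hy
    | smul a x _ hx =>
      rw [map_smul, map_smul, ← algebraMap_smul (Localization.Away E)]
      exact Submodule.smul_mem _ _ hx
  · refine Submodule.span_mono ?_
    rintro _ ⟨x, rfl⟩
    exact ⟨Pullback.incl φ x, rfl⟩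

lemma FrobStr.map_smul_base (F : FrobStr φ E M) (a : R) (y : Away E (Pullback φ M)) :
    F (a • y) = a • F y := by
  rw [← algebraMap_smul (Localization.Away E) a y, map_smul, algebraMap_smul]

end LocalizationAndPullback

/-! ### Comparison of `E` with a power of `u` modulo `p` -/

section Uniformizer

variable {p : ℕ} [hp : Fact p.Prime] {k : Type u} [Field k] [CharP k p] [PerfectRing k p]
  {E : (WittVector p k)[X]} [hE : IsUniformizerPoly p k E]

/-- Eisenstein: every coefficient below the leading one is divisible by `p`. -/
lemma exists_eq_X_pow_add : ∃ g : BK p k,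
    (E : BK p k) = PowerSeries.X ^ E.natDegree + (p : BK p k) * g := by
  have h : (Polynomial.C (p : WittVector p k)) ∣ E - Polynomial.X ^ E.natDegree := by
    rw [Polynomial.C_dvd_iff_dvd_coeff]
    intro i
    rw [Polynomial.coeff_sub, Polynomial.coeff_X_pow]
    rcases lt_trichotomy i E.natDegree with h | h | h
    · rw [if_neg h.ne, sub_zero, ← Ideal.mem_span_singleton]
      exact hE.isEisensteinAt.mem h
    · rw [if_pos h, h, hE.monic.coeff_natDegree, sub_self]
      exact dvd_zero _
    · rw [if_neg h.ne', sub_zero, Polynomial.coeff_eq_zero_of_natDegree_lt h]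
      exact dvd_zero _
  obtain ⟨g, hg⟩ := h
  refine ⟨(g : BK p k), (congrArg (fun q : (WittVector p k)[X] => (q : BK p k))
    (sub_eq_iff_eq_add.mp hg)).trans ?_⟩
  have hp : (((p : (WittVector p k)[X]) : (WittVector p k)[X]) : BK p k) = (p : BK p k) :=
    map_natCast Polynomial.coeToPowerSeries.ringHom p
  simp [add_comm, hp]

lemma exists_pow_eq {a b c : BK p k} (h : a = b + (p : BK p k) * c) (m n : ℕ) :
    ∃ x y : BK p k, a ^ (m + n) = x * b ^ m + y * (p : BK p k) ^ n := by
  have h1 : a ^ (m + n) ∈ Ideal.span {b ^ m, (p : BK p k) ^ n} := by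
    rw [h]
    refine Ideal.add_pow_mem_of_pow_mem_of_le (m := m) (n := n) _ ?_ ?_ (by omega)
    · exact Ideal.subset_span (by simp)
    · rw [mul_pow]
      exact Ideal.mul_mem_right _ _ (Ideal.subset_span (by simp))
  obtain ⟨x, y, h2⟩ := Ideal.mem_span_pair.mp h1
  exact ⟨x, y, h2.symm⟩

-- With `exists_E_pow_eq`, this shows that powers of `E` and of `u` divide each other modulo any
-- power of `p`, so that `E` and `u` have the same localizations on `p`-power torsion modules.
variable (E) in
lemma exists_X_pow_eq (m n : ℕ) : ∃ (N : ℕ) (x y : BK p k),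
    (PowerSeries.X : BK p k) ^ N = x * (E : BK p k) ^ m + y * (p : BK p k) ^ n := by
  obtain ⟨g, hg⟩ := exists_eq_X_pow_add (p := p) (k := k) (E := E)
  have h : (PowerSeries.X : BK p k) ^ E.natDegree = (E : BK p k) + (p : BK p k) * (-g) := by
    rw [hg]; ring
  obtain ⟨x, y, h1⟩ := exists_pow_eq h m n
  exact ⟨E.natDegree * (m + n), x, y, by rw [pow_mul, h1]⟩

variable (E) in
lemma exists_E_pow_eq (m n : ℕ) : ∃ (N : ℕ) (x y : BK p k),
    (E : BK p k) ^ N = x * PowerSeries.X ^ m + y * (p : BK p k) ^ n := by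
  obtain ⟨g, hg⟩ := exists_eq_X_pow_add (p := p) (k := k) (E := E)
  obtain ⟨x, y, h1⟩ := exists_pow_eq hg m n
  refine ⟨m + n, x * PowerSeries.X ^ (E.natDegree * m - m), y, ?_⟩
  rw [h1, ← pow_mul, mul_assoc, ← pow_add, Nat.sub_add_cancel]
  exact Nat.le_mul_of_pos_left m hE.natDegree_pos

end Uniformizer

/-! ### Localization and pullback of torsion modules -/

section TorsionLocalization

variable {p : ℕ} [hp : Fact p.Prime] {k : Type u} [Field k] [CharP k p] [PerfectRing k p]
  {E : (WittVector p k)[X]} [hE : IsUniformizerPoly p k E]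
  {T : Type*} [AddCommGroup T] [Module (BK p k) T]

lemma Away.killed {n : ℕ} (h : ∀ x : T, (p : BK p k) ^ n • x = 0) (y : Away (E : BK p k) T) :
    (p : BK p k) ^ n • y = 0 := by
  obtain ⟨m, x, hx⟩ := Away.exists_pow_smul y
  apply Away.pow_smul_injective m
  rw [smul_comm, hx, ← map_smul, h, map_zero, smul_zero]

/-- A power of `E` is a multiple of `u ^ j` modulo `p ^ n`, so `u` is invertible on `T[1/E]`. -/
lemma Away.mem_of_X_pow_smul_mem {n : ℕ} (h : ∀ x : T, (p : BK p k) ^ n • x = 0)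
    {W : Submodule (Localization.Away (E : BK p k)) (Away (E : BK p k) T)} {j : ℕ}
    {y : Away (E : BK p k) T} (hy : (PowerSeries.X : BK p k) ^ j • y ∈ W) : y ∈ W := by
  obtain ⟨N, a, b, hab⟩ := exists_E_pow_eq (p := p) (k := k) E j n
  apply Away.mem_of_pow_smul_mem (n := N)
  rw [hab, add_smul, mul_smul, mul_smul, Away.killed h, smul_zero, add_zero,
    ← algebraMap_smul (Localization.Away (E : BK p k)) a]
  exact W.smul_mem _ hy

lemma Away.X_pow_smul_injective {n : ℕ} (h : ∀ x : T, (p : BK p k) ^ n • x = 0) (j : ℕ)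
    {x y : Away (E : BK p k) T}
    (hxy : (PowerSeries.X : BK p k) ^ j • x = (PowerSeries.X : BK p k) ^ j • y) : x = y := by
  rw [← sub_eq_zero]
  have : x - y ∈ (⊥ : Submodule (Localization.Away (E : BK p k)) (Away (E : BK p k) T)) := by
    apply Away.mem_of_X_pow_smul_mem h (j := j)
    rw [smul_sub, hxy, sub_self]
    exact zero_mem _
  exact this

lemma Away.exists_X_pow_smul {n : ℕ} (h : ∀ x : T, (p : BK p k) ^ n • x = 0)
    (y : Away (E : BK p k) T) :
    ∃ (j : ℕ) (x : T), (PowerSeries.X : BK p k) ^ j • y = Away.mk (E : BK p k) x := by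
  obtain ⟨m, x, hx⟩ := Away.exists_pow_smul y
  obtain ⟨N, a, b, hab⟩ := exists_X_pow_eq (p := p) (k := k) E m n
  refine ⟨N, a • x, ?_⟩
  rw [hab, add_smul, mul_smul, mul_smul, Away.killed h, smul_zero, add_zero, hx, map_smul]

lemma eq_zero_of_E_pow_smul {n : ℕ} (h : ∀ x : T, (p : BK p k) ^ n • x = 0)
    (hu : NoUTorsion p k T) {m : ℕ} {x : T} (hx : (E : BK p k) ^ m • x = 0) : x = 0 := by
  obtain ⟨N, a, b, hab⟩ := exists_X_pow_eq (p := p) (k := k) E m n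
  apply hu.pow N
  rw [hab, add_smul, mul_smul, mul_smul, h, smul_zero, add_zero, hx, smul_zero]

variable (E) in
lemma Away.mk_injective {n : ℕ} (h : ∀ x : T, (p : BK p k) ^ n • x = 0)
    (hu : NoUTorsion p k T) : Function.Injective (Away.mk (E : BK p k) (M := T)) := by
  rw [← LinearMap.ker_eq_bot, LinearMap.ker_eq_bot']
  intro x hx
  obtain ⟨m, hm⟩ := Away.mk_eq_zero.mp hx
  exact eq_zero_of_E_pow_smul h hu hm

/-- The basis `1, u, …, u ^ (p - 1)` of `𝔖` over `φ(𝔖)`. -/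
lemma exists_twist_basis : ∃ b : Module.Basis (Fin p) (BK p k) (Twist (phi p k)),
    ∀ i, b i = (show Twist (phi p k) from (PowerSeries.X : BK p k) ^ (i : ℕ)) := by
  let T : (Fin p → BK p k) →ₗ[BK p k] Twist (phi p k) :=
    Fintype.linearCombination (BK p k)
      (fun i : Fin p => ((PowerSeries.X : BK p k) ^ (i : ℕ) : Twist (phi p k)))
  have hT : ∀ f, T f = (∑ i : Fin p, phi p k (f i) * PowerSeries.X ^ (i : ℕ) : BK p k) := by
    intro f
    exact Fintype.linearCombination_apply (BK p k) _ f
  have hbij : Function.Bijective T := by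
    constructor
    · rw [← LinearMap.ker_eq_bot, LinearMap.ker_eq_bot']
      intro f hf
      rw [hT] at hf
      exact eq_zero_of_sum_phi_eq_zero p k hf
    · intro (y : BK p k)
      obtain ⟨f, hf⟩ := exists_eq_sum_phi p k y
      exact ⟨f, (hT f).trans hf.symm⟩
  refine ⟨Module.Basis.ofEquivFun (LinearEquiv.ofBijective T hbij).symm, fun i => ?_⟩
  rw [Module.Basis.coe_ofEquivFun]
  change T (Pi.single i 1) = _
  rw [hT, Finset.sum_eq_single i]
  · rw [Pi.single_eq_same, map_one, one_mul]
  · intro j _ hj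
    rw [Pi.single_eq_of_ne hj, map_zero, zero_mul]
  · simp

lemma Pullback.eq_zero_of_sum_eq_zero {x : Fin p → T}
    (h : ∑ i : Fin p, (PowerSeries.X : BK p k) ^ (i : ℕ) • Pullback.incl (phi p k) (x i) = 0) :
    x = 0 := by
  obtain ⟨b, hb⟩ := exists_twist_basis (p := p) (k := k)
  have h1 := TensorProduct.sum_tmul_basis_left_eq_zero b (Finsupp.equivFunOnFinite.symm x) (by
    rw [Finsupp.sum_fintype _ _ (fun i => TensorProduct.tmul_zero _ _)]
    refine Eq.trans (Finset.sum_congr rfl fun i _ => ?_) h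
    rw [Pullback.smul_incl, hb]
    rfl)
  funext i
  exact DFunLike.congr_fun h1 i

lemma Pullback.exists_eq_sum (z : Pullback (phi p k) T) : ∃ x : Fin p → T,
    z = ∑ i : Fin p, (PowerSeries.X : BK p k) ^ (i : ℕ) • Pullback.incl (phi p k) (x i) := by
  have hz : z ∈ Submodule.span (BK p k) (Set.range (Pullback.incl (phi p k) (M := T))) := by
    rw [Pullback.span_incl]; trivial
  induction hz using Submodule.closure_induction with
  | zero => exact ⟨0, by simp⟩
  | add y z _ _ hy hz =>
    obtain ⟨x, rfl⟩ := hy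
    obtain ⟨x', rfl⟩ := hz
    exact ⟨x + x', by simp [smul_add, Finset.sum_add_distrib]⟩
  | smul_mem a y hy =>
    obtain ⟨x, rfl⟩ := hy
    obtain ⟨b, hb⟩ := exists_eq_sum_phi p k a
    refine ⟨fun i => b i • x, ?_⟩
    conv_lhs => rw [hb]
    rw [Finset.sum_smul]
    refine Finset.sum_congr rfl fun i _ => ?_
    rw [map_smulₛₗ, smul_smul, mul_comm]

lemma Pullback.noUTorsion (hu : NoUTorsion p k T) :
    NoUTorsion p k (Pullback (phi p k) T) := by
  intro z hz
  obtain ⟨x, rfl⟩ := Pullback.exists_eq_sum z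
  -- Multiplying on to `u ^ p = φ(u)` lets the scalar pass through the tensor sign into the
  -- coordinates.
  have h1 : (PowerSeries.X : BK p k) ^ p •
      ∑ i : Fin p, (PowerSeries.X : BK p k) ^ (i : ℕ) • Pullback.incl (phi p k) (x i) = 0 := by
    have hpp : PowerSeries.X ∣ (PowerSeries.X : BK p k) ^ p := dvd_pow_self _ hp.out.ne_zero
    obtain ⟨c, hc⟩ := hpp
    rw [hc, mul_comm, mul_smul, hz, smul_zero]
  have h2 : (fun i => (PowerSeries.X : BK p k) • x i) = 0 := by
    refine Pullback.eq_zero_of_sum_eq_zero (p := p) (k := k) ?_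
    rw [← h1, Finset.smul_sum]
    refine Finset.sum_congr rfl fun i _ => ?_
    rw [map_smulₛₗ, phi_X, smul_comm]
  have h3 : x = 0 := funext fun i => hu _ (congrFun h2 i)
  simp [h3]

lemma Pullback.killed {n : ℕ} (h : ∀ x : T, (p : BK p k) ^ n • x = 0)
    (z : Pullback (phi p k) T) : (p : BK p k) ^ n • z = 0 := by
  obtain ⟨x, rfl⟩ := Pullback.exists_eq_sum z
  rw [Finset.smul_sum]
  refine Finset.sum_eq_zero fun i _ => ?_
  rw [smul_comm, ← phi_natCast_pow p k, ← map_smulₛₗ, h, map_zero, smul_zero]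

end TorsionLocalization

/-! ### Effective twists: from Kisin structures to semilinear maps -/

section EffectiveFrobenius

variable {p : ℕ} [hp : Fact p.Prime] {k : Type u} [Field k] [CharP k p] [PerfectRing k p]
  {E : (WittVector p k)[X]} {T S : Type*} [AddCommGroup T]
  [Module (BK p k) T] [AddCommGroup S] [Module (BK p k) S]

/-- `ψ` is the semilinear map underlying `u ^ i φ_T`. -/
def IsEff (F : KisinStr p k E T) (i : ℕ) (ψ : T →ₛₗ[phi p k] T) : Prop :=
  ∀ x, Away.mk (E : BK p k) (ψ x)
    = (PowerSeries.X : BK p k) ^ i • F (Away.mk _ (Pullback.incl (phi p k) x))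

variable {F : KisinStr p k E T} {G : KisinStr p k E S} {i : ℕ} {ψ : T →ₛₗ[phi p k] T}
  {χ : S →ₛₗ[phi p k] S}

lemma IsEff.twist (h : IsEff F i ψ) (j : ℕ) :
    IsEff F (j + i) ((LinearMap.lsmul (BK p k) T (PowerSeries.X ^ j)).comp ψ) := by
  intro x
  change Away.mk (E : BK p k) ((PowerSeries.X : BK p k) ^ j • ψ x) = _
  rw [map_smul, h, pow_add, mul_smul]

lemma IsPhiHom.apply_mk {f : T →ₗ[BK p k] S} (hf : IsPhiHom F G f) (x : T) :
    Away.map (E : BK p k) f (F (Away.mk _ (Pullback.incl (phi p k) x)))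
      = G (Away.mk _ (Pullback.incl (phi p k) (f x))) := by
  rw [hf, Away.map_mk, Pullback.map_incl]

lemma Away.map_smul_base {R : Type*} [CommRing R] {E : R} {M N : Type*} [AddCommGroup M]
    [Module R M] [AddCommGroup N] [Module R N] (f : M →ₗ[R] N) (a : R) (y : Away E M) :
    Away.map E f (a • y) = a • Away.map E f y := by
  rw [← algebraMap_smul (Localization.Away E) a y, map_smul, algebraMap_smul]

lemma IsEff.of_injective {f : T →ₗ[BK p k] S} (hf : IsPhiHom F G f)
    (hinj : Function.Injective f) (h : IsEff G i χ) (hc : ∀ x, f (ψ x) = χ (f x)) :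
    IsEff F i ψ := by
  intro x
  apply Away.map_injective (E : BK p k) hinj
  rw [Away.map_mk, hc, h, Away.map_smul_base, hf.apply_mk]

lemma IsEff.of_surjective {f : T →ₗ[BK p k] S} (hf : IsPhiHom F G f)
    (hsurj : Function.Surjective f) (h : IsEff F i ψ) (hc : ∀ x, f (ψ x) = χ (f x)) :
    IsEff G i χ := by
  intro y
  obtain ⟨x, rfl⟩ := hsurj y
  rw [← hc, ← Away.map_mk, h, Away.map_smul_base, hf.apply_mk]

variable [hE : IsUniformizerPoly p k E]

lemma IsEff.comm (hS : IsPTorsion p k S) {f : T →ₗ[BK p k] S} (hf : IsPhiHom F G f)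
    (h : IsEff F i ψ) (h' : IsEff G i χ) (x : T) : f (ψ x) = χ (f x) := by
  obtain ⟨n, hn⟩ := hS.killed
  apply Away.mk_injective E hn hS.noUTorsion
  rw [← Away.map_mk, h, h', Away.map_smul_base, hf.apply_mk]

/-- The linearization of `ψ` is the composite of `φ^*T ↪ (φ^*T)[1/E]`, the isomorphism `F` and the
injective multiplication by `u ^ i` on `T[1/E]`. -/
lemma IsEff.frobInj (hT : IsPTorsion p k T) (h : IsEff F i ψ) : FrobInj ψ := by
  obtain ⟨n, hn⟩ := hT.killed
  intro x hx
  apply Pullback.eq_zero_of_sum_eq_zero (p := p) (k := k)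
  apply Away.mk_injective E (Pullback.killed hn) (Pullback.noUTorsion hT.noUTorsion)
  apply F.injective
  apply Away.X_pow_smul_injective hn i
  rw [map_zero, map_zero, smul_zero, ← map_zero (Away.mk (E : BK p k) (M := T)), ← hx]
  simp only [map_sum, map_smul, FrobStr.map_smul_base, Finset.smul_sum, h (x _)]
  exact Finset.sum_congr rfl fun l _ => smul_comm _ _ _

lemma exists_isEff_of_forall (hT : IsPTorsion p k T) (F : KisinStr p k E T) {i : ℕ}
    (h : ∀ x : T, ∃ y : T, Away.mk (E : BK p k) y
      = (PowerSeries.X : BK p k) ^ i • F (Away.mk _ (Pullback.incl (phi p k) x))) :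
    ∃ ψ : T →ₛₗ[phi p k] T, IsEff F i ψ := by
  obtain ⟨n, hn⟩ := hT.killed
  have hinj := Away.mk_injective E hn hT.noUTorsion
  choose y hy using h
  refine ⟨{ toFun := y, map_add' := fun a b => hinj ?_, map_smul' := fun a b => hinj ?_ }, hy⟩
  · simp only [map_add, hy, smul_add]
  · rw [hy, map_smulₛₗ, (Away.mk (E : BK p k)).map_smul, FrobStr.map_smul_base, smul_comm, ← hy]
    exact ((Away.mk (E : BK p k)).map_smul _ _).symm

-- A power of `u` clears the denominators of `F` on finitely many generators. Having every `i ≥ i₀`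
-- available lets several modules share one exponent, without which their degrees could not be
-- compared through `delta`.
variable (E) in
lemma exists_isEff (hT : IsPTorsion p k T) (F : KisinStr p k E T) :
    ∃ i₀ : ℕ, ∀ i, i₀ ≤ i → ∃ ψ : T →ₛₗ[phi p k] T, IsEff F i ψ := by
  obtain ⟨n, hn⟩ := hT.killed
  have := hT.finite
  have h1 : ∀ x : T, ∃ (j : ℕ) (y : T), (PowerSeries.X : BK p k) ^ j •
      F (Away.mk _ (Pullback.incl (phi p k) x)) = Away.mk (E : BK p k) y := fun x =>
    Away.exists_X_pow_smul hn _
  obtain ⟨s, hs⟩ := this.fg_top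
  have h2 : ∀ t : Finset T, ∃ j : ℕ, ∀ x ∈ t, ∃ y : T, (PowerSeries.X : BK p k) ^ j •
      F (Away.mk _ (Pullback.incl (phi p k) x)) = Away.mk (E : BK p k) y := by
    classical
    intro t
    induction t using Finset.induction_on with
    | empty => exact ⟨0, by simp⟩
    | insert a t _ ih =>
      obtain ⟨j, hj⟩ := ih
      obtain ⟨l, y, hy⟩ := h1 a
      refine ⟨l + j, fun x hx => ?_⟩
      rcases Finset.mem_insert.mp hx with rfl | hx
      · exact ⟨(PowerSeries.X : BK p k) ^ j • y, by
          rw [add_comm, pow_add, mul_smul, hy, map_smul]⟩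
      · obtain ⟨z, hz⟩ := hj x hx
        exact ⟨(PowerSeries.X : BK p k) ^ l • z, by
          rw [pow_add, mul_smul, hz, map_smul]⟩
  obtain ⟨i₀, hi₀⟩ := h2 s
  refine ⟨i₀, fun i hi => exists_isEff_of_forall hT F fun x => ?_⟩
  have hx : x ∈ Submodule.span (BK p k) (s : Set T) := by rw [hs]; trivial
  induction hx using Submodule.span_induction with
  | mem x hx =>
    obtain ⟨y, hy⟩ := hi₀ x hx
    refine ⟨(PowerSeries.X : BK p k) ^ (i - i₀) • y, ?_⟩
    rw [map_smul, ← hy, smul_smul, ← pow_add, Nat.sub_add_cancel hi]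
  | zero => exact ⟨0, by simp⟩
  | add x y _ _ hx hy =>
    obtain ⟨a, ha⟩ := hx
    obtain ⟨b, hb⟩ := hy
    exact ⟨a + b, by simp only [map_add, ha, hb, smul_add]⟩
  | smul a x _ hx =>
    obtain ⟨y, hy⟩ := hx
    exact ⟨phi p k a • y, by
      rw [map_smul, hy, map_smulₛₗ, map_smul, FrobStr.map_smul_base, smul_comm]⟩

/-- The map `φ^* T → T[1/E]`, `z ↦ u ^ i φ_T(z)`. -/
noncomputable def twistMap (F : KisinStr p k E T) (i : ℕ) :
    Pullback (phi p k) T →ₗ[BK p k] Away (E : BK p k) T :=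
  (LinearMap.lsmul (BK p k) _ (PowerSeries.X ^ i)) ∘ₗ
    (F.toLinearMap.restrictScalars (BK p k)) ∘ₗ Away.mk _

lemma twistLattice_eq (F : KisinStr p k E T) (i : ℕ) :
    twistLattice F i = LinearMap.range (twistMap F i) := by
  rw [twistLattice, frobLattice, stdLattice, twistMap, LinearMap.range_comp, LinearMap.range_comp]

lemma IsEff.map_frobSpan (h : IsEff F i ψ) :
    (frobSpan ψ ⊤).map (Away.mk (E : BK p k)) = twistLattice F i := by
  rw [twistLattice_eq, ← Submodule.map_top, ← Pullback.span_incl, Submodule.map_span, frobSpan,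
    Submodule.map_span]
  congr 1
  ext y
  constructor
  · rintro ⟨_, ⟨x, -, rfl⟩, rfl⟩
    exact ⟨_, ⟨x, rfl⟩, (h x).symm⟩
  · rintro ⟨_, ⟨x, rfl⟩, rfl⟩
    exact ⟨_, ⟨x, trivial, rfl⟩, h x⟩

lemma IsEff.twistLattice_le (h : IsEff F i ψ) : twistLattice F i ≤ stdLattice E T := by
  rw [← h.map_frobSpan, stdLattice]
  exact LinearMap.map_le_range

lemma exists_isEff_of_le (hT : IsPTorsion p k T) (h : twistLattice F i ≤ stdLattice E T) :
    ∃ ψ : T →ₛₗ[phi p k] T, IsEff F i ψ := by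
  refine exists_isEff_of_forall hT F fun x => ?_
  rw [twistLattice_eq] at h
  exact h ⟨Pullback.incl (phi p k) x, rfl⟩

lemma rho_top : (rho (⊤ : Submodule (BK p k) T)) = (Module.length (BK p k)
    (T ⧸ (Ideal.span {(PowerSeries.X : BK p k)} • ⊤ : Submodule (BK p k) T))).toNat := by
  rw [rho, relLength_top, uMul, Submodule.ideal_span_singleton_smul]
  rfl

-- `𝔖` acts on `T / uT` through the surjection to constant coefficients, so lengths over `𝔖` and
-- over `W(k)` coincide.
variable (p k T) in
lemma torsionRank_eq : torsionRank p k T = rho (⊤ : Submodule (BK p k) T) := by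
  rw [rho_top, torsionRank]
  congr 1
  let Q := T ⧸ (Ideal.span {(PowerSeries.X : BK p k)} • ⊤ : Submodule (BK p k) T)
  let : Module (WittVector p k) Q := Module.compHom _ (PowerSeries.C : WittVector p k →+* BK p k)
  let : Algebra (BK p k) (WittVector p k) := (PowerSeries.constantCoeff).toAlgebra
  have key : ∀ (a : BK p k) (x : Q), PowerSeries.C (PowerSeries.constantCoeff a) • x = a • x := by
    intro a y
    obtain ⟨x, rfl⟩ := Submodule.Quotient.mk_surjective _ y
    rw [eq_comm, ← sub_eq_zero, ← sub_smul, PowerSeries.sub_const_eq_X_mul_shift]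
    exact (Submodule.Quotient.mk_eq_zero _).mpr (Submodule.smul_mem_smul
      (Ideal.mul_mem_right _ _ (Ideal.mem_span_singleton_self _)) trivial)
  have : IsScalarTower (BK p k) (WittVector p k) Q := ⟨fun a w x => by
    change PowerSeries.C (PowerSeries.constantCoeff a * w) • x = a • PowerSeries.C w • x
    rw [map_mul, mul_smul, key]⟩
  exact (Module.length_eq_of_surjective (S := BK p k) (R := WittVector p k) (M := Q)
    fun w => ⟨PowerSeries.C w, PowerSeries.constantCoeff_C w⟩).symm

lemma relLength_map_lsmul_X_pow (hT : IsPTorsion p k T) (N : Submodule (BK p k) T) (j : ℕ) :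
    relLength (N.map (LinearMap.lsmul (BK p k) T (PowerSeries.X ^ j))) N = (j * rho N : ℕ) := by
  induction j with
  | zero =>
    rw [relLength_eq_zero.mpr]
    · simp
    · exact fun x hx => ⟨x, hx, by simp⟩
  | succ j ih =>
    have h1 : N.map (LinearMap.lsmul (BK p k) T (PowerSeries.X ^ (j + 1)))
        = (uMul N).map (LinearMap.lsmul (BK p k) T (PowerSeries.X ^ j)) := by
      rw [uMul, ← Submodule.map_comp]
      congr 1
      ext x
      simp only [LinearMap.comp_apply, LinearMap.lsmul_apply, smul_smul, pow_succ]
    have hinj : Function.Injective (LinearMap.lsmul (BK p k) T (PowerSeries.X ^ j)) := by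
      rw [← LinearMap.ker_eq_bot, LinearMap.ker_eq_bot']
      exact fun x hx => hT.noUTorsion.pow j hx
    rw [h1, relLength_add (Submodule.map_mono (uMul_le N)) (b := N.map _),
      relLength_map_of_injective hinj (uMul_le N), ih, ← hT.coe_rho]
    · push_cast; ring
    · rintro _ ⟨x, hx, rfl⟩
      exact N.smul_mem _ hx

lemma frobSpan_twist (ψ : T →ₛₗ[phi p k] T) (N : Submodule (BK p k) T) (j : ℕ) :
    frobSpan ((LinearMap.lsmul (BK p k) T (PowerSeries.X ^ j)).comp ψ) N
      = (frobSpan ψ N).map (LinearMap.lsmul (BK p k) T (PowerSeries.X ^ j)) := by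
  rw [frobSpan, frobSpan, Submodule.map_span, ← Set.image_comp]
  rfl

lemma IsEff.unique (hT : IsPTorsion p k T) {ψ' : T →ₛₗ[phi p k] T} (h : IsEff F i ψ)
    (h' : IsEff F i ψ') : ψ = ψ' := by
  obtain ⟨n, hn⟩ := hT.killed
  ext x
  apply Away.mk_injective E hn hT.noUTorsion
  rw [h, h']

/-- Raising the exponent by `j` multiplies `⟨ψ(T)⟩` by `u ^ j`. This lengthens the cokernel by `j *
rank`, exactly what the correction term gives back, so the least exponent in the definition may be
replaced by any effective one. -/
lemma IsEff.rawDegree_eq (hT : IsPTorsion p k T) (h : IsEff F i ψ) :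
    rawDegree F = delta ψ ⊤ + i * rho (⊤ : Submodule (BK p k) T) := by
  obtain ⟨n, hn⟩ := hT.killed
  have hmem : twistIndex F ∈ {i : ℕ | twistLattice F i ≤ stdLattice E T} :=
    Nat.sInf_mem ⟨i, h.twistLattice_le⟩
  have hle : twistIndex F ≤ i := Nat.sInf_le h.twistLattice_le
  obtain ⟨ψ₀, h₀⟩ := exists_isEff_of_le hT hmem
  obtain ⟨j, hj⟩ := Nat.exists_eq_add_of_le' hle
  have hψ : ψ = (LinearMap.lsmul (BK p k) T (PowerSeries.X ^ j)).comp ψ₀ :=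
    h.unique hT (hj ▸ h₀.twist j)
  have h1 : relLength (frobSpan ψ ⊤) ⊤ = relLength (frobSpan ψ₀ ⊤) ⊤
      + (j * rho (⊤ : Submodule (BK p k) T) : ℕ) := by
    rw [hψ, frobSpan_twist, relLength_add (b := frobSpan ψ₀ ⊤) _ le_top,
      relLength_map_lsmul_X_pow hT, (h₀.frobInj hT).rho_frobSpan, add_comm]
    rintro _ ⟨x, hx, rfl⟩
    exact Submodule.smul_mem _ _ hx
  have h2 : Module.length (BK p k) (stdLattice E T ⧸
      (twistLattice F (twistIndex F)).submoduleOf (stdLattice E T))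
      = relLength (frobSpan ψ₀ ⊤) ⊤ := by
    rw [← relLength_map_of_injective (Away.mk_injective E hn hT.noUTorsion) le_top,
      h₀.map_frobSpan, Submodule.map_top]
    rfl
  rw [hT.coe_delta (h.frobInj hT) invariant_top, hT.coe_delta (h₀.frobInj hT) invariant_top] at h1
  have h1' : (-delta ψ ⊤).toNat = (-delta ψ₀ ⊤).toNat
    + j * rho (⊤ : Submodule (BK p k) T) := by exact_mod_cast h1
  have e1 := delta_nonpos (ψ := ψ) ⊤
  have e2 := delta_nonpos (ψ := ψ₀) ⊤
  have h3 : delta ψ ⊤ = delta ψ₀ ⊤ - (j * rho (⊤ : Submodule (BK p k) T) : ℕ) := by omega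
  rw [rawDegree, h2, hT.coe_delta (h₀.frobInj hT) invariant_top, torsionRank_eq, h3,
    show i = j + twistIndex F from hj]
  simp only [ENat.toNat_natCast]
  rw [Int.toNat_of_nonneg (by omega)]
  push_cast
  ring

/-- That `F` maps onto `N[1/E]`, and not merely into it, rests on `exists_pow_frobSpan`: a power of
`u` carries `N` into `⟨ψ(N)⟩`. -/
lemma IsEff.isStable (hT : IsPTorsion p k T) (h : IsEff F i ψ) {N : Submodule (BK p k) T}
    (hN : Invariant ψ N) : IsStable F N := by
  obtain ⟨n, hn⟩ := hT.killed
  rw [IsStable, Away.range_map_pullback, Away.range_map, Submodule.map_span]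
  apply le_antisymm
  · rw [Submodule.span_le]
    rintro _ ⟨_, ⟨x, rfl⟩, rfl⟩
    apply Away.mem_of_X_pow_smul_mem hn (j := i)
    have := h x
    refine Eq.subst (motive := fun y => y ∈ _) (h x) ?_
    exact Submodule.subset_span ⟨⟨ψ x, hN x x.2⟩, rfl⟩
  · rw [Submodule.span_le]
    rintro _ ⟨x, rfl⟩
    obtain ⟨j, hj⟩ := hT.exists_pow_frobSpan (h.frobInj hT) hN
    obtain ⟨y, hy, hxy⟩ := mem_frobSpan.mp (hj x x.2)
    apply Away.mem_of_X_pow_smul_mem hn (j := j)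
    change (PowerSeries.X : BK p k) ^ j • Away.mk (E : BK p k) (x : T) ∈ _
    rw [← map_smul, hxy, map_sum]
    refine Submodule.sum_mem _ fun l _ => ?_
    rw [map_smul, h, ← algebraMap_smul (Localization.Away (E : BK p k)),
      ← algebraMap_smul (Localization.Away (E : BK p k)) ((PowerSeries.X : BK p k) ^ i)]
    exact Submodule.smul_mem _ _ (Submodule.smul_mem _ _
      (Submodule.subset_span ⟨_, ⟨⟨y l, hy l⟩, rfl⟩, rfl⟩))

/-- Stability only yields a `u`-power multiple of `ψ x` in `N`; strictness removes that power. -/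
lemma IsEff.invariant (hT : IsPTorsion p k T) (h : IsEff F i ψ) {N : Submodule (BK p k) T}
    (hs : StrictIn N ⊤) (hN : IsStable F N) : Invariant ψ N := by
  obtain ⟨n, hn⟩ := hT.killed
  intro x hx
  have h1 : F (Away.mk _ (Pullback.incl (phi p k) x))
      ∈ LinearMap.range (Away.map (E : BK p k) N.subtype) := by
    rw [← hN]
    exact ⟨_, ⟨Away.mk _ (Pullback.incl (phi p k) (⟨x, hx⟩ : N)), by
      rw [Away.map_mk, Pullback.map_incl]; rfl⟩, rfl⟩
  obtain ⟨y, hy⟩ := h1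
  obtain ⟨j, z, hz⟩ := Away.exists_X_pow_smul (E := E) (T := N) (n := n)
    (fun x => Subtype.ext (hn x)) y
  have h2 : (PowerSeries.X : BK p k) ^ j • ψ x = (PowerSeries.X : BK p k) ^ i • (z : T) := by
    apply Away.mk_injective E hn hT.noUTorsion
    rw [map_smul, map_smul, h, ← hy, smul_comm, ← Away.map_smul_base, hz, Away.map_mk]
    rfl
  apply hs.pow j trivial
  rw [h2]
  exact N.smul_mem _ z.2

/-- The restriction of `ψ` to a stable submodule. -/
noncomputable def subPsi (ψ : T →ₛₗ[phi p k] T) {N : Submodule (BK p k) T} (hN : Invariant ψ N) :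
    N →ₛₗ[phi p k] N := ψ.restrict hN

lemma IsPTorsion.sub (hT : IsPTorsion p k T) (N : Submodule (BK p k) T) : IsPTorsion p k N :=
  hT.of_injective N.subtype N.injective_subtype

lemma torsionRank_sub (hT : IsPTorsion p k T) (N : Submodule (BK p k) T) :
    torsionRank p k N = rho N := by
  rw [torsionRank_eq, ← (hT.sub N).rho_map_of_injective hT N.injective_subtype,
    Submodule.map_top, Submodule.range_subtype]

lemma IsEff.sub (h : IsEff F i ψ) {N : Submodule (BK p k) T} (hN : Invariant ψ N)
    (hst : IsStable F N) : IsEff (F.sub N hst) i (subPsi ψ hN) :=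
  IsEff.of_injective (isPhiHom_subtype F N hst) N.injective_subtype h fun _ => rfl

lemma IsEff.rawDegree_sub (hT : IsPTorsion p k T) (h : IsEff F i ψ) {N : Submodule (BK p k) T}
    (hN : Invariant ψ N) (hst : IsStable F N) :
    rawDegree (F.sub N hst) = delta ψ N + i * rho N := by
  have hs := h.sub hN hst
  have h1 := (hT.sub N).delta_map_of_injective hT (hs.frobInj (hT.sub N)) (h.frobInj hT)
    (f := N.subtype) (fun _ => rfl) N.injective_subtype (invariant_top (ψ := subPsi ψ hN))
  rw [hs.rawDegree_eq (hT.sub N), ← torsionRank_eq, torsionRank_sub hT, ← h1,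
    Submodule.map_top, Submodule.range_subtype]

end EffectiveFrobenius

/-! ### Harder-Narasimhan theory in a lattice with rank and degree -/

section HarderNarasimhanLattice

variable {L : Type*} [Lattice L] [BoundedOrder L]

/-- A rank and a degree function on a lattice, as needed for Harder-Narasimhan filtrations. -/
structure IsSlopeData (rk : L → ℕ) (deg : L → ℝ) : Prop where
  strictMono : StrictMono rk
  rk_bot : rk ⊥ = 0
  deg_bot : deg ⊥ = 0
  modular : ∀ a b, rk (a ⊔ b) + rk (a ⊓ b) = rk a + rk b
  supermodular : ∀ a b, deg a + deg b ≤ deg (a ⊔ b) + deg (a ⊓ b)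
  exists_max : ∀ s : Set L, s.Nonempty → ∃ x ∈ s, ∀ y ∈ s, deg y ≤ deg x

variable (rk : L → ℕ) (deg : L → ℝ)

/-- The slope of the interval `[a, b]`. -/
noncomputable def intervalSlope (a b : L) : ℝ := (deg b - deg a) / ((rk b : ℝ) - rk a)

/-- `c` is a Harder-Narasimhan filtration of the interval `[a, ⊤]`. -/
structure IsHNChain (a : L) {s : ℕ} (c : Fin (s + 1) → L) : Prop where
  zero : c 0 = a
  last : c (Fin.last s) = ⊤
  lt : ∀ i : Fin s, c i.castSucc < c i.succ
  semistable : ∀ (i : Fin s) (y : L), c i.castSucc < y → y ≤ c i.succ →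
    intervalSlope rk deg (c i.castSucc) y ≤ intervalSlope rk deg (c i.castSucc) (c i.succ)
  anti : StrictAnti fun i : Fin s => intervalSlope rk deg (c i.castSucc) (c i.succ)

variable {rk deg}

namespace IsSlopeData

lemma rk_sub_pos (h : IsSlopeData rk deg) {a b : L} (hab : a < b) : 0 < (rk b : ℝ) - rk a := by
  have : (rk a : ℝ) < rk b := by exact_mod_cast h.strictMono hab
  linarith

lemma deg_sub_eq (h : IsSlopeData rk deg) {a b : L} (hab : a < b) :
    deg b - deg a = intervalSlope rk deg a b * ((rk b : ℝ) - rk a) := by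
  rw [intervalSlope, div_mul_cancel₀ _ (h.rk_sub_pos hab).ne']

lemma le_intervalSlope (h : IsSlopeData rk deg) {a b : L} (hab : a < b) {μ : ℝ} :
    μ ≤ intervalSlope rk deg a b ↔ μ * ((rk b : ℝ) - rk a) ≤ deg b - deg a := by
  rw [intervalSlope, le_div_iff₀ (h.rk_sub_pos hab)]

lemma intervalSlope_le (h : IsSlopeData rk deg) {a b : L} (hab : a < b) {μ : ℝ} :
    intervalSlope rk deg a b ≤ μ ↔ deg b - deg a ≤ μ * ((rk b : ℝ) - rk a) := by
  rw [intervalSlope, div_le_iff₀ (h.rk_sub_pos hab)]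

/-- The first step of the filtration is an element of maximal slope and, among those, of maximal
rank. The rank condition makes every slope beyond it strictly smaller. -/
lemma exists_maximal_slope (h : IsSlopeData rk deg) {a : L} (ha : a ≠ ⊤) :
    ∃ b, a < b ∧ (∀ y, a < y → intervalSlope rk deg a y ≤ intervalSlope rk deg a b) ∧
      ∀ y, b < y → intervalSlope rk deg b y < intervalSlope rk deg a b := by
  classical
  have h1 : ∀ m : ℕ, (∃ x, a < x ∧ rk x = m) → ∃ x, (a < x ∧ rk x = m) ∧
      ∀ y, a < y → rk y = m → deg y ≤ deg x := by
    rintro m hm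
    obtain ⟨x, hx, hmax⟩ := h.exists_max {x | a < x ∧ rk x = m} hm
    exact ⟨x, hx, fun y h1 h2 => hmax y ⟨h1, h2⟩⟩
  have : Nonempty L := ⟨a⟩
  choose! g hg using h1
  let t := (Finset.range (rk (⊤ : L) + 1)).filter fun m => ∃ x, a < x ∧ rk x = m
  have hmem : ∀ x, a < x → rk x ∈ t := fun x hx => by
    rw [Finset.mem_filter, Finset.mem_range, Nat.lt_succ_iff]
    exact ⟨h.strictMono.monotone le_top, x, hx, rfl⟩
  -- Only finitely many ranks occur, and `g m` has the largest degree among the elements of rank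
  -- `m`. The lexicographic order on (slope, rank) encodes both maximality conditions.
  obtain ⟨m, hm, hmax⟩ := t.exists_max_image
    (fun m => toLex (intervalSlope rk deg a (g m), m)) ⟨_, hmem ⊤ (lt_top_iff_ne_top.mpr ha)⟩
  obtain ⟨⟨hb, hrb⟩, hdb⟩ := hg m (Finset.mem_filter.mp hm).2
  have key : ∀ y, a < y → intervalSlope rk deg a y ≤ intervalSlope rk deg a (g (rk y)) := by
    intro y hy
    obtain ⟨⟨h1, h2⟩, h3⟩ := hg (rk y) ⟨y, hy, rfl⟩
    have h4 := h.deg_sub_eq h1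
    rw [h2] at h4
    rw [h.intervalSlope_le hy]
    linarith [h3 y hy rfl]
  have hle : ∀ y, a < y → intervalSlope rk deg a y ≤ intervalSlope rk deg a (g m) := fun y hy => by
    have h1 := hmax (rk y) (hmem y hy)
    rw [Prod.Lex.toLex_le_toLex] at h1
    refine (key y hy).trans ?_
    rcases h1 with h1 | h1
    · exact h1.le
    · exact h1.1.le
  refine ⟨g m, hb, hle, fun y hy => ?_⟩
  have hay := hb.trans hy
  by_contra! hcon
  rw [h.le_intervalSlope hy] at hcon
  have h2 : intervalSlope rk deg a (g m) ≤ intervalSlope rk deg a y := by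
    rw [h.le_intervalSlope hay]
    have := h.deg_sub_eq hb
    linarith
  have h1 := hmax (rk y) (hmem y hay)
  rw [Prod.Lex.toLex_le_toLex] at h1
  rcases h1 with h1 | h1
  · exact absurd (h2.trans (key y hay)) h1.not_ge
  · have := h.strictMono hy
    have := h1.2
    simp only at this
    omega

lemma exists_chain (h : IsSlopeData rk deg) (a : L) :
    ∃ (s : ℕ) (c : Fin (s + 1) → L), IsHNChain rk deg a c := by
  suffices H : ∀ (n : ℕ) (a : L), rk (⊤ : L) - rk a ≤ n →
      ∃ (s : ℕ) (c : Fin (s + 1) → L), IsHNChain rk deg a c from H _ a le_rfl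
  intro n
  induction n with
  | zero =>
    intro a ha
    have hat : a = ⊤ := by
      by_contra hne
      have := h.strictMono (lt_top_iff_ne_top.mpr hne)
      omega
    exact ⟨0, fun _ => a, rfl, hat, fun i => i.elim0, fun i => i.elim0, fun i => i.elim0⟩
  | succ n ih =>
    intro a ha
    by_cases hat : a = ⊤
    · exact ⟨0, fun _ => a, rfl, hat, fun i => i.elim0, fun i => i.elim0, fun i => i.elim0⟩
    obtain ⟨b, hab, hss, hlt⟩ := h.exists_maximal_slope hat
    obtain ⟨s, c, hc⟩ := ih b (by have := h.strictMono hab; omega)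
    refine ⟨s + 1, Fin.cons a c, rfl, ?_, ?_, ?_, ?_⟩
    · rw [← Fin.succ_last, Fin.cons_succ, hc.last]
    · intro i
      refine Fin.cases ?_ (fun i => ?_) i
      · simpa [hc.zero] using hab
      · simpa only [← Fin.succ_castSucc, Fin.cons_succ] using hc.lt i
    · intro i
      refine Fin.cases ?_ (fun i => ?_) i
      · simpa [hc.zero] using fun y hy _ => hss y hy
      · simpa only [← Fin.succ_castSucc, Fin.cons_succ] using hc.semistable i
    · rw [Fin.strictAnti_iff_succ_lt]
      intro i
      cases s with
      | zero => exact i.elim0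
      | succ s =>
        refine Fin.cases ?_ (fun i => ?_) i
        · have h1 := hlt (c 1) (by rw [← hc.zero]; exact hc.lt 0)
          rw [← hc.zero] at h1
          change intervalSlope rk deg (c 0) (c 1) < intervalSlope rk deg a (c 0)
          rwa [hc.zero] at h1 ⊢
        · have h1 := hc.anti i.castSucc_lt_succ
          simpa only [← Fin.succ_castSucc, Fin.cons_succ] using h1

end IsSlopeData

lemma sum_fin_sub {s : ℕ} {G : Type*} [AddCommGroup G] (f : Fin (s + 1) → G) :
    ∑ i : Fin s, (f i.succ - f i.castSucc) = f (Fin.last s) - f 0 := by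
  induction s with
  | zero => simp
  | succ s ih =>
    rw [Fin.sum_univ_castSucc]
    have := ih fun i => f i.castSucc
    simp only [Fin.succ_castSucc] at this ⊢
    rw [this, Fin.succ_last, Fin.castSucc_zero]
    abel

namespace IsHNChain

variable {s : ℕ} {c : Fin (s + 1) → L}

lemma strictMono {a : L} (hc : IsHNChain rk deg a c) : StrictMono c :=
  Fin.strictMono_iff_lt_succ.mpr hc.lt

/-- The step that the chain induces on `x` has the rank of the interval from `c i` to `(x ⊓ c (i +
1)) ⊔ c i` by modularity, and at most its degree by supermodularity. Semistability bounds the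
latter. -/
lemma step_bounds (h : IsSlopeData rk deg) {a : L} (hc : IsHNChain rk deg a c) (x : L) (i : Fin s) :
    (0 : ℝ) ≤ (rk (x ⊓ c i.succ) : ℝ) - rk (x ⊓ c i.castSucc) ∧
    (rk (x ⊓ c i.succ) : ℝ) - rk (x ⊓ c i.castSucc) ≤ (rk (c i.succ) : ℝ) - rk (c i.castSucc) ∧
    deg (x ⊓ c i.succ) - deg (x ⊓ c i.castSucc)
      ≤ intervalSlope rk deg (c i.castSucc) (c i.succ) *
        ((rk (x ⊓ c i.succ) : ℝ) - rk (x ⊓ c i.castSucc)) := by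
  have hinf : x ⊓ c i.succ ⊓ c i.castSucc = x ⊓ c i.castSucc := by
    rw [inf_assoc, inf_eq_right.mpr (hc.lt i).le]
  have hle : x ⊓ c i.succ ⊔ c i.castSucc ≤ c i.succ := sup_le inf_le_right (hc.lt i).le
  have hm := h.modular (x ⊓ c i.succ) (c i.castSucc)
  have hs := h.supermodular (x ⊓ c i.succ) (c i.castSucc)
  rw [hinf] at hm hs
  have hm' : (rk (x ⊓ c i.succ) : ℝ) - rk (x ⊓ c i.castSucc)
      = (rk (x ⊓ c i.succ ⊔ c i.castSucc) : ℝ) - rk (c i.castSucc) := by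
    have : (rk (x ⊓ c i.succ ⊔ c i.castSucc) : ℝ) + rk (x ⊓ c i.castSucc)
      = rk (x ⊓ c i.succ) + rk (c i.castSucc) := by exact_mod_cast hm
    linarith
  have h1 : (rk (c i.castSucc) : ℝ) ≤ rk (x ⊓ c i.succ ⊔ c i.castSucc) := by
    exact_mod_cast h.strictMono.monotone le_sup_right
  have h2 : (rk (x ⊓ c i.succ ⊔ c i.castSucc) : ℝ) ≤ rk (c i.succ) := by
    exact_mod_cast h.strictMono.monotone hle
  rw [hm']
  refine ⟨by linarith, by linarith, ?_⟩
  rcases (le_sup_right : c i.castSucc ≤ x ⊓ c i.succ ⊔ c i.castSucc).eq_or_lt with he | hlt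
  · rw [← he] at hs ⊢
    rw [sub_self, mul_zero]
    linarith
  · have h3 := (h.intervalSlope_le hlt).mp (hc.semistable i _ hlt hle)
    linarith

lemma inf_chain (c : Fin (s + 1) → L) (hc : StrictMono c) (i j : Fin (s + 1)) :
    c i ⊓ c j = c (min i j) := (hc.monotone.map_inf i j).symm

lemma min_succ_of_lt {i : Fin s} {j : Fin (s + 1)} (h : i.castSucc < j) :
    min j i.succ = i.succ ∧ min j i.castSucc = i.castSucc :=
  ⟨min_eq_right (Fin.castSucc_lt_iff_succ_le.mp h), min_eq_right h.le⟩

lemma min_succ_of_le {i : Fin s} {j : Fin (s + 1)} (h : j ≤ i.castSucc) :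
    min j i.succ = j ∧ min j i.castSucc = j :=
  ⟨min_eq_left (h.trans i.castSucc_le_succ), min_eq_left h⟩

lemma sum_deg (h : IsSlopeData rk deg) (hc : IsHNChain rk deg ⊥ c) (x : L) :
    ∑ i : Fin s, (deg (x ⊓ c i.succ) - deg (x ⊓ c i.castSucc)) = deg x := by
  rw [sum_fin_sub fun i => deg (x ⊓ c i), hc.last, hc.zero, inf_top_eq, inf_bot_eq, h.deg_bot,
    sub_zero]

lemma sum_rk (h : IsSlopeData rk deg) (hc : IsHNChain rk deg ⊥ c) (x : L) :
    ∑ i : Fin s, ((rk (x ⊓ c i.succ) : ℝ) - rk (x ⊓ c i.castSucc)) = rk x := by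
  rw [sum_fin_sub fun i => (rk (x ⊓ c i) : ℝ), hc.last, hc.zero, inf_top_eq, inf_bot_eq, h.rk_bot,
    Nat.cast_zero, sub_zero]

lemma deg_step_chain (h : IsSlopeData rk deg) {a : L} (hc : IsHNChain rk deg a c)
    (j : Fin (s + 1)) (i : Fin s) :
    deg (c j ⊓ c i.succ) - deg (c j ⊓ c i.castSucc)
      = intervalSlope rk deg (c i.castSucc) (c i.succ) *
        ((rk (c j ⊓ c i.succ) : ℝ) - rk (c j ⊓ c i.castSucc)) := by
  rw [inf_chain c hc.strictMono, inf_chain c hc.strictMono]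
  rcases lt_or_ge i.castSucc j with hij | hij
  · rw [(min_succ_of_lt hij).1, (min_succ_of_lt hij).2, h.deg_sub_eq (hc.lt i)]
  · rw [(min_succ_of_le hij).1, (min_succ_of_le hij).2]
    ring

/-- For `j` separating the slopes above `l` from those below, `c j` maximizes `deg - l * rk`. -/
lemma step_le (h : IsSlopeData rk deg) {a : L} (hc : IsHNChain rk deg a c) {l : ℝ}
    {j : Fin (s + 1)} {i : Fin s}
    (h1 : i.castSucc < j → l ≤ intervalSlope rk deg (c i.castSucc) (c i.succ))
    (h2 : j ≤ i.castSucc → intervalSlope rk deg (c i.castSucc) (c i.succ) ≤ l) (x : L) :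
    (intervalSlope rk deg (c i.castSucc) (c i.succ) - l) *
        ((rk (x ⊓ c i.succ) : ℝ) - rk (x ⊓ c i.castSucc))
      ≤ (intervalSlope rk deg (c i.castSucc) (c i.succ) - l) *
        ((rk (c j ⊓ c i.succ) : ℝ) - rk (c j ⊓ c i.castSucc)) := by
  obtain ⟨b1, b2, -⟩ := hc.step_bounds h x i
  rw [inf_chain c hc.strictMono, inf_chain c hc.strictMono]
  rcases lt_or_ge i.castSucc j with hij | hij
  · rw [(min_succ_of_lt hij).1, (min_succ_of_lt hij).2]
    exact mul_le_mul_of_nonneg_left b2 (sub_nonneg.mpr (h1 hij))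
  · rw [(min_succ_of_le hij).1, (min_succ_of_le hij).2, sub_self, mul_zero]
    exact mul_nonpos_of_nonpos_of_nonneg (sub_nonpos.mpr (h2 hij)) b1

lemma deg_sub_le_sum (h : IsSlopeData rk deg) (hc : IsHNChain rk deg ⊥ c) (l : ℝ) (x : L) :
    deg x - l * rk x ≤ ∑ i : Fin s, (intervalSlope rk deg (c i.castSucc) (c i.succ) - l) *
        ((rk (x ⊓ c i.succ) : ℝ) - rk (x ⊓ c i.castSucc)) := by
  have h1 : deg x ≤ ∑ i : Fin s, intervalSlope rk deg (c i.castSucc) (c i.succ) *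
        ((rk (x ⊓ c i.succ) : ℝ) - rk (x ⊓ c i.castSucc)) := by
    conv_lhs => rw [← hc.sum_deg h x]
    exact Finset.sum_le_sum fun i _ => (hc.step_bounds h x i).2.2
  simp only [sub_mul (intervalSlope _ _ _ _) l, Finset.sum_sub_distrib]
  rw [← Finset.mul_sum, hc.sum_rk h]
  linarith

lemma deg_sub_eq_sum (h : IsSlopeData rk deg) (hc : IsHNChain rk deg ⊥ c) (l : ℝ)
    (j : Fin (s + 1)) :
    deg (c j) - l * rk (c j) = ∑ i : Fin s, (intervalSlope rk deg (c i.castSucc) (c i.succ) - l) *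
        ((rk (c j ⊓ c i.succ) : ℝ) - rk (c j ⊓ c i.castSucc)) := by
  simp only [sub_mul (intervalSlope _ _ _ _) l, Finset.sum_sub_distrib, ← hc.deg_step_chain h,
    ← Finset.mul_sum, hc.sum_rk h, hc.sum_deg h]

lemma le_of_separates (h : IsSlopeData rk deg) (hc : IsHNChain rk deg ⊥ c) {l : ℝ}
    {j : Fin (s + 1)}
    (h1 : ∀ i : Fin s, i.castSucc < j → l ≤ intervalSlope rk deg (c i.castSucc) (c i.succ))
    (h2 : ∀ i : Fin s, j ≤ i.castSucc → intervalSlope rk deg (c i.castSucc) (c i.succ) ≤ l)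
    (x : L) : deg x - l * rk x ≤ deg (c j) - l * rk (c j) := by
  rw [hc.deg_sub_eq_sum h]
  refine (hc.deg_sub_le_sum h l x).trans ?_
  exact Finset.sum_le_sum fun i _ => hc.step_le h (h1 i) (h2 i) x

/-- Equality in the sum forces equality in every step. As no slope equals `l`, the rank increments
of `x` and `c j` agree, so `x`, `c j` and `x ⊓ c j` have the same rank. -/
lemma eq_of_separates (h : IsSlopeData rk deg) (hc : IsHNChain rk deg ⊥ c) {l : ℝ}
    {j : Fin (s + 1)}
    (h1 : ∀ i : Fin s, i.castSucc < j → l < intervalSlope rk deg (c i.castSucc) (c i.succ))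
    (h2 : ∀ i : Fin s, j ≤ i.castSucc → intervalSlope rk deg (c i.castSucc) (c i.succ) < l)
    {x : L} (hx : deg (c j) - l * rk (c j) ≤ deg x - l * rk x) : x = c j := by
  rw [hc.deg_sub_eq_sum h] at hx
  have h3 := hx.trans (hc.deg_sub_le_sum h l x)
  have h4 : ∀ i : Fin s, _ := fun i => hc.step_le h (fun hi => (h1 i hi).le) (fun hi => (h2 i hi).le) x
  have h5 := (Finset.sum_eq_sum_iff_of_le fun i _ => h4 i).mp
    (le_antisymm (Finset.sum_le_sum fun i _ => h4 i) h3)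
  have h6 : ∀ i : Fin s, (rk (x ⊓ c i.succ) : ℝ) - rk (x ⊓ c i.castSucc)
      = (rk (c j ⊓ c i.succ) : ℝ) - rk (c j ⊓ c i.castSucc) := by
    intro i
    refine mul_left_cancel₀ ?_ (h5 i (Finset.mem_univ i))
    rw [sub_ne_zero]
    rcases lt_or_ge i.castSucc j with hij | hij
    · exact (h1 i hij).ne'
    · exact (h2 i hij).ne
  have h7 : ∀ i : Fin (s + 1), (rk (x ⊓ c i) : ℝ) = rk (c j ⊓ c i) := by
    intro i
    induction i using Fin.induction with
    | zero => rw [hc.zero, inf_bot_eq, inf_bot_eq]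
    | succ i ih => linarith [h6 i]
  have h8 : rk (x ⊓ c j) = rk (c j) := by
    have := h7 j
    rw [inf_idem] at this
    exact_mod_cast this
  have h9 : rk x = rk (c j) := by
    have := h7 (Fin.last s)
    rw [hc.last, inf_top_eq, inf_top_eq] at this
    exact_mod_cast this
  have h10 : c j ≤ x := by
    by_contra hcon
    exact (h.strictMono (lt_of_le_of_ne inf_le_right fun he => hcon (inf_eq_right.mp he))).ne h8
  by_contra hne
  exact (h.strictMono (lt_of_le_of_ne h10 (Ne.symm hne))).ne h9.symm

lemma exists_separates {a : L} (hc : IsHNChain rk deg a c) (l : ℝ) : ∃ j : Fin (s + 1),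
    (∀ i : Fin s, i.castSucc < j → l ≤ intervalSlope rk deg (c i.castSucc) (c i.succ)) ∧
    (∀ i : Fin s, j ≤ i.castSucc → intervalSlope rk deg (c i.castSucc) (c i.succ) ≤ l) := by
  obtain ⟨j, hj, hmax⟩ := Set.Finite.exists_maximalFor id {j : Fin (s + 1) |
    ∀ i : Fin s, i.castSucc < j → l ≤ intervalSlope rk deg (c i.castSucc) (c i.succ)}
    (Set.toFinite _) ⟨0, fun i hi => absurd hi (Fin.not_lt_zero _)⟩
  refine ⟨j, hj, fun i hi => ?_⟩
  by_contra! hcon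
  have h1 : i.succ ≤ j := hmax (j := i.succ) (fun i' hi' => by
    have h2 : i' ≤ i := Fin.castSucc_lt_succ_iff.mp hi'
    exact hcon.le.trans (hc.anti.antitone h2)) (hi.trans i.castSucc_le_succ)
  exact absurd (hi.trans_lt i.castSucc_lt_succ) h1.not_gt

/-- For `l` strictly between the slopes before and after `j`, the element `c j` is the unique
maximizer of `deg - l * rk`. That property does not mention the chain, and some member of `d` is a
maximizer too. -/
lemma range_subset (h : IsSlopeData rk deg) (hc : IsHNChain rk deg ⊥ c) {t : ℕ}
    {d : Fin (t + 1) → L} (hd : IsHNChain rk deg ⊥ d) : Set.range c ⊆ Set.range d := by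
  classical
  rintro _ ⟨j, rfl⟩
  let μ : Fin s → ℝ := fun i => intervalSlope rk deg (c i.castSucc) (c i.succ)
  obtain ⟨l, hl1, hl2⟩ := Order.exists_between_finsets
    ((Finset.univ.filter fun i : Fin s => j ≤ i.castSucc).image μ)
    ((Finset.univ.filter fun i : Fin s => i.castSucc < j).image μ) (by
      intro x hx y hy
      obtain ⟨i, hi, rfl⟩ := Finset.mem_image.mp hx
      obtain ⟨i', hi', rfl⟩ := Finset.mem_image.mp hy
      exact hc.anti (Fin.castSucc_lt_castSucc_iff.mp
        ((Finset.mem_filter.mp hi').2.trans_le (Finset.mem_filter.mp hi).2)))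
  obtain ⟨j', h1, h2⟩ := hd.exists_separates l
  refine ⟨j', hc.eq_of_separates h (l := l) ?_ ?_ (hd.le_of_separates h h1 h2 _)⟩
  · exact fun i hi => hl2 _ (Finset.mem_image_of_mem μ (by simpa using hi))
  · exact fun i hi => hl1 _ (Finset.mem_image_of_mem μ (by simpa using hi))

lemma length_eq (h : IsSlopeData rk deg) (hc : IsHNChain rk deg ⊥ c) {t : ℕ}
    {d : Fin (t + 1) → L} (hd : IsHNChain rk deg ⊥ d) : s = t := by
  have h1 := (hc.range_subset h hd).antisymm (hd.range_subset h hc)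
  have h2 := congrArg Set.ncard h1
  rw [← Set.image_univ, ← Set.image_univ, Set.ncard_image_of_injective _ hc.strictMono.injective,
    Set.ncard_image_of_injective _ hd.strictMono.injective, Set.ncard_univ, Set.ncard_univ,
    Nat.card_fin, Nat.card_fin] at h2
  omega

lemma unique (h : IsSlopeData rk deg) (hc : IsHNChain rk deg ⊥ c)
    {d : Fin (s + 1) → L} (hd : IsHNChain rk deg ⊥ d) : c = d := by
  have h1 := (hc.range_subset h hd).antisymm (hd.range_subset h hc)
  exact (StrictMono.range_inj hc.strictMono hd.strictMono).mp h1

variable (rk deg) in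
/-- The polygon of a chain. -/
noncomputable def chainPolygon (c : Fin (s + 1) → L) (x : ℝ) : ℝ :=
  ∑ i : Fin s, intervalSlope rk deg (c i.castSucc) (c i.succ) *
    (min x (rk (c i.succ)) - min x (rk (c i.castSucc)))

lemma rk_le (h : IsSlopeData rk deg) {a : L} (hc : IsHNChain rk deg a c) {i j : Fin (s + 1)}
    (hij : i ≤ j) : (rk (c i) : ℝ) ≤ rk (c j) := by
  exact_mod_cast h.strictMono.monotone (hc.strictMono.monotone hij)

lemma min_step_bounds (h : IsSlopeData rk deg) {a : L} (hc : IsHNChain rk deg a c) (x : ℝ)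
    (i : Fin s) : 0 ≤ min x (rk (c i.succ)) - min x (rk (c i.castSucc)) ∧
      min x (rk (c i.succ)) - min x (rk (c i.castSucc))
        ≤ (rk (c i.succ) : ℝ) - rk (c i.castSucc) := by
  have h1 := hc.rk_le h i.castSucc_le_succ
  constructor
  · exact sub_nonneg.mpr (min_le_min_left _ h1)
  · rcases le_total x (rk (c i.castSucc)) with h2 | h2
    · rw [min_eq_left h2, min_eq_left (h2.trans h1)]; linarith
    · rw [min_eq_right h2]
      linarith [min_le_right x (rk (c i.succ) : ℝ)]

lemma sum_min (h : IsSlopeData rk deg) (hc : IsHNChain rk deg ⊥ c) {x : ℝ}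
    (hx : x ∈ Set.Icc (0 : ℝ) (rk (⊤ : L))) :
    ∑ i : Fin s, (min x (rk (c i.succ)) - min x (rk (c i.castSucc))) = x := by
  rw [sum_fin_sub fun i => min x (rk (c i) : ℝ), hc.last, hc.zero, h.rk_bot, Nat.cast_zero,
    min_eq_left hx.2, min_eq_right hx.1, sub_zero]

lemma exists_mem_step (h : IsSlopeData rk deg) (hc : IsHNChain rk deg ⊥ c) (hs : s ≠ 0) {x : ℝ}
    (hx : x ∈ Set.Icc (0 : ℝ) (rk (⊤ : L))) :
    ∃ j : Fin s, (rk (c j.castSucc) : ℝ) ≤ x ∧ x ≤ rk (c j.succ) := by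
  have hpos : 0 < s := Nat.pos_of_ne_zero hs
  obtain ⟨j, hj, hmax⟩ := Set.Finite.exists_maximalFor id {j : Fin s | (rk (c j.castSucc) : ℝ) ≤ x}
    (Set.toFinite _) ⟨⟨0, hpos⟩, by
      have : (Fin.castSucc ⟨0, hpos⟩ : Fin (s + 1)) = 0 := rfl
      change (rk (c (Fin.castSucc ⟨0, hpos⟩)) : ℝ) ≤ x
      rw [this, hc.zero, h.rk_bot, Nat.cast_zero]; exact hx.1⟩
  refine ⟨j, hj, ?_⟩
  by_contra! hcon
  rcases Fin.eq_castSucc_or_eq_last j.succ with ⟨i, hi⟩ | hl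
  · have h1 : j < i := by
      have : j.castSucc < i.castSucc := by rw [← hi]; exact j.castSucc_lt_succ
      exact Fin.castSucc_lt_castSucc_iff.mp this
    have h2 : i ≤ j := hmax (j := i) (by
      change (rk (c i.castSucc) : ℝ) ≤ x
      rw [← hi]; exact hcon.le) h1.le
    exact absurd h1 h2.not_gt
  · rw [hl, hc.last] at hcon
    exact absurd hx.2 hcon.not_ge

lemma min_of_lt (h : IsSlopeData rk deg) {a : L} (hc : IsHNChain rk deg a c) {x : ℝ} {i j : Fin s}
    (hj : (rk (c j.castSucc) : ℝ) ≤ x) (hij : i < j) :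
    min x (rk (c i.succ)) - min x (rk (c i.castSucc))
      = (rk (c i.succ) : ℝ) - rk (c i.castSucc) := by
  have h1 := hc.rk_le h (i := i.succ) (j := j.castSucc)
    (Fin.castSucc_lt_iff_succ_le.mp (Fin.castSucc_lt_castSucc_iff.mpr hij))
  have h2 := hc.rk_le h i.castSucc_le_succ
  rw [min_eq_right (h1.trans hj), min_eq_right (h2.trans (h1.trans hj))]

lemma min_of_gt (h : IsSlopeData rk deg) {a : L} (hc : IsHNChain rk deg a c) {x : ℝ} {i j : Fin s}
    (hj : x ≤ rk (c j.succ)) (hij : j < i) :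
    min x (rk (c i.succ)) - min x (rk (c i.castSucc)) = (0 : ℝ) := by
  have h1 := hc.rk_le h (i := j.succ) (j := i.castSucc)
    (Fin.castSucc_lt_iff_succ_le.mp (Fin.castSucc_lt_castSucc_iff.mpr hij))
  have h2 := hc.rk_le h i.castSucc_le_succ
  rw [min_eq_left (hj.trans h1), min_eq_left (hj.trans (h1.trans h2)), sub_self]

/-- As slopes decrease, distributing a total rank `x` over the steps gives most when the earlier
steps are filled first. Subtracting the slope of the step containing `x` makes the comparison
termwise. -/
lemma sum_le_chainPolygon (h : IsSlopeData rk deg) (hc : IsHNChain rk deg ⊥ c) {ρ : Fin s → ℝ}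
    (h0 : ∀ i, 0 ≤ ρ i) (h1 : ∀ i, ρ i ≤ (rk (c i.succ) : ℝ) - rk (c i.castSucc)) {x : ℝ}
    (hx : x ∈ Set.Icc (0 : ℝ) (rk (⊤ : L))) (hsum : ∑ i, ρ i = x) :
    ∑ i : Fin s, intervalSlope rk deg (c i.castSucc) (c i.succ) * ρ i
      ≤ chainPolygon rk deg c x := by
  rcases eq_or_ne s 0 with rfl | hs
  · simp [chainPolygon]
  obtain ⟨j, hj1, hj2⟩ := hc.exists_mem_step h hs hx
  let μ : Fin s → ℝ := fun i => intervalSlope rk deg (c i.castSucc) (c i.succ)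
  have key : ∑ i : Fin s, (μ i - μ j) * ρ i
      ≤ ∑ i : Fin s, (μ i - μ j) * (min x (rk (c i.succ)) - min x (rk (c i.castSucc))) := by
    refine Finset.sum_le_sum fun i _ => ?_
    rcases lt_trichotomy i j with hij | hij | hij
    · rw [hc.min_of_lt h hj1 hij]
      exact mul_le_mul_of_nonneg_left (h1 i) (sub_nonneg.mpr (hc.anti hij).le)
    · rw [hij, sub_self, zero_mul, zero_mul]
    · rw [hc.min_of_gt h hj2 hij, mul_zero]
      exact mul_nonpos_of_nonpos_of_nonneg (sub_nonpos.mpr (hc.anti hij).le) (h0 i)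
  simp only [sub_mul (μ _) (μ j), Finset.sum_sub_distrib, ← Finset.mul_sum] at key
  rw [hsum, ← Finset.sum_sub_distrib, hc.sum_min h hx] at key
  simp only [chainPolygon]
  change ∑ i, μ i * ρ i ≤ ∑ i, μ i * _
  linarith

lemma deg_le_chainPolygon (h : IsSlopeData rk deg) (hc : IsHNChain rk deg ⊥ c) (x : L) :
    deg x ≤ chainPolygon rk deg c (rk x) := by
  have h1 := hc.deg_sub_le_sum h 0 x
  simp only [zero_mul, sub_zero] at h1
  refine h1.trans (hc.sum_le_chainPolygon h (fun i => (hc.step_bounds h x i).1)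
    (fun i => (hc.step_bounds h x i).2.1) ⟨Nat.cast_nonneg _, ?_⟩ (hc.sum_rk h x))
  exact_mod_cast h.strictMono.monotone le_top

/-- A convex combination of the fillings belonging to `x` and `y` is an admissible filling for the
combined point, hence is at most the optimal one. -/
lemma concaveOn_chainPolygon (h : IsSlopeData rk deg) (hc : IsHNChain rk deg ⊥ c) :
    ConcaveOn ℝ (Set.Icc (0 : ℝ) (rk (⊤ : L))) (chainPolygon rk deg c) := by
  refine ⟨convex_Icc _ _, fun x hx y hy a b ha hb hab => ?_⟩
  have h1 := hc.sum_le_chainPolygon h (x := a • x + b • y)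
    (ρ := fun i => a * (min x (rk (c i.succ)) - min x (rk (c i.castSucc)))
      + b * (min y (rk (c i.succ)) - min y (rk (c i.castSucc)))) ?_ ?_
      ((convex_Icc _ _) hx hy ha hb hab) ?_
  · refine le_trans (le_of_eq ?_) h1
    simp only [chainPolygon, smul_eq_mul, Finset.mul_sum, ← Finset.sum_add_distrib]
    exact Finset.sum_congr rfl fun i _ => by ring
  · intro i
    have := (hc.min_step_bounds h x i).1
    have := (hc.min_step_bounds h y i).1
    positivity
  · intro i
    have e1 := mul_le_mul_of_nonneg_left (hc.min_step_bounds h x i).2 ha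
    have e2 := mul_le_mul_of_nonneg_left (hc.min_step_bounds h y i).2 hb
    calc _ ≤ _ := add_le_add e1 e2
      _ = (a + b) * ((rk (c i.succ) : ℝ) - rk (c i.castSucc)) := by ring
      _ = _ := by rw [hab, one_mul]
  · simp only [Finset.sum_add_distrib, ← Finset.mul_sum, hc.sum_min h hx, hc.sum_min h hy,
      smul_eq_mul]

lemma chainPolygon_rk (h : IsSlopeData rk deg) (hc : IsHNChain rk deg ⊥ c) (j : Fin (s + 1)) :
    chainPolygon rk deg c (rk (c j)) = deg (c j) := by
  have h1 := hc.deg_sub_eq_sum h 0 j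
  simp only [zero_mul, sub_zero] at h1
  rw [h1, chainPolygon]
  refine Finset.sum_congr rfl fun i _ => ?_
  have hm : ∀ i : Fin (s + 1), min (rk (c j) : ℝ) (rk (c i)) = rk (c j ⊓ c i) := by
    intro i
    rw [inf_chain c hc.strictMono]
    rcases le_total j i with hij | hij
    · rw [min_eq_left hij, min_eq_left (hc.rk_le h hij)]
    · rw [min_eq_right hij, min_eq_right (hc.rk_le h hij)]
  rw [hm, hm]

lemma chainPolygon_eq (h : IsSlopeData rk deg) (hc : IsHNChain rk deg ⊥ c) {j : Fin s} {x : ℝ}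
    (hj1 : (rk (c j.castSucc) : ℝ) ≤ x) (hj2 : x ≤ rk (c j.succ)) :
    chainPolygon rk deg c x = deg (c j.castSucc)
      + intervalSlope rk deg (c j.castSucc) (c j.succ) * (x - rk (c j.castSucc)) := by
  have h3 : (rk (c j.castSucc) : ℝ) ≤ rk (c j.succ) := hc.rk_le h j.castSucc_le_succ
  rw [← hc.chainPolygon_rk h, ← sub_eq_iff_eq_add', chainPolygon, chainPolygon,
    ← Finset.sum_sub_distrib, Finset.sum_eq_single j]
  · rw [min_eq_left hj2, min_eq_right hj1, min_self, min_eq_left h3]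
    ring
  · intro i _ hij
    rcases lt_or_gt_of_ne hij with hij | hij
    · rw [hc.min_of_lt h hj1 hij, hc.min_of_lt h le_rfl hij, sub_self]
    · rw [hc.min_of_gt h hj2 hij, hc.min_of_gt h h3 hij, sub_self]
  · simp

/-- The vertices of the polygon are points `(rk, deg)` of chain members, and a concave function
above two vertices is above the chord. With `deg_le_chainPolygon`, the polygon is the least concave
majorant of all such points. -/
lemma chainPolygon_le (h : IsSlopeData rk deg) (hc : IsHNChain rk deg ⊥ c) {g : ℝ → ℝ}
    (hg : ConcaveOn ℝ (Set.Icc (0 : ℝ) (rk (⊤ : L))) g) (hle : ∀ x, deg x ≤ g (rk x)) {x : ℝ}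
    (hx : x ∈ Set.Icc (0 : ℝ) (rk (⊤ : L))) : chainPolygon rk deg c x ≤ g x := by
  have hmem : ∀ y : L, (rk y : ℝ) ∈ Set.Icc (0 : ℝ) (rk (⊤ : L)) := fun y =>
    ⟨Nat.cast_nonneg _, by exact_mod_cast h.strictMono.monotone le_top⟩
  rcases eq_or_ne s 0 with rfl | hs
  · have h1 : (⊤ : L) = ⊥ := by rw [← hc.last, ← hc.zero]; rfl
    have h2 : x = (rk (⊥ : L) : ℝ) := by
      rw [h1, h.rk_bot, Nat.cast_zero] at hx
      rw [h.rk_bot, Nat.cast_zero]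
      exact le_antisymm hx.2 hx.1
    have h3 := hle ⊥
    rw [h.deg_bot, ← h2] at h3
    simpa [chainPolygon] using h3
  obtain ⟨j, hj1, hj2⟩ := hc.exists_mem_step h hs hx
  rw [hc.chainPolygon_eq h hj1 hj2]
  have hpos := h.rk_sub_pos (hc.lt j)
  set D : ℝ := (rk (c j.succ) : ℝ) - rk (c j.castSucc) with hD
  have h1 := hg.2 (hmem (c j.castSucc)) (hmem (c j.succ))
    (show 0 ≤ ((rk (c j.succ) : ℝ) - x) / D from div_nonneg (by linarith) hpos.le)
    (show 0 ≤ (x - (rk (c j.castSucc) : ℝ)) / D from div_nonneg (by linarith) hpos.le)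
    (by rw [← add_div, div_eq_one_iff_eq hpos.ne', hD]; ring)
  have h2 : (((rk (c j.succ) : ℝ) - x) / D) • (rk (c j.castSucc) : ℝ)
      + ((x - (rk (c j.castSucc) : ℝ)) / D) • (rk (c j.succ) : ℝ) = x := by
    simp only [smul_eq_mul]
    field_simp
    rw [hD]; ring
  rw [h2] at h1
  refine le_trans ?_ h1
  have h3 := mul_le_mul_of_nonneg_left (hle (c j.castSucc))
    (div_nonneg (by linarith : (0 : ℝ) ≤ rk (c j.succ) - x) hpos.le)
  have h4 := mul_le_mul_of_nonneg_left (hle (c j.succ))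
    (div_nonneg (by linarith : (0 : ℝ) ≤ x - rk (c j.castSucc)) hpos.le)
  refine le_trans (le_of_eq ?_) (add_le_add h3 h4)
  rw [intervalSlope, ← hD]
  field_simp
  rw [hD]; ring

lemma abs_chainPolygon_sub_le (c : Fin (s + 1) → L) : ∃ C : ℝ, 0 ≤ C ∧ ∀ x y : ℝ,
    |chainPolygon rk deg c x - chainPolygon rk deg c y| ≤ C * |x - y| := by
  -- Each `min · a` is 1-Lipschitz and every step contains two of them, whence the factor 2.
  refine ⟨∑ i : Fin s, |intervalSlope rk deg (c i.castSucc) (c i.succ)| * 2,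
    Finset.sum_nonneg fun i _ => by positivity, fun x y => ?_⟩
  rw [chainPolygon, chainPolygon, ← Finset.sum_sub_distrib, Finset.sum_mul]
  refine (Finset.abs_sum_le_sum_abs _ _).trans (Finset.sum_le_sum fun i _ => ?_)
  rw [← mul_sub, abs_mul, mul_assoc]
  refine mul_le_mul_of_nonneg_left ?_ (abs_nonneg _)
  have h1 : ∀ a : ℝ, |min x a - min y a| ≤ |x - y| := fun a => by
    simpa using abs_min_sub_min_le_max x a y a
  calc _ = |(min x (rk (c i.succ) : ℝ) - min y (rk (c i.succ) : ℝ))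
        - (min x (rk (c i.castSucc) : ℝ) - min y (rk (c i.castSucc) : ℝ))| := by congr 1; ring
    _ ≤ _ := abs_sub _ _
    _ ≤ |x - y| + |x - y| := add_le_add (h1 _) (h1 _)
    _ = _ := by ring

end IsHNChain

end HarderNarasimhanLattice

/-! ### The lattice of strict subobjects -/

section StrictSubobjects

variable {p : ℕ} [hp : Fact p.Prime] {k : Type u} [Field k] [CharP k p] [PerfectRing k p]
  {E : (WittVector p k)[X]} {T : Type*} [AddCommGroup T] [Module (BK p k) T]

/-- The stable submodules `N` of `T` for which `T / N` has no `u`-torsion. -/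
def StrictSub (ψ : T →ₛₗ[phi p k] T) : Type _ :=
  {N : Submodule (BK p k) T // StrictIn N ⊤ ∧ Invariant ψ N}

variable {ψ : T →ₛₗ[phi p k] T}

lemma uSat_le {N N' : Submodule (BK p k) T} (h : StrictIn N' ⊤) (hle : N ≤ N') : uSat N ≤ N' := by
  rintro x ⟨j, hj⟩
  exact h.pow j trivial (hle hj)

instance : PartialOrder (StrictSub ψ) :=
  inferInstanceAs (PartialOrder {N : Submodule (BK p k) T // StrictIn N ⊤ ∧ Invariant ψ N})

/-- A sum of saturated submodules need not be saturated, so the join is the saturation of the sum;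
intersections stay saturated. -/
noncomputable instance : Lattice (StrictSub ψ) where
  sup N N' := ⟨uSat (N.1 ⊔ N'.1), strictIn_uSat _, (N.2.2.sup N'.2.2).uSat⟩
  le_sup_left N N' := le_sup_left.trans (le_uSat (N.1 ⊔ N'.1))
  le_sup_right N N' := le_sup_right.trans (le_uSat (N.1 ⊔ N'.1))
  sup_le _ _ N'' h h' := uSat_le N''.2.1 (sup_le h h')
  inf N N' := ⟨N.1 ⊓ N'.1, fun x hx hX => ⟨N.2.1 x hx hX.1, N'.2.1 x hx hX.2⟩, N.2.2.inf N'.2.2⟩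
  inf_le_left N N' := (inf_le_left : N.1 ⊓ N'.1 ≤ N.1)
  inf_le_right N N' := (inf_le_right : N.1 ⊓ N'.1 ≤ N'.1)
  le_inf N N' N'' h h' := (le_inf h h' : N.1 ≤ N'.1 ⊓ N''.1)

/-- The bottom is `uSat ⊥`, as `T` is not assumed here to be free of `u`-torsion;
`IsPTorsion.bot_val` identifies it with `⊥`. -/
noncomputable instance : BoundedOrder (StrictSub ψ) where
  top := ⟨⊤, fun _ _ _ => trivial, invariant_top⟩
  le_top N := (le_top : N.1 ≤ ⊤)
  bot := ⟨uSat ⊥, strictIn_uSat _, invariant_bot.uSat⟩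
  bot_le N := uSat_le N.2.1 bot_le

lemma IsPTorsion.bot_val (hT : IsPTorsion p k T) : (⊥ : StrictSub ψ).1 = ⊥ := by
  change uSat ⊥ = ⊥
  rw [eq_bot_iff]
  rintro x ⟨j, hj⟩
  exact hT.noUTorsion.pow j hj

variable (E ψ) in
/-- The degree of a `ψ`-stable submodule, where `ψ` underlies `u ^ i φ_T`. -/
noncomputable def effDegree (i : ℕ) (N : Submodule (BK p k) T) : ℝ :=
  ((delta ψ N + i * rho N : ℤ) : ℝ) / E.natDegree

lemma IsPTorsion.isSlopeData (hT : IsPTorsion p k T) (hψ : FrobInj ψ) (i : ℕ) :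
    IsSlopeData (fun N : StrictSub ψ => rho N.1) (fun N => effDegree E ψ i N.1) where
  strictMono N N' h := by
    have h' : N.1 < N'.1 := h
    by_contra hcon
    exact h'.ne (hT.eq_of_rho_le h'.le (N.2.1.mono le_top) (not_lt.mp hcon))
  rk_bot := by rw [hT.bot_val, rho_bot]
  deg_bot := by simp [effDegree, hT.bot_val]
  modular N N' := by
    change rho (uSat (N.1 ⊔ N'.1)) + rho (N.1 ⊓ N'.1) = _
    rw [hT.rho_uSat, hT.rho_sup_add_inf N.2.1]
  supermodular N N' := by
    change _ ≤ effDegree E ψ i (uSat (N.1 ⊔ N'.1)) + effDegree E ψ i (N.1 ⊓ N'.1)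
    simp only [effDegree]
    rw [← add_div, ← add_div]
    refine div_le_div_of_nonneg_right ?_ (Nat.cast_nonneg _)
    have h1 : (rho (N.1 ⊔ N'.1) : ℤ) + rho (N.1 ⊓ N'.1) = rho N.1 + rho N'.1 := by
      exact_mod_cast hT.rho_sup_add_inf N.2.1 N'.1
    have h2 := hT.delta_sup_add_inf hψ N.2.2 N'.2.2 N.2.1
    have h3 := hT.delta_le_uSat hψ (N.2.2.sup N'.2.2)
    rw [hT.rho_uSat]
    norm_cast
    have h4 : (i : ℤ) * (rho (N.1 ⊔ N'.1) : ℤ) + i * rho (N.1 ⊓ N'.1)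
        = i * rho N.1 + i * rho N'.1 := by rw [← mul_add, h1, mul_add]
    push_cast
    linarith
  -- The numerators are integers bounded above, since `delta` is nonpositive and the rank is at most
  -- that of `T`; hence a largest one exists.
  exists_max s hs := by
    obtain ⟨N₀, hN₀⟩ := hs
    obtain ⟨m, ⟨N, hN, hm⟩, hmax⟩ := Int.exists_greatest_of_bdd
      (P := fun m => ∃ N ∈ s, delta ψ N.1 + i * rho N.1 = m)
      ⟨i * rho (⊤ : Submodule (BK p k) T), by
        rintro _ ⟨N, -, rfl⟩
        have h1 : (i : ℤ) * rho N.1 ≤ i * rho (⊤ : Submodule (BK p k) T) :=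
          mul_le_mul_of_nonneg_left (by exact_mod_cast hT.rho_mono le_top) (by positivity)
        linarith [delta_nonpos (ψ := ψ) N.1]⟩ ⟨_, N₀, hN₀, rfl⟩
    refine ⟨N, hN, fun N' hN' => ?_⟩
    refine div_le_div_of_nonneg_right ?_ (Nat.cast_nonneg _)
    have := hmax _ ⟨N', hN', rfl⟩
    rw [← hm] at this
    exact_mod_cast this

end StrictSubobjects

/-! ### Subquotients: slopes and semistability in lattice terms -/

section GradedPieces

variable {p : ℕ} [hp : Fact p.Prime] {k : Type u} [Field k] [CharP k p] [PerfectRing k p]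
  {E : (WittVector p k)[X]} [hE : IsUniformizerPoly p k E] {T : Type*} [AddCommGroup T]
  [Module (BK p k) T] {ψ : T →ₛₗ[phi p k] T} {F : KisinStr p k E T} {i : ℕ}

lemma IsPTorsion.slope_eq (hT : IsPTorsion p k T) (h : IsEff F i ψ) :
    (slope F : ℝ) = effDegree E ψ i ⊤ / rho (⊤ : Submodule (BK p k) T) := by
  rw [slope, torsionDegree, h.rawDegree_eq hT, torsionRank_eq, effDegree]
  push_cast
  rfl

lemma IsPTorsion.slope_sub_eq (hT : IsPTorsion p k T) (h : IsEff F i ψ)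
    {N : Submodule (BK p k) T} (hN : Invariant ψ N) (hst : IsStable F N) :
    (slope (F.sub N hst) : ℝ) = effDegree E ψ i N / rho N := by
  rw [slope, torsionDegree, h.rawDegree_sub hT hN, torsionRank_sub hT, effDegree]
  push_cast
  rfl

variable {N N' : Submodule (BK p k) T}

lemma Invariant.submoduleOf (hN : Invariant ψ N) (hN' : Invariant ψ N') :
    Invariant (subPsi ψ hN') (N.submoduleOf N') := fun x hx => hN x hx

lemma StrictIn.submoduleOf (hN : StrictIn N ⊤) : StrictIn (N.submoduleOf N') ⊤ :=
  fun x _ hx => hN x trivial hx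

/-- The map induced by `ψ` on `N' / N`. -/
noncomputable def grPsi (ψ : T →ₛₗ[phi p k] T) (hN : Invariant ψ N) (hN' : Invariant ψ N') :
    (N' ⧸ N.submoduleOf N') →ₛₗ[phi p k] (N' ⧸ N.submoduleOf N') :=
  quotPsi (subPsi ψ hN') (hN.submoduleOf hN')

lemma IsPTorsion.gr (hT : IsPTorsion p k T) (hs : StrictIn N ⊤) (N' : Submodule (BK p k) T) :
    IsPTorsion p k (N' ⧸ N.submoduleOf N') :=
  (hT.sub N').quotient _ (strictIn_top_iff.mp hs.submoduleOf)

lemma IsEff.gr (h : IsEff F i ψ) (hN : Invariant ψ N) (hN' : Invariant ψ N') (hst : IsStable F N)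
    (hst' : IsStable F N') (hle : N ≤ N') :
    IsEff (F.gr hst hst' hle) i (grPsi ψ hN hN') :=
  IsEff.of_surjective (isPhiHom_mkQ _ _ _) (Submodule.mkQ_surjective _) (h.sub hN' hst')
    (quotPsi_mkQ _)

/-- The preimage in `T` of a submodule of `N' / N`. -/
noncomputable def grPreimage (X : Submodule (BK p k) (N' ⧸ N.submoduleOf N')) : Submodule (BK p k) T :=
  (X.comap (N.submoduleOf N').mkQ).map N'.subtype

lemma mem_grPreimage {X : Submodule (BK p k) (N' ⧸ N.submoduleOf N')} {x : T} :
    x ∈ grPreimage X ↔ ∃ hx : x ∈ N', (N.submoduleOf N').mkQ ⟨x, hx⟩ ∈ X := by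
  constructor
  · rintro ⟨y, hy, rfl⟩
    exact ⟨y.2, hy⟩
  · rintro ⟨hx, hX⟩
    exact ⟨⟨x, hx⟩, hX, rfl⟩

lemma grPreimage_le (X : Submodule (BK p k) (N' ⧸ N.submoduleOf N')) : grPreimage X ≤ N' :=
  Submodule.map_subtype_le _ _

lemma le_grPreimage (hle : N ≤ N') (X : Submodule (BK p k) (N' ⧸ N.submoduleOf N')) :
    N ≤ grPreimage X := by
  intro x hx
  refine mem_grPreimage.mpr ⟨hle hx, ?_⟩
  have : (N.submoduleOf N').mkQ ⟨x, hle hx⟩ = 0 := (Submodule.Quotient.mk_eq_zero _).mpr hx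
  rw [this]
  exact zero_mem _

lemma grPreimage_map {Y : Submodule (BK p k) T} (h : N ≤ Y) (h' : Y ≤ N') :
    grPreimage ((Y.submoduleOf N').map (N.submoduleOf N').mkQ) = Y := by
  ext x
  rw [mem_grPreimage]
  constructor
  · rintro ⟨hx, y, hy, hyx⟩
    have h1 : y - ⟨x, hx⟩ ∈ N.submoduleOf N' := (Submodule.Quotient.eq _).mp hyx
    have h2 : (y : T) - x ∈ Y := h h1
    have h3 : (y : T) ∈ Y := hy
    simpa using Y.sub_mem h3 h2
  · intro hx
    exact ⟨h' hx, ⟨x, h' hx⟩, hx, rfl⟩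

lemma grPreimage_top : grPreimage (⊤ : Submodule (BK p k) (N' ⧸ N.submoduleOf N')) = N' := by
  ext x
  rw [mem_grPreimage]
  exact ⟨fun h => h.1, fun h => ⟨h, trivial⟩⟩

lemma comap_inf_ker {A : Type*} [CommRing A] {M : Type*} [AddCommGroup M] [Module A M]
    (K : Submodule A M) (X : Submodule A (M ⧸ K)) :
    X.comap K.mkQ ⊓ LinearMap.ker K.mkQ = K := by
  rw [Submodule.ker_mkQ, inf_eq_right]
  intro x hx
  have h : K.mkQ x = 0 := (Submodule.Quotient.mk_eq_zero K).mpr hx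
  exact Submodule.mem_comap.mpr (h ▸ zero_mem X)

lemma map_submoduleOf {A : Type*} [CommRing A] {M : Type*} [AddCommGroup M] [Module A M]
    {K K' : Submodule A M} (hle : K ≤ K') : (K.submoduleOf K').map K'.subtype = K := by
  rw [Submodule.submoduleOf, Submodule.map_comap_subtype, inf_eq_right.mpr hle]

lemma IsPTorsion.rho_grPreimage (hT : IsPTorsion p k T) (hs : StrictIn N ⊤) (hle : N ≤ N')
    (X : Submodule (BK p k) (N' ⧸ N.submoduleOf N')) : rho (grPreimage X) = rho N + rho X := by
  rw [grPreimage, (hT.sub N').rho_map_of_injective hT N'.injective_subtype,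
    (hT.sub N').rho_eq_add_map (hT.gr hs N') (N.submoduleOf N').mkQ, comap_inf_ker,
    Submodule.map_comap_eq_of_surjective (Submodule.mkQ_surjective _),
    ← (hT.sub N').rho_map_of_injective hT N'.injective_subtype, map_submoduleOf hle]

lemma IsPTorsion.delta_grPreimage (hT : IsPTorsion p k T) (hψ : FrobInj ψ) (hs : StrictIn N ⊤)
    (hle : N ≤ N') (hN : Invariant ψ N) (hN' : Invariant ψ N')
    {X : Submodule (BK p k) (N' ⧸ N.submoduleOf N')} (hX : Invariant (grPsi ψ hN hN') X) :
    delta ψ (grPreimage X) = delta ψ N + delta (grPsi ψ hN hN') X := by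
  have hinj : FrobInj (subPsi ψ hN') := by
    intro x hx
    have h1 := congrArg N'.subtype hx
    rw [map_sum, map_zero] at h1
    have h2 := hψ (fun i => (x i : T)) h1
    funext i
    exact Subtype.ext (congrFun h2 i)
  have hq : FrobInj (grPsi ψ hN hN') :=
    hinj.quotPsi (hT.sub N') (hN.submoduleOf hN') hs.submoduleOf
  have hc : ∀ x, N'.subtype (subPsi ψ hN' x) = ψ (N'.subtype x) := fun _ => rfl
  have hX' := Invariant.comap (quotPsi_mkQ (hN.submoduleOf hN')) hX
  rw [grPreimage, (hT.sub N').delta_map_of_injective hT hinj hψ hc N'.injective_subtype hX',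
    (hT.sub N').delta_eq_add_map (hT.gr hs N') hinj hq (quotPsi_mkQ (hN.submoduleOf hN')) hX',
    comap_inf_ker, Submodule.map_comap_eq_of_surjective (Submodule.mkQ_surjective _),
    ← (hT.sub N').delta_map_of_injective hT hinj hψ hc N'.injective_subtype
      (hN.submoduleOf hN'), map_submoduleOf hle]

lemma IsPTorsion.effDegree_grPreimage (hT : IsPTorsion p k T) (hψ : FrobInj ψ)
    (hs : StrictIn N ⊤) (hle : N ≤ N') (hN : Invariant ψ N) (hN' : Invariant ψ N')
    {X : Submodule (BK p k) (N' ⧸ N.submoduleOf N')} (hX : Invariant (grPsi ψ hN hN') X) :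
    effDegree E (grPsi ψ hN hN') i X = effDegree E ψ i (grPreimage X) - effDegree E ψ i N := by
  simp only [effDegree]
  rw [hT.delta_grPreimage hψ hs hle hN hN' hX, hT.rho_grPreimage hs hle, ← sub_div]
  congr 1
  push_cast
  ring

lemma invariant_grPreimage (hN : Invariant ψ N) (hN' : Invariant ψ N')
    {X : Submodule (BK p k) (N' ⧸ N.submoduleOf N')} (hX : Invariant (grPsi ψ hN hN') X) :
    Invariant ψ (grPreimage X) :=
  (Invariant.comap (quotPsi_mkQ (hN.submoduleOf hN')) hX).map (ψ' := ψ) fun _ => rfl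

lemma strictIn_grPreimage (hs' : StrictIn N' ⊤)
    {X : Submodule (BK p k) (N' ⧸ N.submoduleOf N')} (hX : StrictIn X ⊤) :
    StrictIn (grPreimage X) ⊤ := by
  intro x _ hx
  obtain ⟨hx', hX'⟩ := mem_grPreimage.mp hx
  exact mem_grPreimage.mpr ⟨hs' x trivial hx', hX _ trivial hX'⟩

lemma strictIn_of_grPreimage {X : Submodule (BK p k) (N' ⧸ N.submoduleOf N')}
    (hX : StrictIn (grPreimage X) ⊤) : StrictIn X ⊤ := by
  intro y _ hy
  obtain ⟨x, rfl⟩ := Submodule.mkQ_surjective _ y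
  have h1 : (PowerSeries.X : BK p k) • (x : T) ∈ grPreimage X :=
    mem_grPreimage.mpr ⟨N'.smul_mem _ x.2, hy⟩
  exact (mem_grPreimage.mp (hX x trivial h1)).2

lemma IsEff.slope_gr (hT : IsPTorsion p k T) (h : IsEff F i ψ) {N N' : StrictSub ψ}
    (hst : IsStable F N.1) (hst' : IsStable F N'.1) (hle : N.1 ≤ N'.1) :
    (slope (F.gr hst hst' hle) : ℝ) = intervalSlope (fun N : StrictSub ψ => rho N.1)
      (fun N => effDegree E ψ i N.1) N N' := by
  have hr := hT.rho_grPreimage (X := ⊤) N.2.1 hle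
  rw [(hT.gr N.2.1 N'.1).slope_eq (h.gr N.2.2 N'.2.2 hst hst' hle),
    hT.effDegree_grPreimage (h.frobInj hT) N.2.1 hle N.2.2 N'.2.2 invariant_top]
  rw [grPreimage_top] at hr ⊢
  simp only [intervalSlope, hr]
  push_cast
  rw [add_sub_cancel_left]

/-- Taking preimages matches strict subobjects of `N' / N` with strict `Y` between `N` and `N'`, and
additivity of rank and degree turns slopes into interval slopes. Nonzero subobjects correspond to `N
< Y`. -/
lemma IsEff.isSemistable_gr_iff (hT : IsPTorsion p k T) (h : IsEff F i ψ) {N N' : StrictSub ψ}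
    (hst : IsStable F N.1) (hst' : IsStable F N'.1) (hle : N.1 ≤ N'.1) :
    IsSemistable (F.gr hst hst' hle) ↔ N < N' ∧ ∀ Y : StrictSub ψ, N < Y → Y ≤ N' →
      intervalSlope (fun N : StrictSub ψ => rho N.1) (fun N => effDegree E ψ i N.1) N Y ≤
      intervalSlope (fun N : StrictSub ψ => rho N.1) (fun N => effDegree E ψ i N.1) N N' := by
  have hTg := hT.gr N.2.1 N'.1
  have hg := h.gr N.2.2 N'.2.2 hst hst' hle
  have hψ := h.frobInj hT
  have hsl : ∀ (X : Submodule (BK p k) (N'.1 ⧸ N.1.submoduleOf N'.1))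
      (hX : Invariant (grPsi ψ N.2.2 N'.2.2) X) (hsX : StrictIn X ⊤)
      (hXst : IsStable (F.gr hst hst' hle) X),
      (slope ((F.gr hst hst' hle).sub X hXst) : ℝ) = intervalSlope
        (fun N : StrictSub ψ => rho N.1) (fun N => effDegree E ψ i N.1) N
        ⟨grPreimage X, strictIn_grPreimage N'.2.1 hsX, invariant_grPreimage N.2.2 N'.2.2 hX⟩ := by
    intro X hX hsX hXst
    rw [hTg.slope_sub_eq hg hX, hT.effDegree_grPreimage hψ N.2.1 hle N.2.2 N'.2.2 hX]
    simp only [intervalSlope, hT.rho_grPreimage N.2.1 hle]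
    push_cast
    rw [add_sub_cancel_left]
  have hsub : Nontrivial (N'.1 ⧸ N.1.submoduleOf N'.1) ↔ N < N' := by
    rw [← not_iff_not, not_nontrivial_iff_subsingleton, Submodule.Quotient.subsingleton_iff,
      Submodule.submoduleOf_eq_top]
    exact ⟨fun hle' hlt => (hlt : N.1 < N'.1).not_ge hle',
      fun hn => by
        by_contra hcon
        exact hn (lt_of_le_not_ge (show N.1 ≤ N'.1 from hle) hcon : N.1 < N'.1)⟩
  constructor
  · rintro ⟨hnt, hss⟩
    refine ⟨hsub.mp hnt, fun Y hNY hYN' => ?_⟩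
    let X := (Y.1.submoduleOf N'.1).map (N.1.submoduleOf N'.1).mkQ
    have hpre : grPreimage X = Y.1 := grPreimage_map hNY.le hYN'
    have hX : Invariant (grPsi ψ N.2.2 N'.2.2) X :=
      (Y.2.2.submoduleOf N'.2.2).map (quotPsi_mkQ _)
    have hsX : StrictIn X ⊤ := strictIn_of_grPreimage (by rw [hpre]; exact Y.2.1)
    have hXst := hg.isStable hTg hX
    have hne : X ≠ ⊥ := by
      intro hb
      have h1 := hT.rho_grPreimage N.2.1 hle X
      rw [hb, rho_bot, ← hb, hpre, add_zero] at h1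
      exact absurd ((hT.isSlopeData (E := E) hψ i).strictMono hNY) h1.le.not_gt
    have h1 := hss X hXst (strictIn_top_iff.mp hsX) hne
    have h2 : (slope ((F.gr hst hst' hle).sub X hXst) : ℝ) ≤ slope (F.gr hst hst' hle) := by
      exact_mod_cast h1
    rw [hsl X hX hsX hXst, h.slope_gr hT] at h2
    have h3 : (⟨grPreimage X, strictIn_grPreimage N'.2.1 hsX, invariant_grPreimage N.2.2 N'.2.2 hX⟩ : StrictSub ψ) = Y :=
      Subtype.ext hpre
    rwa [h3] at h2
  · rintro ⟨hlt, hss⟩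
    refine ⟨hsub.mpr hlt, fun X hXst hsX hne => ?_⟩
    have hsX' := strictIn_top_iff.mpr hsX
    have hX := hg.invariant hTg hsX' hXst
    have h1 := hss ⟨grPreimage X, strictIn_grPreimage N'.2.1 hsX', invariant_grPreimage N.2.2 N'.2.2 hX⟩ (by
      refine lt_of_le_of_ne (show N.1 ≤ grPreimage X from le_grPreimage hle X) fun he => hne ?_
      have he' : N.1 = grPreimage X := congrArg Subtype.val he
      rw [eq_bot_iff]
      intro y hy
      obtain ⟨x, rfl⟩ := Submodule.mkQ_surjective _ y
      have hx : (x : T) ∈ N.1 := he' ▸ mem_grPreimage.mpr ⟨x.2, hy⟩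
      exact (Submodule.Quotient.mk_eq_zero _).mpr hx) (grPreimage_le X)
    rw [← hsl X hX hsX' hXst, ← h.slope_gr hT hst hst' hle] at h1
    exact_mod_cast h1

end GradedPieces

/-! ### Existence, uniqueness and polygon of the Harder-Narasimhan filtration -/

section Flags

variable {p : ℕ} [hp : Fact p.Prime] {k : Type u} [Field k] [CharP k p] [PerfectRing k p]
  {E : (WittVector p k)[X]} [hE : IsUniformizerPoly p k E] {T : Type v} [AddCommGroup T]
  [Module (BK p k) T] {ψ : T →ₛₗ[phi p k] T} {F : KisinStr p k E T} {i : ℕ}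

/-- The chain of strict subobjects underlying a Harder-Narasimhan filtration. -/
noncomputable def HNFlag.chain (hT : IsPTorsion p k T) (h : IsEff F i ψ) (Φ : HNFlag F) (j : Fin (Φ.len + 1)) :
    StrictSub ψ :=
  ⟨Φ.obj j, strictIn_top_iff.mpr (Φ.strict j),
    h.invariant hT (strictIn_top_iff.mpr (Φ.strict j)) (Φ.stable j)⟩

lemma HNFlag.slope_chain (hT : IsPTorsion p k T) (h : IsEff F i ψ) (Φ : HNFlag F)
    (j : Fin Φ.len) :
    (slope (F.gr (Φ.stable j.castSucc) (Φ.stable j.succ) (Φ.mono j.castSucc_le_succ)) : ℝ) =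
      intervalSlope (fun N : StrictSub ψ => rho N.1) (fun N => effDegree E ψ i N.1)
        (Φ.chain hT h j.castSucc) (Φ.chain hT h j.succ) :=
  h.slope_gr hT (N := Φ.chain hT h j.castSucc) (N' := Φ.chain hT h j.succ) (Φ.stable _)
    (Φ.stable _) (Φ.mono j.castSucc_le_succ)

lemma HNFlag.isHNChain (hT : IsPTorsion p k T) (h : IsEff F i ψ) (Φ : HNFlag F) :
    IsHNChain (fun N : StrictSub ψ => rho N.1) (fun N => effDegree E ψ i N.1) ⊥
      (Φ.chain hT h) := by
  have key := fun j : Fin Φ.len => (h.isSemistable_gr_iff hT (N := Φ.chain hT h j.castSucc)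
    (N' := Φ.chain hT h j.succ) (Φ.stable _) (Φ.stable _) (Φ.mono j.castSucc_le_succ)).mp
    (Φ.semistable j)
  refine ⟨Subtype.ext (Φ.obj_zero.trans hT.bot_val.symm), Subtype.ext Φ.obj_last,
    fun j => (key j).1, fun j => (key j).2, fun j j' hj => ?_⟩
  have h1 := (Rat.cast_lt (K := ℝ)).mpr (Φ.slope_anti hj)
  exact (Φ.slope_chain hT h j').symm.trans_lt (h1.trans_eq (Φ.slope_chain hT h j))

lemma IsHNChain.nonempty_flag (hT : IsPTorsion p k T) (h : IsEff F i ψ) {s : ℕ}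
    {c : Fin (s + 1) → StrictSub ψ}
    (hc : IsHNChain (fun N : StrictSub ψ => rho N.1) (fun N => effDegree E ψ i N.1) ⊥ c) :
    Nonempty (HNFlag F) := by
  have hst : ∀ j, IsStable F (c j).1 := fun j => h.isStable hT (c j).2.2
  have hmono : Monotone fun j => (c j).1 := fun j j' hj => hc.strictMono.monotone hj
  exact ⟨{
    len := s
    obj := fun j => (c j).1
    obj_zero := by rw [hc.zero, hT.bot_val]
    obj_last := by rw [hc.last]; rfl
    mono := hmono
    stable := hst
    strict := fun j => strictIn_top_iff.mp (c j).2.1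
    semistable := fun j => (h.isSemistable_gr_iff hT (N := c j.castSucc) (N' := c j.succ)
      (hst _) (hst _) (hmono j.castSucc_le_succ)).mpr ⟨hc.lt j, hc.semistable j⟩
    slope_anti := fun j j' hj => by
      have h1 := hc.anti hj
      simp only at h1
      rw [← h.slope_gr hT (hst _) (hst _) (hmono j.castSucc_le_succ),
        ← h.slope_gr hT (hst _) (hst _) (hmono j'.castSucc_le_succ)] at h1
      exact_mod_cast h1 }⟩

lemma HNFlag.eq_of_obj_eq {Φ Ψ : HNFlag F} (hlen : Φ.len = Ψ.len)
    (hobj : ∀ j : Fin (Φ.len + 1), Φ.obj j = Ψ.obj (Fin.cast (congrArg (· + 1) hlen) j)) :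
    Φ = Ψ := by
  cases Φ with | mk len obj =>
  cases Ψ with | mk len' obj' =>
  cases hlen
  have : obj = obj' := funext hobj
  cases this
  rfl

-- Once an effective `ψ` is fixed, every filtration is a chain for the same slope data, so the
-- lattice theory applies to all of them at once.
variable (E) in
lemma IsPTorsion.existsUnique_flag (hT : IsPTorsion p k T) (F : KisinStr p k E T) :
    ∃ Φ : HNFlag F, ∀ Ψ, Ψ = Φ := by
  obtain ⟨i, hi⟩ := exists_isEff E hT F
  obtain ⟨ψ, h⟩ := hi i le_rfl
  have hd := hT.isSlopeData (E := E) (h.frobInj hT) i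
  obtain ⟨s, c, hc⟩ := hd.exists_chain ⊥
  obtain ⟨Φ⟩ := hc.nonempty_flag hT h
  refine ⟨Φ, fun Ψ => ?_⟩
  have h1 := Φ.isHNChain hT h
  have h2 := Ψ.isHNChain hT h
  have hlen : Ψ.len = Φ.len := h2.length_eq hd h1
  refine HNFlag.eq_of_obj_eq hlen ?_
  have h3 : ∀ {m n : ℕ} (hmn : m = n) (a : Fin (m + 1) → StrictSub ψ)
      (b : Fin (n + 1) → StrictSub ψ),
      IsHNChain (fun N : StrictSub ψ => rho N.1) (fun N => effDegree E ψ i N.1) ⊥ a →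
      IsHNChain (fun N : StrictSub ψ => rho N.1) (fun N => effDegree E ψ i N.1) ⊥ b →
      ∀ j, a j = b (Fin.cast (congrArg (· + 1) hmn) j) := by
    rintro m n rfl a b ha hb j
    rw [ha.unique hd hb]
    rfl
  exact fun j => congrArg Subtype.val (h3 hlen _ _ h2 h1 j)

/-- The properties characterizing the Harder-Narasimhan polygon `P` of `T`. -/
structure IsHNPolygon (E : (WittVector p k)[X]) (ψ : T →ₛₗ[phi p k] T) (i : ℕ) (P : ℝ → ℝ) :
    Prop where
  concaveOn : ConcaveOn ℝ (Set.Icc (0 : ℝ) (rho (⊤ : Submodule (BK p k) T))) P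
  le : ∀ N : Submodule (BK p k) T, Invariant ψ N → effDegree E ψ i N ≤ P (rho N)
  least : ∀ g : ℝ → ℝ, ConcaveOn ℝ (Set.Icc (0 : ℝ) (rho (⊤ : Submodule (BK p k) T))) g →
    (∀ N : Submodule (BK p k) T, Invariant ψ N → effDegree E ψ i N ≤ g (rho N)) →
    ∀ x ∈ Set.Icc (0 : ℝ) (rho (⊤ : Submodule (BK p k) T)), P x ≤ g x
  zero : P 0 = 0
  last : P (rho (⊤ : Submodule (BK p k) T)) = effDegree E ψ i ⊤

lemma HNFlag.polygon_eq (hT : IsPTorsion p k T) (h : IsEff F i ψ) (Φ : HNFlag F) (x : ℝ) :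
    Φ.polygon x = IsHNChain.chainPolygon (fun N : StrictSub ψ => rho N.1)
      (fun N => effDegree E ψ i N.1) (Φ.chain hT h) x := by
  rw [HNFlag.polygon, IsHNChain.chainPolygon]
  refine Finset.sum_congr rfl fun j _ => ?_
  rw [Φ.slope_chain hT h j, torsionRank_sub hT, torsionRank_sub hT]
  rfl

lemma IsEff.exists_hnPolygon_eq (hT : IsPTorsion p k T) (h : IsEff F i ψ) :
    ∃ (s : ℕ) (c : Fin (s + 1) → StrictSub ψ),
      IsHNChain (fun N : StrictSub ψ => rho N.1) (fun N => effDegree E ψ i N.1) ⊥ c ∧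
      hnPolygon F = IsHNChain.chainPolygon (fun N : StrictSub ψ => rho N.1)
        (fun N => effDegree E ψ i N.1) c := by
  have hne : Nonempty (HNFlag F) := ⟨(hT.existsUnique_flag E F).choose⟩
  refine ⟨_, _, hne.some.isHNChain hT h, funext fun x => ?_⟩
  rw [hnPolygon, dif_pos hne, HNFlag.polygon_eq hT h]

/-- The bound extends from strict subobjects to all stable submodules because saturation keeps the
rank and cannot lower the degree. This matters later, when images under morphisms are not saturated.
-/
lemma IsHNChain.isHNPolygon (hT : IsPTorsion p k T) (hψ : FrobInj ψ) {s : ℕ}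
    {c : Fin (s + 1) → StrictSub ψ} {rk : StrictSub ψ → ℕ} {deg : StrictSub ψ → ℝ}
    (hrk : ∀ N, rk N = rho N.1) (hdeg : ∀ N, deg N = effDegree E ψ i N.1)
    (hd : IsSlopeData rk deg) (hc : IsHNChain rk deg ⊥ c) :
    IsHNPolygon E ψ i (IsHNChain.chainPolygon rk deg c) := by
  have htop : rho (⊤ : Submodule (BK p k) T) = rk ⊤ := (hrk ⊤).symm
  refine ⟨?_, fun N hN => ?_, fun g hg hle x hx => ?_, ?_, ?_⟩
  · rw [htop]
    exact hc.concaveOn_chainPolygon hd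
  · let N₁ : StrictSub ψ := ⟨uSat N, strictIn_uSat N, hN.uSat⟩
    have h1 := hc.deg_le_chainPolygon hd N₁
    have h0 : rk N₁ = rho N := (hrk N₁).trans (hT.rho_uSat N)
    have h0' : deg N₁ = effDegree E ψ i (uSat N) := hdeg N₁
    rw [h0, h0'] at h1
    refine le_trans ?_ h1
    simp only [effDegree]
    rw [hT.rho_uSat]
    refine div_le_div_of_nonneg_right ?_ (Nat.cast_nonneg _)
    have h2 := hT.delta_le_uSat hψ hN
    exact_mod_cast add_le_add_left h2 _
  · rw [htop] at hg hx
    refine hc.chainPolygon_le hd hg (fun N => ?_) hx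
    rw [hrk N, hdeg N]
    exact hle N.1 N.2.2
  · have h1 := hc.chainPolygon_rk hd 0
    rw [hc.zero, hd.rk_bot, hd.deg_bot, Nat.cast_zero] at h1
    exact h1
  · have h1 := hc.chainPolygon_rk hd (Fin.last s)
    rw [hc.last] at h1
    rw [htop, h1, hdeg]
    rfl

lemma IsEff.isHNPolygon (hT : IsPTorsion p k T) (h : IsEff F i ψ) :
    IsHNPolygon E ψ i (hnPolygon F) := by
  obtain ⟨s, c, hc, hP⟩ := h.exists_hnPolygon_eq hT
  rw [hP]
  exact hc.isHNPolygon hT (h.frobInj hT) (fun _ => rfl) (fun _ => rfl)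
    (hT.isSlopeData (h.frobInj hT) i)

lemma IsPTorsion.exists_lipschitz_hnPolygon (hT : IsPTorsion p k T) (F : KisinStr p k E T) :
    ∃ C : ℝ, 0 ≤ C ∧ ∀ x y : ℝ, |hnPolygon F x - hnPolygon F y| ≤ C * |x - y| := by
  obtain ⟨i, hi⟩ := exists_isEff E hT F
  obtain ⟨ψ, h⟩ := hi i le_rfl
  obtain ⟨s, c, hc, hP⟩ := h.exists_hnPolygon_eq hT
  rw [hP]
  exact IsHNChain.abs_chainPolygon_sub_le c

end Flags

/-! ### Limits of concave functions decreasing for divisibility -/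

section RealPolygons

/-- A sequence of concave functions on `[0, r]` with common values at the ends, decreasing for
divisibility. -/
structure IsDivDecreasing (t : ℕ → ℝ → ℝ) (r D C : ℝ) : Prop where
  nonneg : 0 ≤ r
  concaveOn : ∀ n, 1 ≤ n → ConcaveOn ℝ (Set.Icc 0 r) (t n)
  zero : ∀ n, 1 ≤ n → t n 0 = 0
  last : ∀ n, 1 ≤ n → t n r = D
  mul_le : ∀ n m, 1 ≤ n → 1 ≤ m → ∀ x ∈ Set.Icc 0 r, t (n * m) x ≤ t n x
  lipschitz_one : ∀ x ∈ Set.Icc 0 r, ∀ y ∈ Set.Icc 0 r, |t 1 x - t 1 y| ≤ C * |x - y|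

namespace IsDivDecreasing

variable {t : ℕ → ℝ → ℝ} {r D C : ℝ}

/-- `t n ≤ t 1` and the common value at `0` bound chord slopes from `0` by `C`, and concavity
carries the bound to all later chords. `le_sub` is the mirror image at `r`. The resulting Lipschitz
constant does not depend on `n`. -/
lemma sub_le (h : IsDivDecreasing t r D C) {n : ℕ} (hn : 1 ≤ n) {x y : ℝ} (hx : x ∈ Set.Icc 0 r)
    (hy : y ∈ Set.Icc 0 r) (hxy : x < y) : t n y - t n x ≤ C * (y - x) := by
  have hle : ∀ z ∈ Set.Icc 0 r, t n z ≤ C * z := by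
    intro z hz
    have h1 := h.mul_le 1 n le_rfl hn z hz
    have h2 := (abs_le.mp (h.lipschitz_one z hz 0 ⟨le_rfl, h.nonneg⟩)).2
    rw [h.zero 1 le_rfl, sub_zero, sub_zero, abs_of_nonneg hz.1] at h2
    rw [one_mul] at h1
    exact h1.trans h2
  rcases hx.1.eq_or_lt with h0 | h0
  · rw [← h0, h.zero n hn, sub_zero, sub_zero]
    exact hle y hy
  · have h1 := (h.concaveOn n hn).slope_anti_adjacent ⟨le_rfl, h.nonneg⟩ hy h0 hxy
    rw [h.zero n hn, sub_zero, sub_zero] at h1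
    have h2 : t n x / x ≤ C := (div_le_iff₀ h0).mpr (hle x hx)
    exact (div_le_iff₀ (sub_pos.mpr hxy)).mp (h1.trans h2)

lemma le_sub (h : IsDivDecreasing t r D C) {n : ℕ} (hn : 1 ≤ n) {x y : ℝ} (hx : x ∈ Set.Icc 0 r)
    (hy : y ∈ Set.Icc 0 r) (hxy : x < y) : -(C * (y - x)) ≤ t n y - t n x := by
  have hle : ∀ z ∈ Set.Icc 0 r, -(C * (r - z)) ≤ D - t n z := by
    intro z hz
    have h1 := h.mul_le 1 n le_rfl hn z hz
    have h2 := (abs_le.mp (h.lipschitz_one r ⟨h.nonneg, le_rfl⟩ z hz)).1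
    rw [h.last 1 le_rfl, abs_of_nonneg (sub_nonneg.mpr hz.2)] at h2
    rw [one_mul] at h1
    linarith
  rcases hy.2.eq_or_lt with h0 | h0
  · rw [h0, h.last n hn]
    exact hle x hx
  · have h1 := (h.concaveOn n hn).slope_anti_adjacent hx ⟨h.nonneg, le_rfl⟩ hxy h0
    rw [h.last n hn] at h1
    have h2 : -C ≤ (D - t n y) / (r - y) := (le_div_iff₀ (sub_pos.mpr h0)).mpr (by
      linarith [hle y hy])
    have := (le_div_iff₀ (sub_pos.mpr hxy)).mp (h2.trans h1)
    linarith

lemma lipschitz (h : IsDivDecreasing t r D C) {n : ℕ} (hn : 1 ≤ n) {x y : ℝ}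
    (hx : x ∈ Set.Icc 0 r) (hy : y ∈ Set.Icc 0 r) : |t n x - t n y| ≤ C * |x - y| := by
  rcases lt_trichotomy x y with hxy | rfl | hxy
  · rw [abs_sub_comm, abs_sub_comm x, abs_of_pos (sub_pos.mpr hxy)]
    exact abs_le.mpr ⟨h.le_sub hn hx hy hxy, h.sub_le hn hx hy hxy⟩
  · simp
  · rw [abs_of_pos (sub_pos.mpr hxy)]
    exact abs_le.mpr ⟨h.le_sub hn hy hx hxy, h.sub_le hn hy hx hxy⟩

lemma bddBelow (h : IsDivDecreasing t r D C) {x : ℝ} (hx : x ∈ Set.Icc 0 r) :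
    BddBelow (Set.range fun n : ℕ+ => t n x) := by
  refine ⟨-(C * x), ?_⟩
  rintro _ ⟨n, rfl⟩
  have h1 := (abs_le.mp (h.lipschitz n.pos hx ⟨le_rfl, h.nonneg⟩)).1
  rw [h.zero _ n.pos, sub_zero, sub_zero, abs_of_nonneg hx.1] at h1
  exact h1

lemma iInf_le (h : IsDivDecreasing t r D C) {n : ℕ} (hn : 1 ≤ n) {x : ℝ} (hx : x ∈ Set.Icc 0 r) :
    ⨅ n : ℕ+, t n x ≤ t n x :=
  ciInf_le (h.bddBelow hx) ⟨n, hn⟩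

lemma isGLB (h : IsDivDecreasing t r D C) {x : ℝ} (hx : x ∈ Set.Icc 0 r) :
    IsGLB {y | ∃ n : ℕ, 1 ≤ n ∧ y = t n x} (⨅ n : ℕ+, t n x) := by
  have h1 : {y | ∃ n : ℕ, 1 ≤ n ∧ y = t n x} = Set.range fun n : ℕ+ => t n x := by
    ext y
    exact ⟨fun ⟨n, hn, hy⟩ => ⟨⟨n, hn⟩, hy.symm⟩, fun ⟨n, hy⟩ => ⟨n, n.pos, hy.symm⟩⟩
  rw [h1]
  exact isGLB_ciInf (h.bddBelow hx)

lemma iInf_sub_le (h : IsDivDecreasing t r D C) {x y : ℝ} (hx : x ∈ Set.Icc 0 r)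
    (hy : y ∈ Set.Icc 0 r) : (⨅ n : ℕ+, t n x) - (⨅ n : ℕ+, t n y) ≤ C * |x - y| := by
  rw [sub_le_comm]
  refine le_ciInf fun n => ?_
  have h1 := h.iInf_le n.pos hx
  have h2 := (abs_le.mp (h.lipschitz n.pos hx hy)).2
  linarith

lemma iInf_lipschitz (h : IsDivDecreasing t r D C) {x y : ℝ} (hx : x ∈ Set.Icc 0 r)
    (hy : y ∈ Set.Icc 0 r) : |(⨅ n : ℕ+, t n x) - (⨅ n : ℕ+, t n y)| ≤ C * |x - y| := by
  refine abs_le.mpr ⟨?_, h.iInf_sub_le hx hy⟩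
  have h1 := h.iInf_sub_le hy hx
  rw [abs_sub_comm] at h1
  linarith

lemma continuousOn (h : IsDivDecreasing t r D C) (hC : 0 ≤ C) :
    ContinuousOn (fun x => ⨅ n : ℕ+, t n x) (Set.Icc 0 r) := by
  refine (LipschitzOnWith.of_dist_le_mul (K := ⟨C, hC⟩) fun x hx y hy => ?_).continuousOn
  rw [Real.dist_eq, Real.dist_eq]
  exact h.iInf_lipschitz hx hy

lemma concaveOn_iInf (h : IsDivDecreasing t r D C) :
    ConcaveOn ℝ (Set.Icc 0 r) (fun x => ⨅ n : ℕ+, t n x) := by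
  refine ⟨convex_Icc _ _, fun x hx y hy a b ha hb hab => le_ciInf fun n => ?_⟩
  refine le_trans ?_ ((h.concaveOn n n.pos).2 hx hy ha hb hab)
  exact add_le_add (mul_le_mul_of_nonneg_left (h.iInf_le n.pos hx) ha)
    (mul_le_mul_of_nonneg_left (h.iInf_le n.pos hy) hb)

lemma iInf_zero (h : IsDivDecreasing t r D C) : ⨅ n : ℕ+, t n 0 = 0 := by
  simp only [fun n : ℕ+ => h.zero n n.pos, ciInf_const]

lemma iInf_last (h : IsDivDecreasing t r D C) : ⨅ n : ℕ+, t n r = D := by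
  simp only [fun n : ℕ+ => h.last n n.pos, ciInf_const]

lemma of_dvd (h : IsDivDecreasing t r D C) {n m : ℕ} (hm : 1 ≤ m) (hdvd : n ∣ m) {x : ℝ}
    (hx : x ∈ Set.Icc 0 r) : t m x ≤ t n x := by
  obtain ⟨c, rfl⟩ := hdvd
  exact h.mul_le n c (Nat.pos_of_mul_pos_right hm) (Nat.pos_of_mul_pos_left hm) x hx

/-- The common Lipschitz bound reduces the estimate to finitely many centres of small balls, each of
which needs closeness for one index only. -/
lemma tendsto_uniformly (h : IsDivDecreasing t r D C) (hC : 0 ≤ C) {ε : ℝ} (hε : 0 < ε) :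
    ∃ N : ℕ, 1 ≤ N ∧ ∀ n : ℕ, 1 ≤ n → N ∣ n → ∀ x ∈ Set.Icc 0 r,
      |t n x - ⨅ n : ℕ+, t n x| < ε := by
  -- `C + 1` keeps the radius meaningful when `C = 0`. Three errors of `ε / 4` occur: two Lipschitz
  -- ones and the approximation at the centre.
  have hδ : 0 < ε / (4 * (C + 1)) := by positivity
  obtain ⟨s, hs, hfin, hcov⟩ := finite_cover_balls_of_compact (isCompact_Icc (a := (0 : ℝ)) (b := r))
    hδ
  have hex : ∀ x : ℝ, ∃ n : ℕ+, t n x < (⨅ n : ℕ+, t n x) + ε / 4 := fun x =>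
    exists_lt_of_ciInf_lt (lt_add_of_pos_right _ (by positivity))
  choose ν hν using hex
  -- The product is a common multiple of the indices chosen at the centres.
  refine ⟨∏ x ∈ hfin.toFinset, (ν x : ℕ), Nat.one_le_iff_ne_zero.mpr
    (Finset.prod_ne_zero_iff.mpr fun x _ => (ν x).ne_zero), fun n hn hdvd x hx => ?_⟩
  obtain ⟨z, hz, hxz⟩ := Set.mem_iUnion₂.mp (hcov hx)
  rw [Metric.mem_ball, Real.dist_eq] at hxz
  have hz' := hs hz
  have h1 : t n z ≤ t (ν z) z :=
    h.of_dvd hn ((Finset.dvd_prod_of_mem _ (hfin.mem_toFinset.mpr hz)).trans hdvd) hz'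
  have h2 := (abs_le.mp (h.lipschitz hn hx hz')).2
  have h3 := (abs_le.mp (h.iInf_lipschitz hx hz')).1
  have h4 := h.iInf_le hn hx
  have h5 : C * |x - z| ≤ ε / 4 := by
    calc C * |x - z| ≤ (C + 1) * (ε / (4 * (C + 1))) := by gcongr; linarith
      _ = ε / 4 := by field_simp
  rw [abs_of_nonneg (by linarith)]
  linarith [hν z]

/-- Replacing `n` by its multiples `n * (m + 1)` does not increase `t'`, while the error `B / n`
tends to zero. -/
lemma iInf_le_iInf {t' : ℕ → ℝ → ℝ} {D' C' B : ℝ} (h : IsDivDecreasing t r D C)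
    (h' : IsDivDecreasing t' r D' C') {x : ℝ} (hx : x ∈ Set.Icc 0 r)
    (hle : ∀ n : ℕ, 1 ≤ n → t n x ≤ t' n x + B / n) :
    ⨅ n : ℕ+, t n x ≤ ⨅ n : ℕ+, t' n x := by
  refine le_ciInf fun n => ge_of_tendsto' (x := Filter.atTop)
    (f := fun m : ℕ => t' n x + B / ((n * (m + 1) : ℕ) : ℝ)) ?_ fun m => ?_
  · have h1 : Filter.Tendsto (fun m : ℕ => B / ((n * (m + 1) : ℕ) : ℝ)) Filter.atTop (nhds 0) := by
      refine Filter.Tendsto.div_atTop tendsto_const_nhds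
        (tendsto_natCast_atTop_atTop.comp (Filter.tendsto_atTop_mono (fun m => ?_)
          Filter.tendsto_id))
      exact (Nat.le_succ m).trans (Nat.le_mul_of_pos_left _ n.pos)
    simpa using h1.const_add (t' n x)
  · have hm : 1 ≤ (n : ℕ) * (m + 1) := Nat.mul_pos n.pos m.succ_pos
    have h1 := h.iInf_le hm hx
    have h2 := hle _ hm
    have h3 := h'.mul_le n (m + 1) n.pos m.succ_pos x hx
    linarith

end IsDivDecreasing

end RealPolygons

/-! ### Formal properties of morphisms -/

section Morphisms

variable {R : Type u} [CommRing R] {φ : R →+* R} {E : R} {L M N : Type*} [AddCommGroup L]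
  [Module R L] [AddCommGroup M] [Module R M] [AddCommGroup N] [Module R N] {F : FrobStr φ E L}
  {G : FrobStr φ E M} {H : FrobStr φ E N}

lemma IsPhiHom.comp {g : M →ₗ[R] N} {f : L →ₗ[R] M} (hg : IsPhiHom G H g) (hf : IsPhiHom F G f) :
    IsPhiHom F H (g ∘ₗ f) := by
  intro z
  have h1 := congrArg (Away.map E g) (hf z)
  rw [hg] at h1
  rw [Away.map_comp, Pullback.map_comp, Away.map_comp]
  exact h1

lemma IsPhiHom.of_comp_surjective {q : L →ₗ[R] M} {f : M →ₗ[R] N} (hq : IsPhiHom F G q)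
    (hsurj : Function.Surjective q) (hf : IsPhiHom F H (f ∘ₗ q)) : IsPhiHom G H f := by
  intro z
  obtain ⟨z, rfl⟩ := Away.map_surjective E (Pullback.map_surjective φ hsurj) z
  have h1 := hf z
  rw [Away.map_comp, Pullback.map_comp, Away.map_comp] at h1
  rw [← hq]
  exact h1

variable (F) in
lemma isPhiHom_lsmul {c : R} (hc : φ c = c) : IsPhiHom F F (LinearMap.lsmul R L c) := by
  intro z
  rw [Pullback.map_lsmul, hc, Away.map_lsmul, Away.map_lsmul]
  exact (F.map_smul (algebraMap R (Localization.Away E) c) z).symm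

end Morphisms

/-! ### The reductions `M / p ^ n` and the exact sequences between them -/

section Reduction

variable {p : ℕ} [hp : Fact p.Prime] {k : Type u} [Field k] {M N : Type*} [AddCommGroup M]
  [Module (BK p k) M] [AddCommGroup N] [Module (BK p k) N]

variable (p k M) in
/-- The submodule `p ^ n M`. -/
noncomputable abbrev pPow (n : ℕ) : Submodule (BK p k) M := Ideal.span {(p : BK p k) ^ n} • ⊤

lemma mem_pPow {n : ℕ} {x : M} : x ∈ pPow p k M n ↔ ∃ y, x = (p : BK p k) ^ n • y := by
  rw [pPow, Submodule.ideal_span_singleton_smul, Submodule.mem_smul_pointwise_iff_exists]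
  exact ⟨fun ⟨y, _, hy⟩ => ⟨y, hy.symm⟩, fun ⟨y, hy⟩ => ⟨y, trivial, hy.symm⟩⟩

lemma mk_pPow_eq_zero {n : ℕ} {x : M} :
    (pPow p k M n).mkQ x = 0 ↔ ∃ y, x = (p : BK p k) ^ n • y := by
  rw [← mem_pPow]
  exact Submodule.Quotient.mk_eq_zero _

variable [CharP k p] [PerfectRing k p]

lemma natCast_p_ne_zero : (p : BK p k) ≠ 0 := by
  intro h
  have h1 := congrArg PowerSeries.constantCoeff h
  rw [map_natCast, map_zero] at h1
  exact (WittVector.irreducible p).ne_zero h1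

lemma smul_p_pow_injective [Module.Free (BK p k) M] {n : ℕ} {x y : M}
    (h : (p : BK p k) ^ n • x = (p : BK p k) ^ n • y) : x = y :=
  smul_right_injective M (pow_ne_zero n natCast_p_ne_zero) h

/-- In coordinates, `u` is a prime not dividing `p`, so it divides every coordinate of `y` and can
be cancelled. Hence `M / p ^ n` has no `u`-torsion. -/
lemma exists_eq_X_smul [Module.Free (BK p k) M] {n : ℕ} {x y : M}
    (h : (PowerSeries.X : BK p k) • x = (p : BK p k) ^ n • y) :
    ∃ z : M, x = (p : BK p k) ^ n • z := by
  let b := Module.Free.chooseBasis (BK p k) M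
  have h1 : ∀ i, ∃ c, b.repr y i = PowerSeries.X * c := by
    intro i
    have h2 := DFunLike.congr_fun (congrArg b.repr h) i
    rw [map_smul, map_smul, Finsupp.smul_apply, Finsupp.smul_apply, smul_eq_mul, smul_eq_mul] at h2
    have h3 : (PowerSeries.X : BK p k) ∣ (p : BK p k) ^ n * b.repr y i := ⟨_, h2.symm⟩
    refine (PowerSeries.X_prime.dvd_or_dvd h3).resolve_left fun h4 => ?_
    have h5 := PowerSeries.X_dvd_iff.mp (PowerSeries.X_prime.dvd_of_dvd_pow h4)
    rw [map_natCast] at h5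
    exact (WittVector.irreducible p).ne_zero h5
  choose c hc using h1
  let z := (b.repr y).sum fun i _ => c i • b i
  have hz : y = (PowerSeries.X : BK p k) • z := by
    conv_lhs => rw [← b.linearCombination_repr y, Finsupp.linearCombination_apply]
    rw [Finsupp.smul_sum]
    refine Finset.sum_congr rfl fun i _ => ?_
    change b.repr y i • b i = (PowerSeries.X : BK p k) • c i • b i
    rw [hc, mul_smul]
  refine ⟨z, ?_⟩
  rw [hz, smul_comm] at h
  exact smul_right_injective M (PowerSeries.X_ne_zero (R := WittVector p k)) h

variable (p k M) in
lemma isPTorsion_reduce [Module.Finite (BK p k) M] [Module.Free (BK p k) M] (n : ℕ) :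
    IsPTorsion p k (M ⧸ pPow p k M n) where
  finite := inferInstance
  killed := by
    refine ⟨n, fun x => ?_⟩
    obtain ⟨x, rfl⟩ := (pPow p k M n).mkQ_surjective x
    rw [← map_smul]
    exact mk_pPow_eq_zero.mpr ⟨x, rfl⟩
  noUTorsion := by
    intro x hx
    obtain ⟨x, rfl⟩ := (pPow p k M n).mkQ_surjective x
    rw [← map_smul] at hx
    obtain ⟨y, hy⟩ := mk_pPow_eq_zero.mp hx
    exact mk_pPow_eq_zero.mpr (exists_eq_X_smul hy)

variable {E : (WittVector p k)[X]}

lemma IsPhiHom.reduce {F : KisinStr p k E M} {G : KisinStr p k E N} {f : M →ₗ[BK p k] N}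
    (hf : IsPhiHom F G f) {a b : ℕ} (h : pPow p k M a ≤ (pPow p k N b).comap f) :
    IsPhiHom (F.reduce a) (G.reduce b) (Submodule.mapQ (pPow p k M a) (pPow p k N b) f h) := by
  have h1 : IsPhiHom F (G.reduce b) ((pPow p k N b).mkQ ∘ₗ f) :=
    IsPhiHom.comp (isPhiHom_mkQ G (pPow p k N b) _) hf
  rw [← Submodule.mapQ_mkQ _ _ _ (h := h)] at h1
  exact IsPhiHom.of_comp_surjective (isPhiHom_mkQ F (pPow p k M a) _)
    (Submodule.mkQ_surjective _) h1

lemma pPow_le_comap (f : M →ₗ[BK p k] N) (n : ℕ) :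
    pPow p k M n ≤ (pPow p k N n).comap f := by
  intro x hx
  obtain ⟨y, rfl⟩ := mem_pPow.mp hx
  exact mem_pPow.mpr ⟨f y, map_smul _ _ _⟩

lemma pPow_le_comap_lsmul (a b : ℕ) : pPow p k M a ≤ (pPow p k M (a + b)).comap
    (LinearMap.lsmul (BK p k) M ((p : BK p k) ^ b)) := by
  intro x hx
  obtain ⟨y, rfl⟩ := mem_pPow.mp hx
  refine mem_pPow.mpr ⟨y, ?_⟩
  rw [LinearMap.lsmul_apply, smul_smul, ← pow_add, add_comm]

lemma pPow_le_comap_id (a b : ℕ) :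
    pPow p k M (a + b) ≤ (pPow p k M b).comap (LinearMap.id : M →ₗ[BK p k] M) := by
  intro x hx
  obtain ⟨y, rfl⟩ := mem_pPow.mp hx
  refine mem_pPow.mpr ⟨(p : BK p k) ^ a • y, ?_⟩
  rw [smul_smul, ← pow_add, add_comm]

variable (p k M) in
/-- The injection `p ^ b : M / p ^ a → M / p ^ (a + b)`. -/
noncomputable def redInj (a b : ℕ) :
    (M ⧸ pPow p k M a) →ₗ[BK p k] (M ⧸ pPow p k M (a + b)) :=
  Submodule.mapQ _ _ (LinearMap.lsmul (BK p k) M ((p : BK p k) ^ b)) (pPow_le_comap_lsmul a b)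

variable (p k M) in
/-- The projection `M / p ^ (a + b) → M / p ^ b`. -/
noncomputable def redProj (a b : ℕ) :
    (M ⧸ pPow p k M (a + b)) →ₗ[BK p k] (M ⧸ pPow p k M b) :=
  Submodule.mapQ _ _ LinearMap.id (pPow_le_comap_id a b)

lemma redInj_mk (a b : ℕ) (x : M) : redInj p k M a b ((pPow p k M a).mkQ x)
    = (pPow p k M (a + b)).mkQ ((p : BK p k) ^ b • x) := rfl

lemma redProj_mk (a b : ℕ) (x : M) : redProj p k M a b ((pPow p k M (a + b)).mkQ x)
    = (pPow p k M b).mkQ x := rfl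

lemma redInj_injective [Module.Free (BK p k) M] (a b : ℕ) :
    Function.Injective (redInj p k M a b) := by
  rw [← LinearMap.ker_eq_bot, LinearMap.ker_eq_bot']
  intro x hx
  obtain ⟨x, rfl⟩ := (pPow p k M a).mkQ_surjective x
  rw [redInj_mk] at hx
  obtain ⟨y, hy⟩ := mk_pPow_eq_zero.mp hx
  rw [add_comm, pow_add, mul_smul] at hy
  exact mk_pPow_eq_zero.mpr ⟨y, smul_p_pow_injective hy⟩

lemma redProj_surjective (a b : ℕ) : Function.Surjective (redProj p k M a b) := by
  intro x
  obtain ⟨x, rfl⟩ := (pPow p k M b).mkQ_surjective x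
  exact ⟨(pPow p k M (a + b)).mkQ x, rfl⟩

lemma ker_redProj (a b : ℕ) :
    LinearMap.ker (redProj p k M a b) = LinearMap.range (redInj p k M a b) := by
  ext x
  obtain ⟨x, rfl⟩ := (pPow p k M (a + b)).mkQ_surjective x
  rw [LinearMap.mem_ker, redProj_mk, mk_pPow_eq_zero]
  constructor
  · rintro ⟨y, rfl⟩
    exact ⟨(pPow p k M a).mkQ y, rfl⟩
  · rintro ⟨y, hy⟩
    obtain ⟨y, rfl⟩ := (pPow p k M a).mkQ_surjective y
    rw [redInj_mk, ← sub_eq_zero, ← map_sub] at hy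
    obtain ⟨z, hz⟩ := mk_pPow_eq_zero.mp hy
    rw [sub_eq_iff_eq_add, ← sub_eq_iff_eq_add'] at hz
    refine ⟨y - (p : BK p k) ^ a • z, ?_⟩
    rw [← hz, smul_sub, smul_smul, ← pow_add, add_comm b a]

/-- An element of `M / p ^ (a + b)` killed by `p ^ b` lies in the image of `M / p ^ b`. -/
lemma mem_range_redInj_of_smul_eq_zero [Module.Free (BK p k) M] {a b : ℕ}
    {x : M ⧸ pPow p k M (a + b)} (hx : (p : BK p k) ^ a • x = 0) :
    x ∈ LinearMap.range (redInj p k M a b) := by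
  obtain ⟨x, rfl⟩ := (pPow p k M (a + b)).mkQ_surjective x
  rw [← map_smul] at hx
  obtain ⟨y, hy⟩ := mk_pPow_eq_zero.mp hx
  rw [pow_add, mul_smul] at hy
  exact ⟨(pPow p k M a).mkQ y, by rw [redInj_mk, smul_p_pow_injective hy]⟩

lemma isPhiHom_redInj (F : KisinStr p k E M) (a b : ℕ) :
    IsPhiHom (F.reduce a) (F.reduce (a + b)) (redInj p k M a b) :=
  (isPhiHom_lsmul F (phi_natCast_pow p k b)).reduce _

lemma IsPhiHom.id (F : KisinStr p k E M) : IsPhiHom F F LinearMap.id := by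
  have h := isPhiHom_lsmul F (map_one (phi p k))
  have h1 : LinearMap.lsmul (BK p k) M 1 = LinearMap.id := by ext; simp
  rwa [h1] at h

lemma isPhiHom_redProj (F : KisinStr p k E M) (a b : ℕ) :
    IsPhiHom (F.reduce (a + b)) (F.reduce b) (redProj p k M a b) :=
  (IsPhiHom.id F).reduce _

end Reduction

/-! ### Subadditivity of the polygons of `M / p ^ n` -/

section PolygonsOfReductions

variable {p : ℕ} [hp : Fact p.Prime] {k : Type u} [Field k] [CharP k p] [PerfectRing k p]
  {E : (WittVector p k)[X]} [hE : IsUniformizerPoly p k E]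
  {M : Type v} [AddCommGroup M] [Module (BK p k) M] [Module.Finite (BK p k) M]
  [Module.Free (BK p k) M]

lemma exists_eq_p_smul_add_X_smul {ι : Type*} [Finite ι] (b : Module.Basis ι (BK p k) M) {x : M}
    (h : ∀ i, residueMap p k (b.repr x i) = 0) :
    ∃ y z : M, x = (p : BK p k) • y + (PowerSeries.X : BK p k) • z := by
  have := Fintype.ofFinite ι
  choose c d hcd using fun i => mem_ker_residueMap p k (h i)
  refine ⟨∑ i, c i • b i, ∑ i, d i • b i, ?_⟩
  rw [Finset.smul_sum, Finset.smul_sum, ← Finset.sum_add_distrib]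
  conv_lhs => rw [← b.sum_repr x]
  refine Finset.sum_congr rfl fun i _ => ?_
  rw [hcd, add_smul, mul_smul, mul_smul]

-- The quotient of `M / p` by `u` is `M` modulo the maximal ideal, a `k`-vector space with the
-- coordinates of a basis.
variable (p k M) in
lemma rho_reduce_one :
    rho (⊤ : Submodule (BK p k) (M ⧸ pPow p k M 1)) = Module.finrank (BK p k) M := by
  let b := Module.Free.chooseBasis (BK p k) M
  let : Algebra (BK p k) k := (residueMap p k).toAlgebra
  let g : M →ₗ[BK p k] (Module.Free.ChooseBasisIndex (BK p k) M → k) :=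
    LinearMap.pi fun i => (Algebra.linearMap (BK p k) k) ∘ₗ (b.coord i)
  have hg : ∀ x i, g x i = residueMap p k (b.repr x i) := fun _ _ => rfl
  have hgs : Function.Surjective g := by
    intro y
    choose a ha using fun i => residueMap_surjective p k (y i)
    refine ⟨∑ i, a i • b i, funext fun i => ?_⟩
    rw [hg, b.repr_sum_self, ha]
  have hlen : Module.length (BK p k) (Module.Free.ChooseBasisIndex (BK p k) M → k)
      = Module.finrank (BK p k) M := by
    have h1 : Module.length (BK p k) k = 1 := by
      rw [Module.length_eq_of_surjective (R := k) (residueMap_surjective p k), Module.length_eq_one]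
    rw [Module.length_pi, h1, mul_one, Module.finrank_eq_card_chooseBasisIndex,
      ENat.card_eq_coe_fintype_card]
  have hmap : uMul (⊤ : Submodule (BK p k) (M ⧸ pPow p k M 1))
      = (LinearMap.ker g).map (pPow p k M 1).mkQ := by
    apply le_antisymm
    · rintro _ ⟨x, -, rfl⟩
      obtain ⟨x, rfl⟩ := (pPow p k M 1).mkQ_surjective x
      refine ⟨(PowerSeries.X : BK p k) • x, funext fun i => ?_, rfl⟩
      rw [hg, map_smul, Finsupp.smul_apply, smul_eq_mul, map_mul]
      simp [residueMap]
    · rintro _ ⟨x, hx, rfl⟩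
      obtain ⟨y, z, rfl⟩ := exists_eq_p_smul_add_X_smul b (fun i => congrFun hx i)
      refine ⟨(pPow p k M 1).mkQ z, trivial, ?_⟩
      have h1 : (pPow p k M 1).mkQ ((p : BK p k) • y) = 0 :=
        mk_pPow_eq_zero.mpr ⟨y, by rw [pow_one]⟩
      rw [map_add, h1, zero_add, map_smul]
      rfl
  have h2 := relLength_map (pPow p k M 1).mkQ (a := LinearMap.ker g) (b := ⊤) le_top (by
    rw [Submodule.ker_mkQ, inf_top_eq]
    intro x hx
    obtain ⟨y, rfl⟩ := mem_pPow.mp hx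
    refine funext fun i => ?_
    rw [hg, map_smul, Finsupp.smul_apply, smul_eq_mul, map_mul, pow_one, map_natCast,
      CharP.cast_eq_zero, zero_mul]
    rfl)
  rw [← hmap, Submodule.map_top, Submodule.range_mkQ, relLength_top,
    relLength_top, (g.quotKerEquivOfSurjective hgs).length_eq, hlen] at h2
  rw [rho, relLength_top, h2, ENat.toNat_natCast]

lemma map_comap_redInj (a b : ℕ) (N : Submodule (BK p k) (M ⧸ pPow p k M (a + b))) :
    (N.comap (redInj p k M a b)).map (redInj p k M a b)
      = N ⊓ LinearMap.ker (redProj p k M a b) := by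
  rw [Submodule.map_comap_eq, ker_redProj, inf_comm]

lemma rho_eq_comap_add_map (a b : ℕ) (N : Submodule (BK p k) (M ⧸ pPow p k M (a + b))) :
    rho N = rho (N.comap (redInj p k M a b)) + rho (N.map (redProj p k M a b)) := by
  rw [(isPTorsion_reduce p k M (a + b)).rho_eq_add_map (isPTorsion_reduce p k M b)
    (redProj p k M a b), ← map_comap_redInj, (isPTorsion_reduce p k M a).rho_map_of_injective
    (isPTorsion_reduce p k M (a + b)) (redInj_injective a b)]

variable (p k M) in
lemma rho_reduce (n : ℕ) :
    rho (⊤ : Submodule (BK p k) (M ⧸ pPow p k M n)) = n * Module.finrank (BK p k) M := by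
  induction n with
  | zero =>
    have h : (⊤ : Submodule (BK p k) (M ⧸ pPow p k M 0)) = ⊥ := by
      rw [eq_bot_iff]
      rintro x -
      obtain ⟨x, rfl⟩ := (pPow p k M 0).mkQ_surjective x
      exact mk_pPow_eq_zero.mpr ⟨x, by simp⟩
    rw [h, rho_bot, zero_mul]
  | succ n ih =>
    rw [rho_eq_comap_add_map, Submodule.comap_top, ih, Submodule.map_top, LinearMap.range_eq_top.mpr
      (redProj_surjective n 1), rho_reduce_one, add_mul, one_mul]

section

variable {F : KisinStr p k E M} {a b i : ℕ}
  {ψ : (M ⧸ pPow p k M (a + b)) →ₛₗ[phi p k] (M ⧸ pPow p k M (a + b))}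
  {ψa : (M ⧸ pPow p k M a) →ₛₗ[phi p k] (M ⧸ pPow p k M a)}
  {ψb : (M ⧸ pPow p k M b) →ₛₗ[phi p k] (M ⧸ pPow p k M b)}

/-- Additivity along `0 → M / p ^ a → M / p ^ (a + b) → M / p ^ b → 0`. All three effective maps use
the same exponent `i`. -/
lemma effDegree_eq_comap_add_map (h : IsEff (F.reduce (a + b)) i ψ) (ha : IsEff (F.reduce a) i ψa)
    (hb : IsEff (F.reduce b) i ψb) {N : Submodule (BK p k) (M ⧸ pPow p k M (a + b))}
    (hN : Invariant ψ N) :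
    effDegree E ψ i N = effDegree E ψa i (N.comap (redInj p k M a b))
      + effDegree E ψb i (N.map (redProj p k M a b)) := by
  have hT := isPTorsion_reduce p k M (a + b)
  have hTa := isPTorsion_reduce p k M a
  have hTb := isPTorsion_reduce p k M b
  have hca := IsEff.comm hT (isPhiHom_redInj F a b) ha h
  have hcb := IsEff.comm hTb (isPhiHom_redProj F a b) h hb
  have hd : delta ψ N = delta ψa (N.comap (redInj p k M a b))
      + delta ψb (N.map (redProj p k M a b)) := by
    rw [hT.delta_eq_add_map hTb (h.frobInj hT) (hb.frobInj hTb) hcb hN, ← map_comap_redInj,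
      hTa.delta_map_of_injective hT (ha.frobInj hTa) (h.frobInj hT) hca (redInj_injective a b)
        (hN.comap hca)]
  simp only [effDegree]
  rw [hd, rho_eq_comap_add_map a b N, ← add_div]
  push_cast
  ring

end

lemma concaveOn_hnPolygon_reduce (F : KisinStr p k E M) (n : ℕ) :
    ConcaveOn ℝ (Set.Icc (0 : ℝ) (n * Module.finrank (BK p k) M : ℕ)) (hnPolygon (F.reduce n)) := by
  have hT := isPTorsion_reduce p k M n
  obtain ⟨i, hi⟩ := exists_isEff E hT (F.reduce n)
  obtain ⟨ψ, h⟩ := hi i le_rfl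
  rw [← rho_reduce p k M]
  exact (h.isHNPolygon hT).concaveOn

lemma hnPolygon_reduce_zero (F : KisinStr p k E M) (n : ℕ) : hnPolygon (F.reduce n) 0 = 0 := by
  have hT := isPTorsion_reduce p k M n
  obtain ⟨i, hi⟩ := exists_isEff E hT (F.reduce n)
  obtain ⟨ψ, h⟩ := hi i le_rfl
  exact (h.isHNPolygon hT).zero

lemma exists_isEff_reduce_add (F : KisinStr p k E M) (a b : ℕ) :
    ∃ i ψ ψa ψb, IsEff (F.reduce (a + b)) i ψ ∧ IsEff (F.reduce a) i ψa ∧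
      IsEff (F.reduce b) i ψb := by
  obtain ⟨i, hi⟩ := exists_isEff E (isPTorsion_reduce p k M (a + b)) (F.reduce (a + b))
  obtain ⟨ia, hia⟩ := exists_isEff E (isPTorsion_reduce p k M a) (F.reduce a)
  obtain ⟨ib, hib⟩ := exists_isEff E (isPTorsion_reduce p k M b) (F.reduce b)
  obtain ⟨ψ, h⟩ := hi (i + ia + ib) (by omega)
  obtain ⟨ψa, ha⟩ := hia (i + ia + ib) (by omega)
  obtain ⟨ψb, hb⟩ := hib (i + ia + ib) (by omega)
  exact ⟨_, ψ, ψa, ψb, h, ha, hb⟩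

lemma IsPTorsion.rho_mem_Icc {T : Type*} [AddCommGroup T] [Module (BK p k) T]
    (hT : IsPTorsion p k T) (N : Submodule (BK p k) T) :
    (rho N : ℝ) ∈ Set.Icc (0 : ℝ) (rho (⊤ : Submodule (BK p k) T)) :=
  ⟨Nat.cast_nonneg _, Nat.cast_le.mpr (hT.rho_mono le_top)⟩

/-- Each stable submodule is cut into a part in `M / p ^ a` and a part in `M / p ^ b`, whose degrees
lie below the two polygons. So `g` dominates all points `(rank, degree)`, and the polygon is the
least concave function that does. -/
lemma hnPolygon_reduce_add_le (F : KisinStr p k E M) (a b : ℕ) {g : ℝ → ℝ}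
    (hg : ConcaveOn ℝ (Set.Icc (0 : ℝ) ((a + b) * Module.finrank (BK p k) M : ℕ)) g)
    (h : ∀ x ∈ Set.Icc (0 : ℝ) (a * Module.finrank (BK p k) M : ℕ),
      ∀ y ∈ Set.Icc (0 : ℝ) (b * Module.finrank (BK p k) M : ℕ),
      hnPolygon (F.reduce a) x + hnPolygon (F.reduce b) y ≤ g (x + y)) :
    ∀ x ∈ Set.Icc (0 : ℝ) ((a + b) * Module.finrank (BK p k) M : ℕ),
      hnPolygon (F.reduce (a + b)) x ≤ g x := by
  have hT := isPTorsion_reduce p k M (a + b)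
  have hTa := isPTorsion_reduce p k M a
  have hTb := isPTorsion_reduce p k M b
  obtain ⟨i, ψ, ψa, ψb, hψ, hψa, hψb⟩ := exists_isEff_reduce_add F a b
  have hca := IsEff.comm hT (isPhiHom_redInj F a b) hψa hψ
  have hcb := IsEff.comm hTb (isPhiHom_redProj F a b) hψ hψb
  rw [← rho_reduce p k M] at hg ⊢
  refine (hψ.isHNPolygon hT).least g hg fun N hN => ?_
  rw [effDegree_eq_comap_add_map hψ hψa hψb hN, rho_eq_comap_add_map a b N, Nat.cast_add]
  rw [← rho_reduce p k M, ← rho_reduce p k M] at h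
  exact (add_le_add ((hψa.isHNPolygon hTa).le _ (hN.comap hca))
    ((hψb.isHNPolygon hTb).le _ (hN.map hcb))).trans (h _ (hTa.rho_mem_Icc _) _ (hTb.rho_mem_Icc _))

lemma hnPolygon_reduce_last_add (F : KisinStr p k E M) (a b : ℕ) :
    hnPolygon (F.reduce (a + b)) ((a + b) * Module.finrank (BK p k) M : ℕ)
      = hnPolygon (F.reduce a) (a * Module.finrank (BK p k) M : ℕ)
        + hnPolygon (F.reduce b) (b * Module.finrank (BK p k) M : ℕ) := by
  obtain ⟨i, ψ, ψa, ψb, hψ, hψa, hψb⟩ := exists_isEff_reduce_add F a b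
  rw [← rho_reduce p k M, ← rho_reduce p k M, ← rho_reduce p k M,
    (hψ.isHNPolygon (isPTorsion_reduce p k M _)).last,
    (hψa.isHNPolygon (isPTorsion_reduce p k M _)).last,
    (hψb.isHNPolygon (isPTorsion_reduce p k M _)).last,
    effDegree_eq_comap_add_map hψ hψa hψb invariant_top, Submodule.comap_top, Submodule.map_top,
    LinearMap.range_eq_top.mpr (redProj_surjective a b)]

lemma hnPolygon_reduce_last (F : KisinStr p k E M) (n : ℕ) :
    hnPolygon (F.reduce n) (n * Module.finrank (BK p k) M : ℕ) = n * torsionDegree (F.reduce 1) := by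
  induction n with
  | zero => simp [hnPolygon_reduce_zero]
  | succ n ih =>
    have hT := isPTorsion_reduce p k M 1
    obtain ⟨i, hi⟩ := exists_isEff E hT (F.reduce 1)
    obtain ⟨ψ, h⟩ := hi i le_rfl
    have h1 := (h.isHNPolygon hT).last
    rw [rho_reduce] at h1
    rw [hnPolygon_reduce_last_add, ih, h1, effDegree, torsionDegree, h.rawDegree_eq hT]
    push_cast
    ring

/-- Induction on `m`, splitting off one copy of `M / p ^ n`. With `h` its polygon, the majorant is
`(m + 2) h(x / (m + 2))`, and the required inequality is concavity of `h` with weights `(m + 1) / (m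
+ 2)` and `1 / (m + 2)`. -/
lemma hnPolygon_reduce_mul_le (F : KisinStr p k E M) (n m : ℕ) :
    ∀ x ∈ Set.Icc (0 : ℝ) ((n * (m + 1)) * Module.finrank (BK p k) M : ℕ),
      hnPolygon (F.reduce (n * (m + 1))) x
        ≤ (m + 1) * hnPolygon (F.reduce n) (x / (m + 1)) := by
  induction m with
  | zero =>
    intro x hx
    rw [zero_add, mul_one] at *
    simp
  | succ m ih =>
    have hm : (0 : ℝ) < m + 1 := by positivity
    have hc := concaveOn_hnPolygon_reduce F n
    have hmem : ∀ c : ℝ, 0 < c → ∀ x, x ∈ Set.Icc (0 : ℝ) (c * (n * Module.finrank (BK p k) M : ℕ)) →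
        x / c ∈ Set.Icc (0 : ℝ) (n * Module.finrank (BK p k) M : ℕ) := fun c hc x hx =>
      ⟨div_nonneg hx.1 hc.le, (div_le_iff₀' hc).mpr hx.2⟩
    rw [show n * (m + 1 + 1) = n * (m + 1) + n by ring]
    refine hnPolygon_reduce_add_le F (n * (m + 1)) n ?_ ?_
    · refine ⟨convex_Icc _ _, fun x hx y hy s t hs ht hst => ?_⟩
      have hm2 : (0 : ℝ) < (m + 1 : ℕ) + 1 := by positivity
      have hb : (((n * (m + 1) + n) * Module.finrank (BK p k) M : ℕ) : ℝ)
          = ((m + 1 : ℕ) + 1) * (n * Module.finrank (BK p k) M : ℕ) := by push_cast; ring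
      rw [hb] at hx hy
      have h1 := hc.2 (hmem _ hm2 x hx) (hmem _ hm2 y hy) hs ht hst
      have h2 := mul_le_mul_of_nonneg_left h1 hm2.le
      simp only [smul_eq_mul] at h2 ⊢
      have h3 : (s * x + t * y) / ((m + 1 : ℕ) + 1 : ℝ)
          = s * (x / ((m + 1 : ℕ) + 1)) + t * (y / ((m + 1 : ℕ) + 1)) := by ring
      rw [h3]
      linarith
    · intro x hx y hy
      have hb : (((n * (m + 1)) * Module.finrank (BK p k) M : ℕ) : ℝ)
          = (m + 1) * (n * Module.finrank (BK p k) M : ℕ) := by push_cast; ring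
      refine (add_le_add_left (ih x hx) _).trans ?_
      rw [hb] at hx
      have hm2 : (0 : ℝ) < m + 2 := by positivity
      have h1 := hc.2 (hmem _ hm x hx) hy (by positivity : (0 : ℝ) ≤ (m + 1) / (m + 2))
        (by positivity : (0 : ℝ) ≤ 1 / (m + 2)) (by field_simp; ring)
      have h2 := mul_le_mul_of_nonneg_left h1 hm2.le
      simp only [smul_eq_mul] at h2
      have h3 : (m + 1 : ℝ) / (m + 2) * (x / (m + 1)) + 1 / (m + 2) * y = (x + y) / (m + 2) := by
        field_simp
      rw [h3] at h2
      have h4 : ((m + 1 : ℕ) : ℝ) + 1 = m + 2 := by push_cast; ring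
      rw [h4]
      refine le_trans (le_of_eq ?_) h2
      field_simp

lemma isDivDecreasing_renormPolygon (F : KisinStr p k E M) {C : ℝ}
    (hC : ∀ x y : ℝ, |hnPolygon (F.reduce 1) x - hnPolygon (F.reduce 1) y| ≤ C * |x - y|) :
    IsDivDecreasing (renormPolygon F) (Module.finrank (BK p k) M) (torsionDegree (F.reduce 1)) C where
  nonneg := Nat.cast_nonneg _
  concaveOn n hn := by
    have hn' : (0 : ℝ) < n := Nat.cast_pos.mpr hn
    have hc := concaveOn_hnPolygon_reduce F n
    have hmem : ∀ x ∈ Set.Icc (0 : ℝ) (Module.finrank (BK p k) M),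
        n * x ∈ Set.Icc (0 : ℝ) (n * Module.finrank (BK p k) M : ℕ) := fun x hx =>
      ⟨mul_nonneg hn'.le hx.1, by push_cast; exact mul_le_mul_of_nonneg_left hx.2 hn'.le⟩
    refine ⟨convex_Icc _ _, fun x hx y hy s t hs ht hst => ?_⟩
    have h1 := hc.2 (hmem x hx) (hmem y hy) hs ht hst
    simp only [smul_eq_mul, renormPolygon] at h1 ⊢
    have h2 := mul_le_mul_of_nonneg_left h1 (one_div_pos.mpr hn').le
    have h3 : (n : ℝ) * (s * x + t * y) = s * (n * x) + t * (n * y) := by ring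
    rw [h3]
    linarith
  zero n hn := by rw [renormPolygon, mul_zero, hnPolygon_reduce_zero, mul_zero]
  last n hn := by
    have hn' : (n : ℝ) ≠ 0 := Nat.cast_ne_zero.mpr (by omega)
    have h := hnPolygon_reduce_last F n
    rw [Nat.cast_mul] at h
    rw [renormPolygon, h]
    field_simp
  mul_le n m hn hm x hx := by
    obtain ⟨m, rfl⟩ := Nat.exists_eq_add_of_le' hm
    have hn' : (0 : ℝ) < n := Nat.cast_pos.mpr hn
    have h := hnPolygon_reduce_mul_le F n m ((n * (m + 1) : ℕ) * x) ⟨by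
      have := hx.1
      positivity, by
      rw [Nat.cast_mul (n * (m + 1))]
      exact mul_le_mul_of_nonneg_left hx.2 (Nat.cast_nonneg _)⟩
    have h1 : ((n * (m + 1) : ℕ) : ℝ) * x / (m + 1) = n * x := by
      push_cast
      field_simp
    rw [h1] at h
    simp only [renormPolygon]
    have h2 := mul_le_mul_of_nonneg_left h
      (by positivity : (0 : ℝ) ≤ 1 / ((n * (m + 1) : ℕ) : ℝ))
    refine h2.trans (le_of_eq ?_)
    push_cast
    field_simp
  lipschitz_one x _ y _ := by simpa [renormPolygon] using hC x y

end PolygonsOfReductions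

/-! ### Invariance under isogeny -/

section Isogenies

variable {p : ℕ} [hp : Fact p.Prime] {k : Type u} [Field k] [CharP k p] [PerfectRing k p]
  {E : (WittVector p k)[X]} [hE : IsUniformizerPoly p k E]
  {M : Type v} [AddCommGroup M] [Module (BK p k) M] [Module.Finite (BK p k) M]
  [Module.Free (BK p k) M] {M' : Type w} [AddCommGroup M'] [Module (BK p k) M']
  [Module.Finite (BK p k) M'] [Module.Free (BK p k) M']

lemma finrank_le_of_comp_eq_smul {f : M →ₗ[BK p k] M'} {g : M' →ₗ[BK p k] M} {c : ℕ}
    (hfg : ∀ x, g (f x) = (p : BK p k) ^ c • x) :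
    Module.finrank (BK p k) M ≤ Module.finrank (BK p k) M' := by
  refine LinearMap.finrank_le_finrank_of_injective (f := f) fun x y hxy => ?_
  have h := congrArg g hxy
  rw [hfg, hfg] at h
  exact smul_p_pow_injective h

/-- For `c ≤ n` the `p ^ c`-torsion of `M / p ^ n` is a copy of `M / p ^ c`; for `n ≤ c` the whole
module is small enough. The bound is independent of `n`. -/
lemma rho_le_of_smul_eq_zero {n c : ℕ} {K : Submodule (BK p k) (M ⧸ pPow p k M n)}
    (hK : ∀ x ∈ K, (p : BK p k) ^ c • x = 0) : rho K ≤ c * Module.finrank (BK p k) M := by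
  rcases le_total n c with h | h
  · refine ((isPTorsion_reduce p k M n).rho_mono le_top).trans ?_
    rw [rho_reduce]
    exact Nat.mul_le_mul_right _ h
  · obtain ⟨b, rfl⟩ := Nat.exists_eq_add_of_le h
    have h1 := (isPTorsion_reduce p k M (c + b)).rho_mono (N := K)
      (N' := LinearMap.range (redInj p k M c b)) fun x hx =>
        mem_range_redInj_of_smul_eq_zero (hK x hx)
    rwa [← Submodule.map_top, (isPTorsion_reduce p k M c).rho_map_of_injective
      (isPTorsion_reduce p k M (c + b)) (redInj_injective c b), rho_reduce] at h1

/-- A stable `N` splits into `N ∩ ker q` and its image in `M' / p ^ n`. The first is killed by `p ^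
c`, so its rank is at most `c r` and its degree at most `C c r`. The image has rank smaller than `N`
by that same amount, which costs at most `C' c r` on the second polygon. -/
lemma hnPolygon_reduce_le_of_isogeny {F : KisinStr p k E M} {F' : KisinStr p k E M'}
    {f : M →ₗ[BK p k] M'} {g : M' →ₗ[BK p k] M} {c n : ℕ} (hf : IsPhiHom F F' f)
    (hfg : ∀ x, g (f x) = (p : BK p k) ^ c • x)
    (hr : Module.finrank (BK p k) M' = Module.finrank (BK p k) M) {C C' : ℝ} (hC0 : 0 ≤ C)
    (hC0' : 0 ≤ C')
    (hC : ∀ x ∈ Set.Icc (0 : ℝ) (n * Module.finrank (BK p k) M : ℕ),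
      hnPolygon (F.reduce n) x ≤ C * x)
    (hC' : ∀ x ∈ Set.Icc (0 : ℝ) (n * Module.finrank (BK p k) M : ℕ),
      ∀ y ∈ Set.Icc (0 : ℝ) (n * Module.finrank (BK p k) M : ℕ), x ≤ y →
      hnPolygon (F'.reduce n) x ≤ hnPolygon (F'.reduce n) y + C' * (y - x)) :
    ∀ x ∈ Set.Icc (0 : ℝ) (n * Module.finrank (BK p k) M : ℕ),
      hnPolygon (F.reduce n) x ≤ hnPolygon (F'.reduce n) x
        + (C + C') * (c * Module.finrank (BK p k) M : ℕ) := by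
  have hT := isPTorsion_reduce p k M n
  have hT' := isPTorsion_reduce p k M' n
  obtain ⟨i, hi⟩ := exists_isEff E hT (F.reduce n)
  obtain ⟨i', hi'⟩ := exists_isEff E hT' (F'.reduce n)
  obtain ⟨ψ, h⟩ := hi (i + i') (by omega)
  obtain ⟨ψ', h'⟩ := hi' (i + i') (by omega)
  let q : (M ⧸ pPow p k M n) →ₗ[BK p k] (M' ⧸ pPow p k M' n) :=
    Submodule.mapQ _ _ f (pPow_le_comap f n)
  let q' : (M' ⧸ pPow p k M' n) →ₗ[BK p k] (M ⧸ pPow p k M n) :=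
    Submodule.mapQ _ _ g (pPow_le_comap g n)
  have hqq : ∀ x, q' (q x) = (p : BK p k) ^ c • x := by
    intro x
    obtain ⟨x, rfl⟩ := (pPow p k M n).mkQ_surjective x
    change (pPow p k M n).mkQ (g (f x)) = _
    rw [hfg, map_smul]
  have hq : ∀ x, q (ψ x) = ψ' (q x) := IsEff.comm hT' (hf.reduce (pPow_le_comap f n)) h h'
  have htop := rho_reduce p k M n
  have htop' := rho_reduce p k M' n
  rw [hr, ← htop] at htop'
  have hcast : ((n * Module.finrank (BK p k) M : ℕ) : ℝ)
      = (rho (⊤ : Submodule (BK p k) (M ⧸ pPow p k M n)) : ℝ) := by rw [htop]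
  rw [hcast] at hC hC' ⊢
  have hconc := (h'.isHNPolygon hT').concaveOn
  rw [htop'] at hconc
  refine (h.isHNPolygon hT).least (fun x => hnPolygon (F'.reduce n) x
        + (C + C') * (c * Module.finrank (BK p k) M : ℕ)) ?_ fun N hN => ?_
  · exact hconc.add_const _
  · have hK : Invariant ψ (N ⊓ LinearMap.ker q) := hN.inf (invariant_ker hq)
    have hρK : rho (N ⊓ LinearMap.ker q) ≤ c * Module.finrank (BK p k) M :=
      rho_le_of_smul_eq_zero fun x hx => by
        rw [← hqq, LinearMap.mem_ker.mp hx.2, map_zero]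
    have hρ := hT.rho_eq_add_map hT' q N
    have hδ := hT.delta_eq_add_map hT' (h.frobInj hT) (h'.frobInj hT') hq hN
    have hdeg : effDegree E ψ (i + i') N = effDegree E ψ (i + i') (N ⊓ LinearMap.ker q)
        + effDegree E ψ' (i + i') (N.map q) := by
      simp only [effDegree]
      rw [hδ, hρ, ← add_div]
      push_cast
      ring
    have h1 := ((h.isHNPolygon hT).le _ hK).trans (hC _ (hT.rho_mem_Icc _))
    have h2 := (h'.isHNPolygon hT').le _ (hN.map hq)
    have hmem : (rho (N.map q) : ℝ) ∈ Set.Icc (0 : ℝ)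
        (rho (⊤ : Submodule (BK p k) (M ⧸ pPow p k M n))) := by
      rw [← htop']
      exact hT'.rho_mem_Icc _
    have hle : (rho (N.map q) : ℝ) ≤ rho N := by exact_mod_cast hρ ▸ Nat.le_add_left _ _
    have h3 := hC' _ hmem _ (hT.rho_mem_Icc N) hle
    have h4 : (rho N : ℝ) - rho (N.map q) = rho (N ⊓ LinearMap.ker q) := by
      rw [hρ]
      push_cast
      ring
    have h5 : ((rho (N ⊓ LinearMap.ker q) : ℕ) : ℝ) ≤ (c * Module.finrank (BK p k) M : ℕ) :=
      Nat.cast_le.mpr hρK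
    have h6 := mul_le_mul_of_nonneg_left h5 hC0
    have h7 := mul_le_mul_of_nonneg_left h5 hC0'
    rw [h4] at h3
    rw [hdeg]
    linarith

/-- The Lipschitz constants for `n = 1` serve every rescaled polygon, so the error before rescaling
is bounded in `n` and vanishes in the limit. Exchanging `f` and `g` gives the opposite inequality.
-/
lemma farguesPolygon_le_of_isogeny {F : KisinStr p k E M} {F' : KisinStr p k E M'}
    {f : M →ₗ[BK p k] M'} {g : M' →ₗ[BK p k] M} {c : ℕ} (hf : IsPhiHom F F' f)
    (hfg : ∀ x, g (f x) = (p : BK p k) ^ c • x)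
    (hr : Module.finrank (BK p k) M' = Module.finrank (BK p k) M) {x : ℝ}
    (hx : x ∈ Set.Icc (0 : ℝ) (Module.finrank (BK p k) M)) :
    farguesPolygon F x ≤ farguesPolygon F' x := by
  obtain ⟨C, hC0, hC⟩ := (isPTorsion_reduce p k M 1).exists_lipschitz_hnPolygon (F.reduce 1)
  obtain ⟨C', hC0', hC'⟩ := (isPTorsion_reduce p k M' 1).exists_lipschitz_hnPolygon (F'.reduce 1)
  have h := isDivDecreasing_renormPolygon F hC
  have h' := isDivDecreasing_renormPolygon F' hC'
  rw [hr] at h'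
  refine h.iInf_le_iInf h' hx (B := (C + C') * (c * Module.finrank (BK p k) M : ℕ)) fun n hn => ?_
  have hn' : (0 : ℝ) < n := Nat.cast_pos.mpr hn
  have hmem : ∀ y ∈ Set.Icc (0 : ℝ) (n * Module.finrank (BK p k) M : ℕ),
      y / n ∈ Set.Icc (0 : ℝ) (Module.finrank (BK p k) M) := fun y hy =>
    ⟨div_nonneg hy.1 hn'.le, (div_le_iff₀' hn').mpr (by exact_mod_cast hy.2)⟩
  have hval : ∀ y, hnPolygon (F.reduce n) y = n * renormPolygon F n (y / n) := fun y => by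
    rw [renormPolygon, mul_div_cancel₀ _ hn'.ne']
    field_simp
  have hval' : ∀ y, hnPolygon (F'.reduce n) y = n * renormPolygon F' n (y / n) := fun y => by
    rw [renormPolygon, mul_div_cancel₀ _ hn'.ne']
    field_simp
  have key := hnPolygon_reduce_le_of_isogeny (n := n) hf hfg hr hC0 hC0' (fun y hy => by
      have h1 := (abs_le.mp (h.lipschitz hn (hmem y hy) ⟨le_rfl, h.nonneg⟩)).2
      rw [h.zero n hn, sub_zero, sub_zero, abs_of_nonneg (hmem y hy).1] at h1
      have h2 := mul_le_mul_of_nonneg_left h1 hn'.le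
      rw [hval]
      refine h2.trans (le_of_eq ?_)
      field_simp) (fun y hy z hz hyz => by
      have h1 := (abs_le.mp (h'.lipschitz hn (hmem y hy) (hmem z hz))).2
      have h0 : y / n ≤ z / n := div_le_div_of_nonneg_right hyz hn'.le
      rw [abs_sub_comm, abs_of_nonneg (sub_nonneg.mpr h0)] at h1
      have h2 := mul_le_mul_of_nonneg_left h1 hn'.le
      rw [hval', hval']
      have h3 : (n : ℝ) * (C' * (z / n - y / n)) = C' * (z - y) := by field_simp
      linarith) (n * x) ⟨mul_nonneg hn'.le hx.1, by
        push_cast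
        exact mul_le_mul_of_nonneg_left hx.2 hn'.le⟩
  have h2 := mul_le_mul_of_nonneg_left key (one_div_pos.mpr hn').le
  simp only [renormPolygon]
  refine h2.trans (le_of_eq ?_)
  ring

lemma IsIsogenous.finrank_eq {F : KisinStr p k E M} {F' : KisinStr p k E M'}
    (h : IsIsogenous F F') : Module.finrank (BK p k) M' = Module.finrank (BK p k) M := by
  obtain ⟨f, g, c, -, -, hgf, hfg⟩ := h
  exact le_antisymm (finrank_le_of_comp_eq_smul hfg) (finrank_le_of_comp_eq_smul hgf)

lemma IsIsogenous.farguesPolygon_eq {F : KisinStr p k E M} {F' : KisinStr p k E M'}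
    (h : IsIsogenous F F') {x : ℝ} (hx : x ∈ Set.Icc (0 : ℝ) (Module.finrank (BK p k) M)) :
    farguesPolygon F' x = farguesPolygon F x := by
  have hr := h.finrank_eq
  obtain ⟨f, g, c, hf, hg, hgf, hfg⟩ := h
  exact le_antisymm (farguesPolygon_le_of_isogeny hg hfg hr.symm (hr ▸ hx))
    (farguesPolygon_le_of_isogeny hf hgf hr hx)

end Isogenies

/-! ### Smith normal form, cokernels and determinants -/

section Determinants

variable {O : Type*} [CommRing O] [IsDomain O] [IsPrincipalIdealRing O] {L : Type*} [AddCommGroup L]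
  [Module O L] {ι : Type*} [Fintype ι] [DecidableEq ι]

lemma injective_of_det_ne_zero (b : Module.Basis ι O L) {g : L →ₗ[O] L}
    (h : LinearMap.det g ≠ 0) : Function.Injective g := by
  rw [← LinearMap.ker_eq_bot, LinearMap.ker_eq_bot']
  intro x hx
  rw [← LinearMap.det_toMatrix b] at h
  have h1 := LinearMap.toMatrix_mulVec_repr b b g x
  rw [hx, map_zero] at h1
  have h2 := Matrix.eq_zero_of_mulVec_eq_zero h h1
  exact b.repr.map_eq_zero_iff.mp (DFunLike.coe_injective h2)

lemma finrank_range_of_det_ne_zero (b : Module.Basis ι O L) {g : L →ₗ[O] L}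
    (h : LinearMap.det g ≠ 0) :
    Module.finrank O (LinearMap.range g) = Module.finrank O L :=
  (LinearEquiv.ofInjective g (injective_of_det_ne_zero b h)).finrank_eq.symm

/-- `g` is the inclusion of its range preceded by an isomorphism. Changing that isomorphism alters
the determinant by a unit, and in adapted bases the inclusion is diagonal. -/
lemma associated_det_prod_smithCoeffs (b : Module.Basis ι O L) {g : L →ₗ[O] L}
    (h : LinearMap.det g ≠ 0) : Associated (LinearMap.det g)
      (∏ i, Submodule.smithNormalFormCoeffs b (finrank_range_of_det_ne_zero b h) i) := by
  set hr := finrank_range_of_det_ne_zero b h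
  let a := Submodule.smithNormalFormCoeffs b hr
  let b' := Submodule.smithNormalFormTopBasis b hr
  let ab := Submodule.smithNormalFormBotBasis b hr
  have h1 := LinearMap.associated_det_comp_equiv (LinearMap.range g).subtype
    (LinearEquiv.ofInjective g (injective_of_det_ne_zero b h)) (b'.equiv ab (Equiv.refl ι))
  have h2 : (LinearMap.range g).subtype ∘ₗ
      (LinearEquiv.ofInjective g (injective_of_det_ne_zero b h)).toLinearMap = g := by
    ext x
    rfl
  have h3 : LinearMap.toMatrix b' b' ((LinearMap.range g).subtype ∘ₗ
      (b'.equiv ab (Equiv.refl ι)).toLinearMap) = Matrix.diagonal a := by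
    ext i j
    have h4 : ((ab j : LinearMap.range g) : L) = a j • b' j :=
      Submodule.smithNormalFormBotBasis_def b hr j
    rw [LinearMap.toMatrix_apply, LinearMap.comp_apply, LinearEquiv.coe_coe, Module.Basis.equiv_apply,
      Equiv.refl_apply, Submodule.subtype_apply, h4, map_smul, Finsupp.smul_apply,
      Module.Basis.repr_self, Matrix.diagonal_apply, Finsupp.single_apply, smul_eq_mul]
    by_cases hij : i = j
    · subst hij
      simp
    · rw [if_neg hij, if_neg (fun h => hij h.symm), mul_zero]
  rw [h2, ← LinearMap.det_toMatrix b' (_ ∘ₗ (b'.equiv ab (Equiv.refl ι)).toLinearMap), h3,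
    Matrix.det_diagonal] at h1
  exact h1

lemma ord_prod {a : ι → O} (s : Finset ι) (h : ∀ i ∈ s, a i ≠ 0) :
    Ring.ord O (∏ i ∈ s, a i) = ∑ i ∈ s, Ring.ord O (a i) := by
  induction s using Finset.induction_on with
  | empty => simp
  | insert i s hi ih =>
    rw [Finset.prod_insert hi, Finset.sum_insert hi, Ring.ord_mul _ (mem_nonZeroDivisors_of_ne_zero
      (Finset.prod_ne_zero_iff.mpr fun j hj => h j (Finset.mem_insert_of_mem hj))),
      ih fun j hj => h j (Finset.mem_insert_of_mem hj)]

/-- The length of the cokernel of an injective endomorphism is the order of its determinant. -/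
lemma length_quotient_range (b : Module.Basis ι O L) {g : L →ₗ[O] L}
    (h : LinearMap.det g ≠ 0) :
    Module.length O (L ⧸ LinearMap.range g) = Ring.ord O (LinearMap.det g) := by
  have h1 := associated_det_prod_smithCoeffs b h
  rw [Ring.ord_eq_of_associated h1, ord_prod, ((LinearMap.range g).quotientEquivPiSpan b
    (finrank_range_of_det_ne_zero b h)).length_eq, Module.length_pi_of_fintype]
  · rfl
  · intro i _
    exact Submodule.smithNormalFormCoeffs_ne_zero b _ i

lemma exists_basis_range_eq {O : Type*} [CommRing O] [IsDomain O] [IsDiscreteValuationRing O]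
    {L : Type*} [AddCommGroup L] [Module O L] {π : O} (hπ : Irreducible π)
    (b : Module.Basis ι O L) {g : L →ₗ[O] L} (h : LinearMap.det g ≠ 0) :
    ∃ (b' : Module.Basis ι O L) (c : ι → ℕ),
      LinearMap.range g = Submodule.span O (Set.range fun i => π ^ c i • b' i) ∧
      Associated (LinearMap.det g) (π ^ ∑ i, c i) := by
  set hr := finrank_range_of_det_ne_zero b h
  let a := Submodule.smithNormalFormCoeffs b hr
  let b' := Submodule.smithNormalFormTopBasis b hr
  let ab := Submodule.smithNormalFormBotBasis b hr
  have ha : ∀ i, ((ab i : LinearMap.range g) : L) = a i • b' i := fun i =>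
    Submodule.smithNormalFormBotBasis_def b hr i
  choose c hc using fun i => IsDiscreteValuationRing.associated_pow_irreducible
    (Submodule.smithNormalFormCoeffs_ne_zero b hr i) hπ
  have h0 : LinearMap.range g = Submodule.span O (Set.range fun i => a i • b' i) := by
    have h1 := congrArg (Submodule.map (LinearMap.range g).subtype) ab.span_eq
    rw [Submodule.map_span, Submodule.map_top, Submodule.range_subtype, ← Set.range_comp] at h1
    rw [← h1]
    congr 2
    exact funext ha
  refine ⟨b', c, ?_, (associated_det_prod_smithCoeffs b h).trans ?_⟩
  · rw [h0]
    apply le_antisymm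
    · rw [Submodule.span_le]
      rintro _ ⟨i, rfl⟩
      obtain ⟨w, hw⟩ := (hc i).symm
      have : a i • b' i = (w : O) • π ^ c i • b' i := by
        rw [smul_smul, mul_comm, hw]
      simp only [SetLike.mem_coe]
      rw [this]
      exact Submodule.smul_mem _ _ (Submodule.subset_span ⟨i, rfl⟩)
    · rw [Submodule.span_le]
      rintro _ ⟨i, rfl⟩
      obtain ⟨w, hw⟩ := hc i
      have : π ^ c i • b' i = (w : O) • a i • b' i := by
        rw [smul_smul, mul_comm, hw]
      simp only [SetLike.mem_coe]
      rw [this]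
      exact Submodule.smul_mem _ _ (Submodule.subset_span ⟨i, rfl⟩)
  · rw [← Finset.prod_pow_eq_pow_sum]
    exact Associated.prod _ _ _ fun i _ => hc i

end Determinants

/-! ### Relative position of lattices in adapted coordinates -/

section RelativePosition

variable {O : Type*} [CommRing O] [IsDomain O] [IsPrincipalIdealRing O] {π : O}
  {V : Type*} [AddCommGroup V] [Module O V] {ι : Type*} [Fintype ι]

variable (π) in
/-- The functions whose values at the `i` with `a i < n` are divisible by `π`. -/
def coordFil (a : ι → ℤ) (n : ℤ) : Submodule O (ι → O) where
  carrier := {f | ∀ i, a i < n → π ∣ f i}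
  zero_mem' := fun _ _ => dvd_zero π
  add_mem' hf hg := fun i hi => dvd_add (hf i hi) (hg i hi)
  smul_mem' c _ hf := fun i hi => Dvd.dvd.mul_left (hf i hi) c

/-- The graded piece is a product of copies of `O / π`, one for each `i` with `a i = n`. -/
lemma relLength_coordFil (hπ : Irreducible π) (a : ι → ℤ) (n : ℤ) :
    relLength (coordFil π a (n + 1)) (coordFil π a n) = Fintype.card {i // a i = n} := by
  let g : (ι → O) →ₗ[O] ({i // a i = n} → O ⧸ Ideal.span {π}) :=
    LinearMap.pi fun i => (Submodule.mkQ (Ideal.span {π})) ∘ₗ LinearMap.proj i.1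
  have hg : ∀ f i, g f i = 0 ↔ π ∣ f i.1 := fun f i =>
    (Submodule.Quotient.mk_eq_zero _).trans Ideal.mem_span_singleton
  have h := relLength_map g (a := coordFil π a (n + 1)) (b := coordFil π a n)
    (fun _ hf i hi => hf i (hi.trans (lt_add_one n))) (by
      rintro f ⟨hf, hf'⟩ i hi
      rcases (Int.lt_add_one_iff.mp hi).lt_or_eq with h | h
      · exact hf' i h
      · exact (hg f ⟨i, h⟩).mp (congrFun hf ⟨i, h⟩))
  have h1 : (coordFil π a (n + 1)).map g = ⊥ := by
    rw [eq_bot_iff]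
    rintro _ ⟨f, hf, rfl⟩
    exact funext fun i => (hg f i).mpr (hf i (by rw [i.2]; exact lt_add_one n))
  have h2 : (coordFil π a n).map g = ⊤ := by
    classical
    rw [eq_top_iff]
    rintro y -
    choose x hx using fun i => Submodule.mkQ_surjective _ (y i)
    refine ⟨fun i => if hi : a i = n then x ⟨i, hi⟩ else 0, fun i hi => ?_, funext fun i => ?_⟩
    · simp only [dif_neg hi.ne, dvd_zero]
    · change Submodule.mkQ _ (if hi : a i.1 = n then x ⟨i.1, hi⟩ else 0) = y i
      rw [dif_pos i.2, hx]
  have h3 : Module.length O (O ⧸ Ideal.span {π}) = 1 := Ring.ord_of_irreducible hπ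
  rw [← h, h1, h2, relLength_bot_top, Module.length_pi, h3, mul_one, ENat.card_eq_coe_fintype_card]

variable {β : ι → V} {m : ℕ} {c : ι → ℕ} {L₂ : Submodule O V}

/-- `L₂` has coordinates `π ^ (c i - m)`, with `π ^ m` clearing denominators. At least one of
`n.toNat` and `(-n).toNat` is zero, so the divisibility is membership in `π ^ n L₂` written without
negative exponents. -/
lemma mem_zpowSMul_iff (hV : ∀ v : V, π • v = 0 → v = 0) (hβ : LinearIndependent O β)
    (hL : L₂.map (LinearMap.lsmul O V (π ^ m)) =
      Submodule.span O (Set.range fun i => π ^ c i • β i)) (n : ℤ) (f : ι → O) :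
    Fintype.linearCombination O β f ∈ zpowSMul π n L₂ ↔
      ∀ i, π ^ (n.toNat + c i) ∣ π ^ (m + (-n).toNat) * f i := by
  have hV' : ∀ (j : ℕ) {v w : V}, π ^ j • v = π ^ j • w → v = w := by
    intro j
    induction j with
    | zero => intro v w h; simpa using h
    | succ j ih =>
      intro v w h
      rw [pow_succ, mul_smul, mul_smul] at h
      have h1 := ih h
      rw [← sub_eq_zero, ← smul_sub] at h1
      exact sub_eq_zero.mp (hV _ h1)
  have hinj : Function.Injective (Fintype.linearCombination O β) :=
    linearIndependent_iff_injective_fintypeLinearCombination.mp hβ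
  have hdiag : ∀ g : ι → O, ∑ i, g i • π ^ c i • β i
      = Fintype.linearCombination O β fun i => π ^ c i * g i := by
    intro g
    rw [Fintype.linearCombination_apply]
    exact Finset.sum_congr rfl fun i _ => by rw [smul_smul, mul_comm]
  rw [zpowSMul, Submodule.mem_comap]
  constructor
  · rintro ⟨y, hy, hyf⟩ i
    have h1 : π ^ m • y ∈ Submodule.span O (Set.range fun i => π ^ c i • β i) := hL ▸ ⟨y, hy, rfl⟩
    obtain ⟨g, hg⟩ := (Submodule.mem_span_range_iff_exists_fun O).mp h1
    rw [hdiag] at hg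
    have h2 : Fintype.linearCombination O β (π ^ n.toNat • fun i => π ^ c i * g i)
        = Fintype.linearCombination O β (π ^ (m + (-n).toNat) • f) := by
      rw [map_smul, map_smul, hg, pow_add, mul_smul, smul_comm]
      exact congrArg (π ^ m • ·) hyf
    have h3 := congrFun (hinj h2) i
    simp only [Pi.smul_apply, smul_eq_mul] at h3
    exact ⟨g i, by rw [← h3, pow_add, mul_assoc]⟩
  · intro h
    choose g hg using h
    have h1 : Fintype.linearCombination O β (fun i => π ^ c i * g i)
        ∈ L₂.map (LinearMap.lsmul O V (π ^ m)) := by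
      rw [hL, ← hdiag]
      exact (Submodule.mem_span_range_iff_exists_fun O).mpr ⟨g, rfl⟩
    obtain ⟨y, hy, hyg⟩ := h1
    refine ⟨y, hy, hV' m ?_⟩
    have h2 : π ^ n.toNat • (π ^ m • y) = π ^ m • (π ^ (-n).toNat • Fintype.linearCombination O β f) := by
      have h3 : π ^ m • y = Fintype.linearCombination O β (fun i => π ^ c i * g i) := hyg
      rw [h3, smul_smul, ← pow_add, ← map_smul, ← map_smul]
      congr 1
      funext i
      simp only [Pi.smul_apply, smul_eq_mul]
      rw [hg, pow_add, mul_assoc]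
    rw [smul_comm] at h2
    exact h2

/-- Coordinates with `m - c i ≥ n` lie in `π ^ n L₂` without condition. The other coordinates of an
element of `π ^ n L₂ ∩ L₁` are divisible by `π`, hence vanish modulo `π L₁`. -/
lemma relFil_eq_map (hπ : π ≠ 0) (hV : ∀ v : V, π • v = 0 → v = 0) (hβ : LinearIndependent O β)
    (hL : L₂.map (LinearMap.lsmul O V (π ^ m)) =
      Submodule.span O (Set.range fun i => π ^ c i • β i)) (n : ℤ) :
    relFil π (Submodule.span O (Set.range β)) L₂ n
      = (coordFil π (fun i => (m : ℤ) - c i) n).map (Fintype.linearCombination O β) := by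
  classical
  have hrange : Submodule.span O (Set.range β) = LinearMap.range (Fintype.linearCombination O β) :=
    (Fintype.range_linearCombination O β).symm
  have hz := mem_zpowSMul_iff hV hβ hL n
  rw [relFil, hrange]
  apply le_antisymm
  · refine sup_le ?_ ?_
    · rintro _ ⟨hx, f, rfl⟩
      refine ⟨f, fun i hi => ?_, rfl⟩
      have h1 := (hz f).mp hx i
      have hi' : (m : ℤ) - c i < n := hi
      obtain ⟨s, hs⟩ := Nat.exists_eq_add_of_le (show m + (-n).toNat + 1 ≤ n.toNat + c i by omega)
      rw [hs, pow_add, pow_succ, mul_assoc, mul_dvd_mul_iff_left (pow_ne_zero _ hπ)] at h1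
      exact dvd_of_mul_right_dvd h1
    · rintro _ ⟨_, ⟨f, rfl⟩, rfl⟩
      exact ⟨π • f, fun i _ => Dvd.intro _ rfl, map_smul _ _ _⟩
  · rintro _ ⟨f, hf, rfl⟩
    have h1 : ∀ i, ∃ h, (m : ℤ) - c i < n → f i = π * h := fun i => by
      by_cases hi : (m : ℤ) - c i < n
      · obtain ⟨h, hh⟩ := hf i hi
        exact ⟨h, fun _ => hh⟩
      · exact ⟨0, fun h => absurd h hi⟩
    choose h hh using h1
    have h2 : f = (fun i => if (m : ℤ) - c i < n then 0 else f i)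
        + π • (fun i => if (m : ℤ) - c i < n then h i else 0) := by
      funext i
      by_cases hi : (m : ℤ) - c i < n
      · simp [hi, hh i hi]
      · simp [hi]
    rw [h2, map_add, map_smul]
    refine Submodule.add_mem_sup ⟨(hz _).mpr fun i => ?_, LinearMap.mem_range_self _ _⟩
      ⟨_, LinearMap.mem_range_self _ _, rfl⟩
    by_cases hi : (m : ℤ) - c i < n
    · simp [hi]
    · rw [if_neg hi]
      exact Dvd.dvd.mul_right (pow_dvd_pow π (by omega)) _

lemma nu_eq_sum (hπ : Irreducible π) (hV : ∀ v : V, π • v = 0 → v = 0)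
    (hβ : LinearIndependent O β) (hL : L₂.map (LinearMap.lsmul O V (π ^ m)) =
      Submodule.span O (Set.range fun i => π ^ c i • β i)) :
    nu π (Submodule.span O (Set.range β)) L₂ = ∑ i, ((m : ℤ) - c i) := by
  classical
  have hinj : Function.Injective (Fintype.linearCombination O β) :=
    linearIndependent_iff_injective_fintypeLinearCombination.mp hβ
  let a : ι → ℤ := fun i => (m : ℤ) - c i
  have key : ∀ n : ℤ, relLength (relFil π (Submodule.span O (Set.range β)) L₂ (n + 1))
      (relFil π (Submodule.span O (Set.range β)) L₂ n) = Fintype.card {i // a i = n} := by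
    intro n
    rw [relFil_eq_map hπ.ne_zero hV hβ hL, relFil_eq_map hπ.ne_zero hV hβ hL, relLength_map,
      relLength_coordFil hπ]
    · exact fun f hf i hi => hf i (hi.trans (lt_add_one n))
    · rw [LinearMap.ker_eq_bot.mpr hinj, bot_inf_eq]
      exact bot_le
  have h1 : nu π (Submodule.span O (Set.range β)) L₂
      = ∑ᶠ n : ℤ, n * (Fintype.card {i // a i = n} : ℤ) := by
    rw [nu]
    refine finsum_congr fun n => ?_
    have h2 := congrArg ENat.toNat (key n)
    rw [ENat.toNat_natCast, relLength] at h2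
    rw [h2]
  rw [h1, finsum_eq_sum_of_support_subset (s := Finset.univ.image a)]
  · rw [Finset.sum_comp (fun n : ℤ => n) a]
    refine Finset.sum_congr rfl fun n _ => ?_
    rw [Fintype.card_subtype, nsmul_eq_mul, mul_comm]
  · intro n hn
    rw [Function.mem_support] at hn
    have h2 : Fintype.card {i // a i = n} ≠ 0 := fun h0 => hn (by rw [h0]; simp)
    obtain ⟨i, hi⟩ := Fintype.card_pos_iff.mp (Nat.pos_of_ne_zero h2)
    rw [Finset.coe_image]
    exact ⟨i, by simp, hi⟩

end RelativePosition

/-! ### The discrete valuation ring `𝔖_(E)` -/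

section LocalRing

variable {p : ℕ} [hp : Fact p.Prime] {k : Type u} [Field k] [CharP k p] [PerfectRing k p]
  (E : (WittVector p k)[X]) [hE : IsUniformizerPoly p k E]

lemma coe_E_ne_zero : (E : BK p k) ≠ 0 := by
  rw [Ne, Polynomial.coe_eq_zero_iff]
  exact hE.monic.ne_zero

lemma prime_E : Prime (E : BK p k) :=
  (Ideal.span_singleton_prime (coe_E_ne_zero E)).mp inferInstance

lemma algebraMap_LocE_injective : Function.Injective (algebraMap (BK p k) (LocE E)) :=
  IsLocalization.injective (LocE E)
    (Ideal.primeCompl_le_nonZeroDivisors (Ideal.span {(E : BK p k)}))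

lemma maximalIdeal_LocE : IsLocalRing.maximalIdeal (LocE E)
    = Ideal.span {algebraMap (BK p k) (LocE E) (E : BK p k)} := by
  have h := Localization.AtPrime.map_eq_maximalIdeal (I := Ideal.span {(E : BK p k)})
  rw [Ideal.map_span, Set.image_singleton] at h
  exact h.symm

instance : IsDiscreteValuationRing (LocE E) := by
  have hne : ¬ IsField (LocE E) := by
    intro h
    have h1 := IsLocalRing.isField_iff_maximalIdeal_eq.mp h
    rw [maximalIdeal_LocE, Ideal.span_singleton_eq_bot] at h1
    exact coe_E_ne_zero E (algebraMap_LocE_injective E (h1.trans (map_zero _).symm))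
  have h1 : (IsLocalRing.maximalIdeal (LocE E)).IsPrincipal := ⟨_, maximalIdeal_LocE E⟩
  exact ((IsDiscreteValuationRing.TFAE (LocE E) hne).out 4 0).mp h1

lemma irreducible_algebraMap_E : Irreducible (algebraMap (BK p k) (LocE E) (E : BK p k)) :=
  (IsDiscreteValuationRing.irreducible_iff_uniformizer _).mpr (maximalIdeal_LocE E)

end LocalRing

/-! ### The matrix of Frobenius and its determinant -/

section FrobeniusMatrix

variable {p : ℕ} [hp : Fact p.Prime] {k : Type u} [Field k] [CharP k p] [PerfectRing k p]
  {E : (WittVector p k)[X]} [hE : IsUniformizerPoly p k E]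
  {M : Type v} [AddCommGroup M] [Module (BK p k) M]
  {ι : Type*} (b : Module.Basis ι (BK p k) M)

lemma Pullback.span_incl_basis :
    Submodule.span (BK p k) (Set.range fun i => Pullback.incl (phi p k) (b i)) = ⊤ := by
  rw [eq_top_iff, ← Pullback.span_incl, Submodule.span_le]
  rintro _ ⟨x, rfl⟩
  rw [← b.linearCombination_repr x, Finsupp.linearCombination_apply, Finsupp.sum, map_sum]
  refine Submodule.sum_mem _ fun i _ => ?_
  rw [map_smulₛₗ]
  exact Submodule.smul_mem _ _ (Submodule.subset_span ⟨i, rfl⟩)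

lemma frobLattice_eq_span (F : KisinStr p k E M) : frobLattice F = Submodule.span (BK p k)
    (Set.range fun i => F (Away.mk _ (Pullback.incl (phi p k) (b i)))) := by
  rw [frobLattice, stdLattice, ← Submodule.map_top, ← Pullback.span_incl_basis b,
    Submodule.map_span, Submodule.map_span, ← Set.range_comp, ← Set.range_comp]
  rfl

lemma Away.mk_injective_of_basis (b : Module.Basis ι (BK p k) M) :
    Function.Injective (Away.mk (E : BK p k) (M := M)) := by
  have : Module.Free (BK p k) M := Module.Free.of_basis b
  rw [← LinearMap.ker_eq_bot, LinearMap.ker_eq_bot']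
  intro x hx
  obtain ⟨n, hn⟩ := Away.mk_eq_zero.mp hx
  exact smul_right_injective M (pow_ne_zero n (coe_E_ne_zero E)) (by simpa using hn)

/-- On bases, `E ^ m φ_M` is given by an endomorphism of `M`, for some `m`. -/
lemma exists_frob_endomorphism [Finite ι] (F : KisinStr p k E M) :
    ∃ (m : ℕ) (g : M →ₗ[BK p k] M), ∀ j, Away.mk (E : BK p k) (g (b j))
      = (E : BK p k) ^ m • F (Away.mk _ (Pullback.incl (phi p k) (b j))) := by
  have := Fintype.ofFinite ι
  choose n x hx using fun j => Away.exists_pow_smul (E := (E : BK p k))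
    (F (Away.mk _ (Pullback.incl (phi p k) (b j))))
  -- The sum of the exponents is a common denominator. `g` is linear although Frobenius is not: it
  -- is read from the basis `1 ⊗ b j` of `φ^* M` to the basis `b j` of `M`.
  refine ⟨∑ j, n j, b.constr (BK p k) fun j => (E : BK p k) ^ (∑ j, n j - n j) • x j,
    fun j => ?_⟩
  rw [b.constr_basis, map_smul, ← hx, smul_smul, ← pow_add, Nat.sub_add_cancel]
  exact Finset.single_le_sum (f := n) (fun _ _ => Nat.zero_le _) (Finset.mem_univ j)

variable {b} {F : KisinStr p k E M} {m : ℕ} {g : M →ₗ[BK p k] M}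

lemma exists_pow_smul_mem_range (hg : ∀ j, Away.mk (E : BK p k) (g (b j))
      = (E : BK p k) ^ m • F (Away.mk _ (Pullback.incl (phi p k) (b j)))) (x : M) :
    ∃ t : ℕ, (E : BK p k) ^ t • x ∈ LinearMap.range g := by
  obtain ⟨z, hz⟩ := F.surjective (Away.mk _ x)
  obtain ⟨s, w, hw⟩ := Away.exists_pow_smul z
  have h1 : F (Away.mk _ w) ∈ frobLattice F := ⟨_, ⟨w, rfl⟩, rfl⟩
  rw [frobLattice_eq_span b] at h1
  have h2 : (E : BK p k) ^ m • F (Away.mk _ w) ∈ (LinearMap.range g).map (Away.mk (E : BK p k)) := by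
    have h3 : (E : BK p k) ^ m • F (Away.mk _ w) ∈ (Submodule.span (BK p k)
        (Set.range fun i => F (Away.mk _ (Pullback.incl (phi p k) (b i))))).map
          (LinearMap.lsmul (BK p k) _ ((E : BK p k) ^ m)) := ⟨_, h1, rfl⟩
    rw [Submodule.map_span] at h3
    refine Submodule.span_le.mpr ?_ h3
    rintro _ ⟨_, ⟨j, rfl⟩, rfl⟩
    exact ⟨g (b j), ⟨b j, rfl⟩, hg j⟩
  obtain ⟨y, hy, hyw⟩ := h2
  refine ⟨m + s, ?_⟩
  have h4 : Away.mk (E : BK p k) y = Away.mk (E : BK p k) ((E : BK p k) ^ (m + s) • x) := by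
    rw [hyw, ← hw, FrobStr.map_smul_base, hz, smul_smul, ← pow_add, map_smul]
  rw [← Away.mk_injective_of_basis b h4]
  exact hy

/-- Surjectivity of `F` gives an `h` with `g ∘ h` a power of `E`. So `det g` divides a power of the
prime `E`. -/
lemma exists_associated_det [Fintype ι] [DecidableEq ι]
    (hg : ∀ j, Away.mk (E : BK p k) (g (b j))
      = (E : BK p k) ^ m • F (Away.mk _ (Pullback.incl (phi p k) (b j)))) :
    ∃ a : ℕ, Associated (LinearMap.det g) ((E : BK p k) ^ a) := by
  have : Module.Free (BK p k) M := Module.Free.of_basis b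
  choose t y hy using fun j => exists_pow_smul_mem_range hg (b j)
  have h1 : g ∘ₗ (b.constr (BK p k) fun j => (E : BK p k) ^ (∑ j, t j - t j) • y j)
      = (E : BK p k) ^ (∑ j, t j) • LinearMap.id := by
    refine b.ext fun j => ?_
    rw [LinearMap.comp_apply, b.constr_basis, map_smul, hy, smul_smul, ← pow_add,
      Nat.sub_add_cancel]
    · rfl
    · exact Finset.single_le_sum (f := t) (fun _ _ => Nat.zero_le _) (Finset.mem_univ j)
  have h2 := congrArg LinearMap.det h1
  rw [LinearMap.det_comp, LinearMap.det_smul, LinearMap.det_id, mul_one, ← pow_mul] at h2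
  obtain ⟨a, -, ha⟩ := (dvd_prime_pow (prime_E E) _).mp ⟨_, h2.symm⟩
  exact ⟨a, ha⟩

end FrobeniusMatrix

/-! ### The degree of a Kisin module from the determinant -/

section DegreeOfKisinModule

variable {p : ℕ} [hp : Fact p.Prime] {k : Type u} [Field k] [CharP k p] [PerfectRing k p]
  {E : (WittVector p k)[X]} [hE : IsUniformizerPoly p k E]
  {M : Type v} [AddCommGroup M] [Module (BK p k) M]
  {ι : Type*} {b : Module.Basis ι (BK p k) M}

/-- The map `M[1/E] → M[1/E]_(E)`. -/
noncomputable abbrev toLoc (E : (WittVector p k)[X]) [IsUniformizerPoly p k E] (M : Type v)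
    [AddCommGroup M] [Module (BK p k) M] : Away (E : BK p k) M →ₗ[BK p k]
      LocalizedModule (Ideal.span {(E : BK p k)}).primeCompl (Away (E : BK p k) M) :=
  LocalizedModule.mkLinearMap (Ideal.span {(E : BK p k)}).primeCompl (Away (E : BK p k) M)

lemma toLoc_smul (a : BK p k) (y : Away (E : BK p k) M) :
    toLoc E M (a • y) = algebraMap (BK p k) (LocE E) a • toLoc E M y := by
  rw [map_smul, algebraMap_smul]

lemma localLattice_span (S : Set (Away (E : BK p k) M)) :
    localLattice (Submodule.span (BK p k) S) = Submodule.span (LocE E) (toLoc E M '' S) := by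
  apply le_antisymm
  · rw [localLattice, Submodule.span_le]
    rintro _ ⟨y, hy, rfl⟩
    have h1 : (Submodule.span (BK p k) S) ≤ ((Submodule.span (LocE E)
        (toLoc E M '' S)).restrictScalars (BK p k)).comap (toLoc E M) :=
      Submodule.span_le.mpr fun z hz => Submodule.subset_span ⟨z, hz, rfl⟩
    exact h1 hy
  · exact Submodule.span_mono (Set.image_mono Submodule.subset_span)

lemma eq_zero_of_smul_toLoc_eq_zero
    (v : LocalizedModule (Ideal.span {(E : BK p k)}).primeCompl (Away (E : BK p k) M))
    (hv : algebraMap (BK p k) (LocE E) (E : BK p k) • v = 0) : v = 0 := by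
  obtain ⟨⟨y, s⟩, hy⟩ := IsLocalizedModule.surj (Ideal.span {(E : BK p k)}).primeCompl
    (toLoc E M) v
  have h1 : toLoc E M ((E : BK p k) • y) = 0 := by
    have h2 : toLoc E M ((E : BK p k) • y) = (s : BK p k) • (E : BK p k) • v := by
      rw [map_smul]
      change _ • toLoc E M (y, s).1 = _
      rw [← hy, smul_comm]
      rfl
    rw [h2, ← algebraMap_smul (LocE E) (E : BK p k) v, hv, smul_zero]
  obtain ⟨t, ht⟩ := (IsLocalizedModule.eq_zero_iff
    (Ideal.span {(E : BK p k)}).primeCompl (toLoc E M)).mp h1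
  have h3 : t • y = 0 := by
    apply Away.pow_smul_injective 1 (E := (E : BK p k))
    rw [pow_one, smul_zero, smul_comm]
    exact ht
  have h4 : toLoc E M y = 0 := (IsLocalizedModule.eq_zero_iff
    (Ideal.span {(E : BK p k)}).primeCompl (toLoc E M)).mpr ⟨t, h3⟩
  have h5 : s • v = 0 := hy.trans h4
  exact IsLocalizedModule.smul_injective (toLoc E M) s (h5.trans (smul_zero s).symm)

variable {F : KisinStr p k E M} {m : ℕ} {g : M →ₗ[BK p k] M}

/-- Over `𝔖_(E)` the Smith form of `g` has exponents `c i` with sum `a`, and `g` represents `E ^ m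
φ_M`. The relative position is therefore `m - c i`. -/
lemma kisinDegree_eq [Fintype ι] [DecidableEq ι] (hg : ∀ j, Away.mk (E : BK p k) (g (b j))
      = (E : BK p k) ^ m • F (Away.mk _ (Pullback.incl (phi p k) (b j)))) {a : ℕ}
    (ha : Associated (LinearMap.det g) ((E : BK p k) ^ a)) :
    kisinDegree F = m * Fintype.card ι - a := by
  set ϖ := algebraMap (BK p k) (LocE E) (E : BK p k) with hϖ
  have hirr : Irreducible ϖ := irreducible_algebraMap_E E
  let β₀ : ι → LocalizedModule (Ideal.span {(E : BK p k)}).primeCompl (Away (E : BK p k) M) :=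
    fun i => toLoc E M (Away.mk (E : BK p k) (b i))
  have hβ₀ : LinearIndependent (LocE E) β₀ := by
    have h1 : LinearIndependent (BK p k) (Away.mk (E : BK p k) ∘ b) :=
      b.linearIndependent.map' _ (LinearMap.ker_eq_bot.mpr (Away.mk_injective_of_basis b))
    exact h1.of_isLocalizedModule (LocE E) (Ideal.span {(E : BK p k)}).primeCompl (toLoc E M)
  let Λ := Fintype.linearCombination (LocE E) β₀
  have hΛ : Function.Injective Λ := linearIndependent_iff_injective_fintypeLinearCombination.mp hβ₀
  let G := LinearMap.toMatrix b b g
  let g' := Matrix.toLin' (G.map (algebraMap (BK p k) (LocE E)))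
  have hdet : LinearMap.det g' = algebraMap (BK p k) (LocE E) (LinearMap.det g) := by
    rw [LinearMap.det_toLin', ← LinearMap.det_toMatrix b, RingHom.map_det]
    rfl
  have hassoc : Associated (LinearMap.det g') (ϖ ^ a) := by
    rw [hdet, hϖ, ← map_pow]
    exact ha.map (algebraMap (BK p k) (LocE E))
  have hdet0 : LinearMap.det g' ≠ 0 := fun h0 =>
    pow_ne_zero a hirr.ne_zero ((hassoc.eq_zero_iff).mp h0)
  obtain ⟨b', c, hrange, hc⟩ := exists_basis_range_eq hirr (Pi.basisFun (LocE E) ι) hdet0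
  have hsum : ∑ i, c i = a := by
    have h1 := hc.symm.trans hassoc
    exact le_antisymm ((pow_dvd_pow_iff hirr.ne_zero hirr.not_isUnit).mp h1.dvd)
      ((pow_dvd_pow_iff hirr.ne_zero hirr.not_isUnit).mp h1.symm.dvd)
  have hβ : LinearIndependent (LocE E) (fun i => Λ (b' i)) :=
    b'.linearIndependent.map' _ (LinearMap.ker_eq_bot.mpr hΛ)
  have hspan : Submodule.span (LocE E) (Set.range fun i => Λ (b' i)) = localLattice (stdLattice E M) := by
    have h1 : stdLattice E M = Submodule.span (BK p k) (Set.range (Away.mk (E : BK p k) ∘ b)) := by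
      rw [Set.range_comp, ← Submodule.map_span, b.span_eq, Submodule.map_top, stdLattice]
    have h2 : Set.range (fun i => Λ (b' i)) = Λ '' Set.range b' := by rw [← Set.range_comp]; rfl
    rw [h1, localLattice_span, h2, ← Submodule.map_span, b'.span_eq, Submodule.map_top,
      Fintype.range_linearCombination, ← Set.range_comp]
    rfl
  have hΛg : ∀ j, Λ (g' (Pi.single j 1)) = toLoc E M (Away.mk (E : BK p k) (g (b j))) := by
    intro j
    rw [Matrix.toLin'_apply, Matrix.mulVec_single_one, Fintype.linearCombination_apply]
    conv_rhs => rw [← b.sum_repr (g (b j)), map_sum, map_sum]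
    refine Finset.sum_congr rfl fun i _ => ?_
    rw [map_smul, toLoc_smul]
    simp only [G, Matrix.col_apply, Matrix.map_apply, LinearMap.toMatrix_apply]
    rfl
  have hL : (localLattice (frobLattice F)).map (LinearMap.lsmul (LocE E) _ (ϖ ^ m))
      = Submodule.span (LocE E) (Set.range fun i => ϖ ^ c i • Λ (b' i)) := by
    have h1 : Submodule.span (LocE E) (Set.range fun i => ϖ ^ c i • Λ (b' i))
        = (LinearMap.range g').map Λ := by
      rw [hrange, Submodule.map_span, ← Set.range_comp]
      congr 2
      funext i
      exact (map_smul Λ _ _).symm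
    have h2 : (LinearMap.range g').map Λ = Submodule.span (LocE E)
        (Set.range fun j => toLoc E M (Away.mk (E : BK p k) (g (b j)))) := by
      rw [← LinearMap.range_comp, ← Submodule.map_top, ← (Pi.basisFun (LocE E) ι).span_eq,
        Submodule.map_span, ← Set.range_comp]
      congr 2
      funext j
      rw [← hΛg]
      simp
    rw [h1, h2, frobLattice_eq_span b, localLattice_span, Submodule.map_span, ← Set.range_comp,
      ← Set.range_comp]
    congr 2
    funext j
    rw [hg, toLoc_smul, map_pow (algebraMap (BK p k) (LocE E))]
    rfl
  rw [kisinDegree, ← hspan, nu_eq_sum hirr eq_zero_of_smul_toLoc_eq_zero hβ hL,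
    Finset.sum_sub_distrib, Finset.sum_const, Finset.card_univ, nsmul_eq_mul, mul_comm, ← hsum]
  push_cast
  ring

end DegreeOfKisinModule

/-! ### Reduction modulo `p` and the degree of `M / p` -/

section ReductionModP

variable (p : ℕ) [hp : Fact p.Prime] (k : Type u) [Field k] [CharP k p]

/-- The reduction `W(k)⟦u⟧ → k⟦u⟧`. -/
noncomputable def modP : BK p k →+* PowerSeries k :=
  PowerSeries.map (WittVector.constantCoeff (p := p))

lemma modP_surjective : Function.Surjective (modP p k) := by
  intro f
  refine ⟨PowerSeries.mk fun n => WittVector.teichmuller p (PowerSeries.coeff n f), ?_⟩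
  ext n
  rw [modP, PowerSeries.coeff_map, PowerSeries.coeff_mk]
  simp [WittVector.constantCoeff_apply]

lemma modP_X : modP p k PowerSeries.X = PowerSeries.X := PowerSeries.map_X _

lemma modP_natCast : modP p k (p : BK p k) = 0 := by
  rw [map_natCast, ← map_natCast (PowerSeries.C : k →+* PowerSeries k), CharP.cast_eq_zero, map_zero]

variable [PerfectRing k p]

lemma exists_eq_p_mul {a : BK p k} (h : modP p k a = 0) : ∃ c, a = (p : BK p k) * c := by
  have h1 : ∀ n, ∃ c, PowerSeries.coeff n a = (p : WittVector p k) * c := by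
    intro n
    have h2 := congrArg (PowerSeries.coeff n) h
    rw [modP, PowerSeries.coeff_map, map_zero] at h2
    have h3 : PowerSeries.coeff n a ∈
      RingHom.ker (WittVector.constantCoeff (p := p) (R := k)) := h2
    rw [WittVector.ker_constantCoeff, Ideal.mem_span_singleton] at h3
    exact h3
  choose c hc using h1
  refine ⟨PowerSeries.mk c, PowerSeries.ext fun n => ?_⟩
  have h4 : (p : BK p k) = PowerSeries.C (p : WittVector p k) := (map_natCast _ p).symm
  rw [h4, PowerSeries.coeff_C_mul, PowerSeries.coeff_mk, hc]

variable {p k} {E : (WittVector p k)[X]} [hE : IsUniformizerPoly p k E]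

variable (E) in
lemma modP_E : modP p k (E : BK p k) = PowerSeries.X ^ E.natDegree := by
  obtain ⟨g, hg⟩ := exists_eq_X_pow_add (p := p) (k := k) (E := E)
  rw [hg, map_add, map_pow, map_mul, modP_natCast, zero_mul, add_zero, modP_X]

variable {M : Type v} [AddCommGroup M] [Module (BK p k) M] {ι : Type*} [Fintype ι] [DecidableEq ι]

/-- Over `k⟦u⟧` the determinant becomes `u ^ (e a)` up to a unit, and its order is the length of the
cokernel. The map `Ξ` identifies this cokernel with that of `g` on `M / p`. -/
lemma relLength_map_range_mkQ (b : Module.Basis ι (BK p k) M) {g : M →ₗ[BK p k] M} {a : ℕ}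
    (ha : Associated (LinearMap.det g) ((E : BK p k) ^ a)) :
    relLength ((LinearMap.range g).map (pPow p k M 1).mkQ) ⊤ = (E.natDegree * a : ℕ) := by
  let : Algebra (BK p k) (PowerSeries k) := (modP p k).toAlgebra
  let G := LinearMap.toMatrix b b g
  let g' := Matrix.toLin' (G.map (modP p k))
  have hdet : LinearMap.det g' = modP p k (LinearMap.det g) := by
    rw [LinearMap.det_toLin', ← LinearMap.det_toMatrix b, RingHom.map_det]
    rfl
  have hassoc : Associated (LinearMap.det g') (PowerSeries.X ^ (E.natDegree * a)) := by
    rw [hdet, pow_mul, ← modP_E E, ← map_pow]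
    exact ha.map (modP p k)
  have hX : (PowerSeries.X : PowerSeries k) ≠ 0 := PowerSeries.X_ne_zero
  have hdet0 : LinearMap.det g' ≠ 0 := fun h0 =>
    pow_ne_zero _ hX ((hassoc.eq_zero_iff).mp h0)
  have hlen : Module.length (PowerSeries k) ((ι → PowerSeries k) ⧸ LinearMap.range g')
      = (E.natDegree * a : ℕ) := by
    rw [length_quotient_range (Pi.basisFun (PowerSeries k) ι) hdet0,
      Ring.ord_eq_of_associated hassoc, Ring.ord_pow (mem_nonZeroDivisors_of_ne_zero hX),
      Ring.ord_of_irreducible PowerSeries.X_prime.irreducible, nsmul_eq_mul, mul_one]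
  let Θ : M →ₗ[BK p k] (ι → PowerSeries k) :=
    LinearMap.pi fun i => (Algebra.linearMap (BK p k) (PowerSeries k)) ∘ₗ (b.coord i)
  have hΘ : ∀ x i, Θ x i = modP p k (b.repr x i) := fun _ _ => rfl
  have hΘs : Function.Surjective Θ := by
    intro y
    choose c hc using fun i => modP_surjective p k (y i)
    refine ⟨∑ i, c i • b i, funext fun i => ?_⟩
    rw [hΘ, b.repr_sum_self, hc]
  have hΘker : ∀ x, Θ x = 0 → (pPow p k M 1).mkQ x = 0 := by
    intro x hx
    choose c hc using fun i => exists_eq_p_mul p k (congrFun hx i)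
    refine mk_pPow_eq_zero.mpr ⟨∑ i, c i • b i, ?_⟩
    rw [pow_one, Finset.smul_sum]
    conv_lhs => rw [← b.sum_repr x]
    exact Finset.sum_congr rfl fun i _ => by
      rw [smul_smul, ← hc]
      rfl
  have hΘg : ∀ x, Θ (g x) = g' (Θ x) := by
    intro x
    funext i
    rw [hΘ, ← LinearMap.toMatrix_mulVec_repr b b g x, RingHom.map_mulVec, Matrix.toLin'_apply]
    rfl
  let Ξ : M →ₗ[BK p k] ((ι → PowerSeries k) ⧸ LinearMap.range g') :=
    ((LinearMap.range g').mkQ.restrictScalars (BK p k)) ∘ₗ Θ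
  have hΞ : Function.Surjective Ξ := (Submodule.mkQ_surjective _).comp hΘs
  have hmap : (LinearMap.ker Ξ).map (pPow p k M 1).mkQ
      = (LinearMap.range g).map (pPow p k M 1).mkQ := by
    apply le_antisymm
    · rintro _ ⟨x, hx, rfl⟩
      have h1 : Θ x ∈ LinearMap.range g' := (Submodule.Quotient.mk_eq_zero _).mp hx
      obtain ⟨f, hf⟩ := h1
      obtain ⟨y, rfl⟩ := hΘs f
      refine ⟨g y, ⟨y, rfl⟩, ?_⟩
      have h2 := hΘker (g y - x) (by rw [map_sub, hΘg, hf, sub_self])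
      rwa [map_sub, sub_eq_zero] at h2
    · rintro _ ⟨_, ⟨y, rfl⟩, rfl⟩
      refine ⟨g y, ?_, rfl⟩
      exact (Submodule.Quotient.mk_eq_zero _).mpr ⟨Θ y, (hΘg y).symm⟩
  have h1 := relLength_map Ξ (a := LinearMap.ker Ξ) (b := ⊤) le_top inf_le_left
  have h2 := relLength_map (pPow p k M 1).mkQ (a := LinearMap.ker Ξ) (b := ⊤) le_top (by
    rw [Submodule.ker_mkQ, inf_top_eq]
    intro x hx
    obtain ⟨y, rfl⟩ := mem_pPow.mp hx
    refine LinearMap.mem_ker.mpr ((Submodule.Quotient.mk_eq_zero _).mpr ?_)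
    have h3 : Θ ((p : BK p k) ^ 1 • y) = 0 := funext fun i => by
      rw [hΘ, map_smul, Finsupp.smul_apply, smul_eq_mul, map_mul, pow_one, modP_natCast, zero_mul]
      rfl
    rw [h3]
    exact zero_mem _)
  have h4 : (LinearMap.ker Ξ).map Ξ = ⊥ := by
    rw [eq_bot_iff]
    rintro _ ⟨x, hx, rfl⟩
    exact hx
  rw [← hmap, ← hlen, ← Module.length_eq_of_surjective (S := BK p k) (modP_surjective p k),
    ← relLength_bot_top, ← h4]
  rw [Submodule.map_top, Submodule.range_mkQ] at h2
  rw [Submodule.map_top, LinearMap.range_eq_top.mpr hΞ] at h1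
  rw [h2, h1]

variable {b : Module.Basis ι (BK p k) M} {F : KisinStr p k E M} {m : ℕ} {g : M →ₗ[BK p k] M}

lemma frob_mem_range (hg : ∀ j, Away.mk (E : BK p k) (g (b j))
      = (E : BK p k) ^ m • F (Away.mk _ (Pullback.incl (phi p k) (b j)))) (x : M) :
    ∃ y, Away.mk (E : BK p k) (g y)
      = (E : BK p k) ^ m • F (Away.mk _ (Pullback.incl (phi p k) x)) := by
  refine ⟨∑ j, phi p k (b.repr x j) • b j, ?_⟩
  conv_rhs => rw [← b.sum_repr x]
  simp only [map_sum, map_smul, map_smulₛₗ, FrobStr.map_smul_base, Finset.smul_sum, hg]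
  exact Finset.sum_congr rfl fun j _ => smul_comm _ _ _

lemma X_pow_smul_of_killed {V : Type*} [AddCommGroup V] [Module (BK p k) V]
    (hV : ∀ v : V, (p : BK p k) • v = 0) (m : ℕ) (v : V) :
    (PowerSeries.X : BK p k) ^ (E.natDegree * m) • v = (E : BK p k) ^ m • v := by
  obtain ⟨c, hc⟩ := exists_eq_p_mul p k (a := (E : BK p k) ^ m
    - PowerSeries.X ^ (E.natDegree * m)) (by
      rw [map_sub, map_pow, map_pow, modP_E, modP_X, pow_mul, sub_self])
  rw [eq_comm, ← sub_eq_zero, ← sub_smul, hc, mul_smul, hV]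

variable [Module.Finite (BK p k) M] [Module.Free (BK p k) M]

/-- Modulo `p`, `E ^ m φ_M` becomes `u ^ (e m) φ`, so `g` provides an effective `ψ` with exponent `e
m`. The cokernel has length `e a`, and the correction term is `e m r`. -/
lemma rawDegree_reduce_one (hg : ∀ j, Away.mk (E : BK p k) (g (b j))
      = (E : BK p k) ^ m • F (Away.mk _ (Pullback.incl (phi p k) (b j)))) {a : ℕ}
    (ha : Associated (LinearMap.det g) ((E : BK p k) ^ a)) :
    rawDegree (F.reduce 1) = E.natDegree * (m * Fintype.card ι - a) := by
  have hT := isPTorsion_reduce p k M 1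
  have hkill : ∀ x : M ⧸ pPow p k M 1, (p : BK p k) ^ 1 • x = 0 := by
    intro x
    obtain ⟨x, rfl⟩ := (pPow p k M 1).mkQ_surjective x
    rw [← map_smul]
    exact mk_pPow_eq_zero.mpr ⟨x, rfl⟩
  have hkillA : ∀ v : Away (E : BK p k) (M ⧸ pPow p k M 1), (p : BK p k) • v = 0 := fun v => by
    have h := Away.killed hkill v
    rwa [pow_one] at h
  have hq := isPhiHom_mkQ F (pPow p k M 1) (isStable_smul_top F (phi_natCast_pow p k 1))
  have key : ∀ x y : M, Away.mk (E : BK p k) (g y)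
      = (E : BK p k) ^ m • F (Away.mk _ (Pullback.incl (phi p k) x)) →
      Away.mk (E : BK p k) ((pPow p k M 1).mkQ (g y))
      = (PowerSeries.X : BK p k) ^ (E.natDegree * m) • (F.reduce 1)
        (Away.mk _ (Pullback.incl (phi p k) ((pPow p k M 1).mkQ x))) := by
    intro x y hxy
    rw [X_pow_smul_of_killed hkillA, ← Away.map_mk, hxy, Away.map_smul_base]
    exact congrArg _ (hq.apply_mk x)
  obtain ⟨ψ, hψ⟩ := exists_isEff_of_forall hT (F.reduce 1) (i := E.natDegree * m) (fun x => by
    obtain ⟨x, rfl⟩ := (pPow p k M 1).mkQ_surjective x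
    obtain ⟨y, hy⟩ := frob_mem_range hg x
    exact ⟨_, key x y hy⟩)
  have hψg : ∀ x y : M, Away.mk (E : BK p k) (g y)
      = (E : BK p k) ^ m • F (Away.mk _ (Pullback.incl (phi p k) x)) →
      ψ ((pPow p k M 1).mkQ x) = (pPow p k M 1).mkQ (g y) := by
    intro x y hxy
    apply Away.mk_injective E hkill hT.noUTorsion
    rw [hψ, key x y hxy]
  have hspan : frobSpan ψ ⊤ = (LinearMap.range g).map (pPow p k M 1).mkQ := by
    apply le_antisymm
    · rw [frobSpan, Submodule.span_le]
      rintro _ ⟨x, -, rfl⟩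
      obtain ⟨x, rfl⟩ := (pPow p k M 1).mkQ_surjective x
      obtain ⟨y, hy⟩ := frob_mem_range hg x
      exact ⟨g y, ⟨y, rfl⟩, (hψg x y hy).symm⟩
    · rw [← Submodule.map_top, ← b.span_eq, Submodule.map_span, Submodule.map_span,
        Submodule.span_le]
      rintro _ ⟨_, ⟨_, ⟨j, rfl⟩, rfl⟩, rfl⟩
      exact Submodule.subset_span ⟨_, trivial, hψg (b j) (b j) (hg j)⟩
  rw [hψ.rawDegree_eq hT, delta, hspan, relLength_map_range_mkQ b ha, ENat.toNat_natCast,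
    rho_reduce_one, Module.finrank_eq_card_basis b]
  push_cast
  ring

variable (F) in
/-- The degree of a Kisin module is the degree of its reduction modulo `p`. -/
lemma torsionDegree_reduce_one : torsionDegree (F.reduce 1) = kisinDegree F := by
  classical
  let b := Module.Free.chooseBasis (BK p k) M
  obtain ⟨m, g, hg⟩ := exists_frob_endomorphism b F
  obtain ⟨a, ha⟩ := exists_associated_det hg
  have he : (E.natDegree : ℚ) ≠ 0 := Nat.cast_ne_zero.mpr hE.natDegree_pos.ne'
  rw [torsionDegree, rawDegree_reduce_one hg ha, kisinDegree_eq hg ha]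
  push_cast
  field_simp

end ReductionModP

end KisinModules

theorem theorem3p19 (p : ℕ) [Fact p.Prime] (k : Type u) [Field k] [CharP k p] [PerfectRing k p]
    (E : (WittVector p k)[X]) [KisinModules.IsUniformizerPoly p k E]
    (M : Type v) [AddCommGroup M] [Module (KisinModules.BK p k) M]
    [Module.Finite (KisinModules.BK p k) M] [Module.Free (KisinModules.BK p k) M]
    (F : KisinModules.KisinStr p k E M) (r : ℕ) (d : ℤ)
    (hr : r = Module.finrank (KisinModules.BK p k) M) (hd : d = KisinModules.kisinDegree F) :
    -- the Harder-Narasimhan filtrations defining the polygons exist and are unique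
    (∀ n : ℕ, 1 ≤ n → ∃ Φ : KisinModules.HNFlag (F.reduce n), ∀ Ψ, Ψ = Φ) ∧
    -- the function is the pointwise infimum, a genuine greatest lower bound
    (∀ x ∈ Set.Icc (0 : ℝ) r,
      IsGLB {y | ∃ n : ℕ, 1 ≤ n ∧ y = KisinModules.renormPolygon F n x}
        (KisinModules.farguesPolygon F x)) ∧
    -- uniform convergence along the positive integers ordered by divisibility
    (∀ ε : ℝ, 0 < ε → ∃ N : ℕ, 1 ≤ N ∧ ∀ n : ℕ, 1 ≤ n → N ∣ n →
      ∀ x ∈ Set.Icc (0 : ℝ) r,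
        |KisinModules.renormPolygon F n x - KisinModules.farguesPolygon F x| < ε) ∧
    ContinuousOn (KisinModules.farguesPolygon F) (Set.Icc (0 : ℝ) r) ∧
    ConcaveOn ℝ (Set.Icc (0 : ℝ) r) (KisinModules.farguesPolygon F) ∧
    KisinModules.farguesPolygon F 0 = 0 ∧
    KisinModules.farguesPolygon F r = d ∧
    -- the limit depends only on the isogeny class
    ∀ (M' : Type w) [AddCommGroup M'] [Module (KisinModules.BK p k) M']
      [Module.Finite (KisinModules.BK p k) M'] [Module.Free (KisinModules.BK p k) M']
      (F' : KisinModules.KisinStr p k E M'), KisinModules.IsIsogenous F F' →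
      Module.finrank (KisinModules.BK p k) M' = r ∧
      ∀ x ∈ Set.Icc (0 : ℝ) r,
        KisinModules.farguesPolygon F' x = KisinModules.farguesPolygon F x := by
  subst hr hd
  obtain ⟨C, hC0, hC⟩ :=
    (KisinModules.isPTorsion_reduce p k M 1).exists_lipschitz_hnPolygon (F.reduce 1)
  have h := KisinModules.isDivDecreasing_renormPolygon F hC
  refine ⟨fun n _ => (KisinModules.isPTorsion_reduce p k M n).existsUnique_flag E (F.reduce n),
    fun x hx => h.isGLB hx, fun ε hε => h.tendsto_uniformly hC0 hε, h.continuousOn hC0,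
    h.concaveOn_iInf, h.iInf_zero, ?_, fun M' _ _ _ _ F' hF' =>
      ⟨hF'.finrank_eq, fun x hx => hF'.farguesPolygon_eq hx⟩⟩
  -- All `t_n` take at `r` the degree of `M / p`, which equals that of `M`.
  refine h.iInf_last.trans ?_
  rw [KisinModules.torsionDegree_reduce_one]
  exact Rat.cast_intCast _
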